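/- Let $G$ be a compact (real, finite-dimensional) Lie group, not necessarily connected, with Lie algebra $\mathfrak g$, embedded in a finite-dimensional real vector space $V$ by a smooth embedding $\iota$. Let $I=[0,1]$ and let $m$ be a natural number. A map $u:I^m\to G$ belongs to $W^{1,2}(I^m,G)$ if $\iota\circ u\in W^{1,2}(I^m,V)$, that is, $\iota\circ u$ is in $L^2$ and has weak first partial derivatives in $L^2$. For such a map and a $\mathfrak g$-valued $1$-form $A=\sum_i A_i\,dx^i$, the equation $A=u^{-1}du$ means that for every $i$ the weak derivative $\partial_i(\iota\circ u)$ is equal almost everywhere to $d\iota_{u}\big(u\cdot A_i\big)$, where $u\cdot A_i\in T_uG$ is the image of $A_i$ under the differential of left multiplication by $u$. Theorem. Given any $L^2$ $\mathfrak g$-valued $1$-form $A$ on $I^m$ such that $$dA+\tfrac12[A,A]=0$$ in the sense of distributions (i.e. $\partial_iA_j-\partial_jA_i+[A_i,A_j]=0$ for all $i,j$ when tested against smooth functions compactly supported in the interior of $I^m$), there exists $u\in W^{1,2}(I^m,G)$ such that $u^{-1}\in W^{1,2}(I^m,G)$ and $A=u^{-1}du$. Furthermore, for any two such maps $u$ and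 $v$, there exists $g\in G$ such that $u(x)=g\cdot v(x)$ for almost every $x\in I^m$. -/

import Mathlib

open MeasureTheory
open scoped Manifold ContDiff

namespace FlatForms

/-- The cube `I^m = [0,1]^m`. -/
def cube (m : ℕ) : Set (Fin m → ℝ) := Set.Icc 0 1

/-- Lebesgue measure on the cube. -/
noncomputable def cubeMeasure (m : ℕ) : Measure (Fin m → ℝ) := volume.restrict (cube m)

/-- Test functions: smooth real functions with compact support in the interior of the cube. -/
structure IsTestFunction {m : ℕ} (φ : (Fin m → ℝ) → ℝ) : Prop where
  smooth : ContDiff ℝ ∞ φ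
  compact : HasCompactSupport φ
  support : tsupport φ ⊆ interior (cube m)

/-- The partial derivative `∂φ/∂xᵢ` of a smooth function. -/
noncomputable def partialDeriv {m : ℕ} (i : Fin m) (φ : (Fin m → ℝ) → ℝ) (x : Fin m → ℝ) : ℝ :=
  fderiv ℝ φ x (Pi.single i 1)

section Sobolev

variable {m : ℕ} {V : Type*} [NormedAddCommGroup V] [NormedSpace ℝ V]

/-- `g` is the weak partial derivative `∂f/∂xᵢ` on the cube. -/
def HasWeakPartialDeriv (i : Fin m) (f g : (Fin m → ℝ) → V) : Prop :=
  LocallyIntegrableOn f (interior (cube m)) ∧ LocallyIntegrableOn g (interior (cube m)) ∧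
    ∀ φ : (Fin m → ℝ) → ℝ, IsTestFunction φ →
      ∫ x, partialDeriv i φ x • f x ∂(cubeMeasure m) = - ∫ x, φ x • g x ∂(cubeMeasure m)

/-- The Sobolev space `W^{1,2}(I^m, V)` of vector-valued functions. -/
def MemW12 (f : (Fin m → ℝ) → V) : Prop :=
  MemLp f 2 (cubeMeasure m) ∧
    ∀ i : Fin m, ∃ g : (Fin m → ℝ) → V, MemLp g 2 (cubeMeasure m) ∧ HasWeakPartialDeriv i f g

/-- The Sobolev space `W^{1,2}(I^m, G)` of maps into a manifold `G` that is embedded in the vector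
space `V` by `ι`. -/
def MemW12Embedded {G : Type*} (ι : G → V) (u : (Fin m → ℝ) → G) : Prop :=
  MemW12 (fun x => ι (u x))

end Sobolev

section LieGroup

variable {m : ℕ} {E : Type*} [NormedAddCommGroup E] [NormedSpace ℝ E]
  {G : Type*} [TopologicalSpace G] [ChartedSpace E G] [Group G]

/-- The Lie-algebra-valued `1`-form `A = ∑ Aᵢ dxᵢ` on the cube is square integrable. The Lie algebra
is a finite-dimensional vector space without a preferred norm, so this is expressed through its
linear functionals. -/
def IsL2Form (A : Fin m → (Fin m → ℝ) → GroupLieAlgebra 𝓘(ℝ, E) G) : Prop :=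
  ∀ (i : Fin m) (l : GroupLieAlgebra 𝓘(ℝ, E) G →L[ℝ] ℝ),
    MemLp (fun x => l (A i x)) 2 (cubeMeasure m)

/-- `dA + ½[A, A] = 0` in the sense of distributions: the `dxᵢ ∧ dxⱼ` component
`∂ᵢ Aⱼ - ∂ⱼ Aᵢ + [Aᵢ, Aⱼ]` vanishes against every test function (and in every linear functional of
the Lie algebra), for all `i` and `j`. -/
def IsDistributionallyFlat (A : Fin m → (Fin m → ℝ) → GroupLieAlgebra 𝓘(ℝ, E) G) : Prop :=
  ∀ (i j : Fin m) (l : GroupLieAlgebra 𝓘(ℝ, E) G →L[ℝ] ℝ) (φ : (Fin m → ℝ) → ℝ),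
    IsTestFunction φ →
      ∫ x, (-(partialDeriv i φ x * l (A j x)) + partialDeriv j φ x * l (A i x)
        + φ x * l ⁅A i x, A j x⁆) ∂(cubeMeasure m) = 0

variable {V : Type*} [NormedAddCommGroup V] [NormedSpace ℝ V]

/-- For `a` in the Lie algebra, the tangent vector `g · a ∈ T_g G` (the image of `a` under the
differential of left multiplication by `g`), seen as a vector of `V` through the differential of
`ι : G → V`. -/
noncomputable def leftTranslate (ι : G → V) (g : G) (a : GroupLieAlgebra 𝓘(ℝ, E) G) : V :=
  mfderiv 𝓘(ℝ, E) 𝓘(ℝ, V) ι g (mulInvariantVectorField a g)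

/-- `A = u⁻¹ du`, that is `∂ᵢ u = u · Aᵢ` for all `i`, where `G` is embedded in `V` by `ι` and `∂ᵢ`
is the weak derivative. -/
def IsLogDeriv (ι : G → V) (u : (Fin m → ℝ) → G)
    (A : Fin m → (Fin m → ℝ) → GroupLieAlgebra 𝓘(ℝ, E) G) : Prop :=
  ∀ i : Fin m,
    HasWeakPartialDeriv i (fun x => ι (u x)) (fun x => leftTranslate ι (u x) (A i x))

end LieGroup

end FlatForms

/-!
The form `A` is integrated along coordinate lines, and flatness says that the result does not depend
on the path.

*Transport on a line.* For an integrable `a : ℝ → E` the equation `γ' = γ · a` has a unique solution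
on `[0,1]` with a given initial value. Existence (`exists_isSol`) is the contraction principle in a
chart at `1`, followed by concatenation. Uniqueness and Lipschitz dependence of the transport
`par ι a s t` on `a` in `L¹` (`exists_gdist_par_le`) come from one comparison estimate
(`exists_gdist_mul_ex_mul_inv_le`): if `S` and `R` solve the equations for `a` and `b`, and `y` is a
short path in the chart, then `S · ex y · R⁻¹` moves at a speed bounded by
`‖rho y a + y' - lam y b‖`, where `lam` and `rho` are the left- and right-invariant vector fields in
the chart. Distances are measured in a bi-invariant metric `gdist` that is equivalent to the one
induced by `ι`, so that products of transports can be estimated factor by factor.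

*Nonabelian Stokes inequality.* For a `C¹` form in the plane, the two transports between opposite
corners of a rectangle differ by at most a constant times the integral of the norm of the curvature
(`exists_holonomy_le`). The rectangle is swept by thin strips; on a strip of width `h` the
comparison estimate is applied with `y = h • A₁`, and the first-order term in `h` is the curvature,
because the Lie bracket is the antisymmetrization of the derivative of `lam` at `0`.

*Passage to `L²`.* Mollification turns an `L²` form that is flat in the sense of distributions into
smooth forms `Aⁿ` whose curvature, away from the boundary of the cube, is the difference of
`[Aⁿᵢ, Aⁿⱼ]` and the mollification of `[Aᵢ, Aⱼ]`. It tends to `0` in `L¹`. The integrability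
exponent `2` enters here, since the bracket is quadratic. For a fast enough sequence the convergence
holds in `L¹` of almost every coordinate line and plane, and so the limit has trivial holonomy
around almost every coordinate rectangle (`IsFlat.ae_lineTransport_comm`).

*Gauge.* By induction over the coordinates and Fubini's theorem, line transports that commute around
almost every rectangle are the transition functions of one measurable map `u` (`exists_gauge`).
Integration by parts on lines shows that `u` has the prescribed weak derivative
(`hasWeakPartialDeriv_of_ae_eq`), and so does `u⁻¹`, because `g ↦ ι g⁻¹` is also smooth and
`1`-Lipschitz for `gdist`.

*Uniqueness.* A map with logarithmic derivative `A` follows the transports of `A` on almost every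
line (`ae_eq_mul_par_of_hasWeakPartialDeriv`): there `ι ∘ u` is the primitive of its weak
derivative. For two such maps `u v⁻¹` is therefore independent of each coordinate, hence constant.
-/

namespace FlatForms
open Set Filter Topology
set_option linter.unusedSectionVars false

/-! ### The chart at the identity and local left inverses of immersions -/

section Chart

variable (E : Type*) [NormedAddCommGroup E] [NormedSpace ℝ E]
  (G : Type*) [TopologicalSpace G] [ChartedSpace E G] [Group G]

/-- The inverse of the preferred chart of `G` at `1`, translated so that `0` is sent to `1`. It is a
parametrization of a neighbourhood of `1` only near `0`. -/
noncomputable def ex (y : E) : G :=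
  (extChartAt 𝓘(ℝ, E) (1 : G)).symm (y + extChartAt 𝓘(ℝ, E) (1 : G) 1)

/-- The preferred chart of `G` at `1`, translated so that `1` is sent to `0`. It is a chart only
near `1`. -/
noncomputable def lg (g : G) : E :=
  extChartAt 𝓘(ℝ, E) (1 : G) g - extChartAt 𝓘(ℝ, E) (1 : G) 1

@[simp] lemma ex_zero : ex E G 0 = 1 := by simp [ex]

@[simp] lemma lg_one : lg E G 1 = 0 := by simp [lg]

lemma eventually_ex_lg : ∀ᶠ g in 𝓝 (1 : G), ex E G (lg E G g) = g := by
  filter_upwards [extChartAt_source_mem_nhds (I := 𝓘(ℝ, E)) (1 : G)] with g hg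
  simp only [ex, lg, sub_add_cancel]
  exact (extChartAt 𝓘(ℝ, E) (1 : G)).left_inv hg

lemma eventually_lg_ex : ∀ᶠ y in 𝓝 (0 : E), lg E G (ex E G y) = y := by
  have h : Tendsto (fun y : E => y + extChartAt 𝓘(ℝ, E) (1 : G) 1) (𝓝 0)
      (𝓝 (extChartAt 𝓘(ℝ, E) (1 : G) 1)) := by
    have : Continuous (fun y : E => y + extChartAt 𝓘(ℝ, E) (1 : G) 1) := by fun_prop
    simpa using this.tendsto 0
  filter_upwards [h (extChartAt_target_mem_nhds (I := 𝓘(ℝ, E)) (1 : G))] with y hy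
  simp only [ex, lg]
  rw [(extChartAt 𝓘(ℝ, E) (1 : G)).right_inv hy]
  simp

variable [LieGroup 𝓘(ℝ, E) ∞ G]

lemma contMDiffAt_lg : ∀ᶠ g in 𝓝 (1 : G), ContMDiffAt 𝓘(ℝ, E) 𝓘(ℝ, E) ∞ (lg E G) g := by
  filter_upwards [extChartAt_source_mem_nhds (I := 𝓘(ℝ, E)) (1 : G)] with g hg
  have h1 : ContMDiffAt 𝓘(ℝ, E) 𝓘(ℝ, E) ∞ (extChartAt 𝓘(ℝ, E) (1 : G)) g :=
    contMDiffAt_extChartAt' (by simpa using hg)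
  exact h1.sub contMDiffAt_const

lemma contMDiffAt_ex : ∀ᶠ y in 𝓝 (0 : E), ContMDiffAt 𝓘(ℝ, E) 𝓘(ℝ, E) ∞ (ex E G) y := by
  have h : Tendsto (fun y : E => y + extChartAt 𝓘(ℝ, E) (1 : G) 1) (𝓝 0)
      (𝓝 (extChartAt 𝓘(ℝ, E) (1 : G) 1)) := by
    have : Continuous (fun y : E => y + extChartAt 𝓘(ℝ, E) (1 : G) 1) := by fun_prop
    simpa using this.tendsto 0
  filter_upwards [h.eventually (eventually_eventually_nhds.2
    (extChartAt_target_mem_nhds (I := 𝓘(ℝ, E)) (1 : G)))] with y hy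
  have h1 := (contMDiffOn_extChartAt_symm (I := 𝓘(ℝ, E)) (n := ∞) (1 : G)).contMDiffAt hy
  have h2 : ContMDiffAt 𝓘(ℝ, E) 𝓘(ℝ, E) ∞ (fun y : E => y + extChartAt 𝓘(ℝ, E) (1 : G) 1) y := by
    rw [contMDiffAt_iff_contDiffAt]; fun_prop
  exact h1.comp y h2

end Chart

section Immersion

variable {E : Type*} [NormedAddCommGroup E] [NormedSpace ℝ E]
  {G : Type*} [TopologicalSpace G] [ChartedSpace E G]
  {V : Type*} [NormedAddCommGroup V] [NormedSpace ℝ V]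

/-- An immersion into a vector space has a smooth local left inverse. -/
lemma exists_local_left_inverse [IsManifold 𝓘(ℝ, E) ∞ G] {ι : G → V} {g₀ : G}
    (h : Manifold.IsImmersionAt 𝓘(ℝ, E) 𝓘(ℝ, V) ∞ ι g₀) :
    ∃ P : V → G, ContMDiffAt 𝓘(ℝ, V) 𝓘(ℝ, E) ∞ P (ι g₀) ∧ ∀ᶠ g in 𝓝 g₀, P (ι g) = g := by
  have key' : ∀ g ∈ h.domChart.source, (h.equiv.symm (h.codChart (ι g))).1 = h.domChart g := by
    intro g hg
    have hw := h.writtenInCharts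
    have hm : h.domChart g ∈ (h.domChart.extend 𝓘(ℝ, E)).target := by
      simpa using h.domChart.map_source hg
    have := hw hm
    simp [h.domChart.left_inv hg] at this
    rw [this]
    simp
  have key : ∀ g ∈ h.domChart.source,
      h.domChart.symm ((h.equiv.symm (h.codChart (ι g))).1) = g := by
    intro g hg
    rw [key' g hg, h.domChart.left_inv hg]
  refine ⟨fun v => h.domChart.symm ((h.equiv.symm (h.codChart v)).1), ?_, ?_⟩
  · have h1 : ContMDiffAt 𝓘(ℝ, V) 𝓘(ℝ, V) ∞ h.codChart (ι g₀) :=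
      contMDiffAt_of_mem_maximalAtlas h.codChart_mem_maximalAtlas h.mem_codChart_source
    have h2 : ContMDiffAt 𝓘(ℝ, V) 𝓘(ℝ, E) ∞ (fun v => (h.equiv.symm v).1) (h.codChart (ι g₀)) := by
      rw [contMDiffAt_iff_contDiffAt]; fun_prop
    have h3 : ContMDiffAt 𝓘(ℝ, E) 𝓘(ℝ, E) ∞ h.domChart.symm
        ((h.equiv.symm (h.codChart (ι g₀))).1) := by
      rw [key' g₀ h.mem_domChart_source]
      exact contMDiffAt_symm_of_mem_maximalAtlas h.domChart_mem_maximalAtlas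
        (h.domChart.map_source h.mem_domChart_source)
    exact ContMDiffAt.comp (ι g₀) (g := h.domChart.symm) (f := fun v => (h.equiv.symm (h.codChart
        v)).1)
      h3 (h2.comp _ h1)
  · filter_upwards [h.domChart.open_source.mem_nhds h.mem_domChart_source] with g hg
    exact key g hg

end Immersion

/-! ### The multiplication and the invariant vector fields in the chart -/

section LocalProduct

variable (E : Type*) [NormedAddCommGroup E] [NormedSpace ℝ E]
  (G : Type*) [TopologicalSpace G] [ChartedSpace E G] [Group G] [LieGroup 𝓘(ℝ, E) ∞ G]

variable {E} in
lemma ex_comp {X : Type*} [NormedAddCommGroup X] [NormedSpace ℝ X] {u : X → E} {x : X}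
    (h : ContMDiffAt 𝓘(ℝ, E) 𝓘(ℝ, E) ∞ (ex E G) (u x)) (hu : ContDiffAt ℝ ∞ u x) :
    ContMDiffAt 𝓘(ℝ, X) 𝓘(ℝ, E) ∞ (fun x => ex E G (u x)) x :=
  h.comp x hu.contMDiffAt

/-- The product `ex z * ex y * (ex w)⁻¹` at `(z, y, w)`, read in the chart at `1`. -/
noncomputable def nu (p : E × E × E) : E :=
  lg E G (ex E G p.1 * ex E G p.2.1 * (ex E G p.2.2)⁻¹)

/-- The multiplication of `G` read in the chart at `1`. -/
noncomputable def mu (p : E × E) : E := lg E G (ex E G p.1 * ex E G p.2)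

lemma eventually_contMDiffAt_tripleProd : ∀ᶠ p in 𝓝 (0 : E × E × E),
    ContMDiffAt 𝓘(ℝ, E × E × E) 𝓘(ℝ, E) ∞
      (fun p : E × E × E => ex E G p.1 * ex E G p.2.1 * (ex E G p.2.2)⁻¹) p := by
  have h1 : Tendsto (fun p : E × E × E => p.1) (𝓝 0) (𝓝 0) := continuous_fst.tendsto' _ _ rfl
  have h2 : Tendsto (fun p : E × E × E => p.2.1) (𝓝 0) (𝓝 0) :=
    (continuous_fst.comp continuous_snd).tendsto' _ _ rfl
  have h3 : Tendsto (fun p : E × E × E => p.2.2) (𝓝 0) (𝓝 0) :=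
    (continuous_snd.comp continuous_snd).tendsto' _ _ rfl
  filter_upwards [h1.eventually (contMDiffAt_ex E G), h2.eventually (contMDiffAt_ex E G),
    h3.eventually (contMDiffAt_ex E G)] with p p1 p2 p3
  exact ((ex_comp G (u := fun p : E × E × E => p.1) p1 (by fun_prop)).mul
    (ex_comp G (u := fun p : E × E × E => p.2.1) p2 (by fun_prop))).mul
    (ex_comp G (u := fun p : E × E × E => p.2.2) p3 (by fun_prop)).inv

lemma tendsto_tripleProd : Tendsto
    (fun p : E × E × E => ex E G p.1 * ex E G p.2.1 * (ex E G p.2.2)⁻¹) (𝓝 0) (𝓝 1) := by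
  have := (eventually_contMDiffAt_tripleProd E G).self_of_nhds.continuousAt.tendsto
  simpa using this

lemma eventually_ex_nu : ∀ᶠ p in 𝓝 (0 : E × E × E),
    ex E G (nu E G p) = ex E G p.1 * ex E G p.2.1 * (ex E G p.2.2)⁻¹ :=
  (tendsto_tripleProd E G).eventually (eventually_ex_lg E G)

lemma eventually_contDiffAt_nu : ∀ᶠ p in 𝓝 (0 : E × E × E), ContDiffAt ℝ ∞ (nu E G) p := by
  filter_upwards [eventually_contMDiffAt_tripleProd E G,
    (tendsto_tripleProd E G).eventually (contMDiffAt_lg E G)] with p h1 h2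
  rw [← contMDiffAt_iff_contDiffAt]
  exact ContMDiffAt.comp p (g := lg E G) h2 h1

lemma nu_eq_mu (p : E × E) : nu E G (p.1, p.2, 0) = mu E G p := by simp [nu, mu]

lemma eventually_contDiffAt_mu : ∀ᶠ p in 𝓝 (0 : E × E), ContDiffAt ℝ ∞ (mu E G) p := by
  have h : Tendsto (fun p : E × E => (p.1, p.2, (0 : E))) (𝓝 0) (𝓝 0) := by
    have : Continuous (fun p : E × E => (p.1, p.2, (0 : E))) := by fun_prop
    exact this.tendsto' _ _ rfl
  filter_upwards [h.eventually (eventually_contDiffAt_nu E G)] with p hp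
  have : mu E G = nu E G ∘ (fun p : E × E => (p.1, p.2, (0 : E))) := by
    ext p; exact (nu_eq_mu E G p).symm
  rw [this]
  exact hp.comp p (by fun_prop)

lemma eventually_mu_zero_left : ∀ᶠ y in 𝓝 (0 : E), mu E G (0, y) = y := by
  filter_upwards [eventually_lg_ex E G] with y hy
  simp [mu, hy]

lemma eventually_mu_zero_right : ∀ᶠ y in 𝓝 (0 : E), mu E G (y, 0) = y := by
  filter_upwards [eventually_lg_ex E G] with y hy
  simp [mu, hy]

/-- The left-invariant vector fields in the chart: for `y` near `0`, `lam y a` is the value at `y`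
of the left-invariant vector field with value `a` at `0`. -/
noncomputable def lam (y : E) : E →L[ℝ] E := fderiv ℝ (fun z => mu E G (y, z)) 0

/-- The right-invariant vector fields in the chart: for `y` near `0`, `rho y a` is the value at `y`
of the right-invariant vector field with value `a` at `0`. -/
noncomputable def rho (y : E) : E →L[ℝ] E := fderiv ℝ (fun z => mu E G (z, y)) 0

lemma lam_zero : lam E G 0 = ContinuousLinearMap.id ℝ E := by
  have : (fun z => mu E G (0, z)) =ᶠ[𝓝 0] id := eventually_mu_zero_left E G
  rw [lam, this.fderiv_eq, fderiv_id]

lemma rho_zero : rho E G 0 = ContinuousLinearMap.id ℝ E := by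
  have : (fun z => mu E G (z, 0)) =ᶠ[𝓝 0] id := eventually_mu_zero_right E G
  rw [rho, this.fderiv_eq, fderiv_id]

lemma eventually_mu_left : ∀ᶠ y in 𝓝 (0 : E), ContDiffAt ℝ ∞ (mu E G) (y, 0) := by
  have h : Tendsto (fun y : E => (y, (0 : E))) (𝓝 0) (𝓝 0) :=
    Continuous.tendsto' (by fun_prop) _ _ rfl
  exact h.eventually (eventually_contDiffAt_mu E G)

lemma eventually_mu_right : ∀ᶠ y in 𝓝 (0 : E), ContDiffAt ℝ ∞ (mu E G) (0, y) := by
  have h : Tendsto (fun y : E => ((0 : E), y)) (𝓝 0) (𝓝 0) :=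
    Continuous.tendsto' (by fun_prop) _ _ rfl
  exact h.eventually (eventually_contDiffAt_mu E G)

lemma eventually_lam_eq : ∀ᶠ y in 𝓝 (0 : E),
    lam E G y = (fderiv ℝ (mu E G) (y, 0)).comp (ContinuousLinearMap.inr ℝ E E) := by
  filter_upwards [eventually_mu_left E G] with y hy
  have h := (hy.differentiableAt (by simp)).hasFDerivAt
  exact (HasFDerivAt.comp (0 : E) h (hasFDerivAt_prodMk_right y (0 : E))).fderiv

lemma eventually_rho_eq : ∀ᶠ y in 𝓝 (0 : E),
    rho E G y = (fderiv ℝ (mu E G) (0, y)).comp (ContinuousLinearMap.inl ℝ E E) := by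
  filter_upwards [eventually_mu_right E G] with y hy
  have h := (hy.differentiableAt (by simp)).hasFDerivAt
  exact (HasFDerivAt.comp (f := fun z => (z, y)) (0 : E) h (hasFDerivAt_prodMk_left (0 : E)
      y)).fderiv

lemma contDiffAt_lam : ContDiffAt ℝ ∞ (lam E G) 0 := by
  have h : ContDiffAt ℝ ∞ (fun y : E => (fderiv ℝ (mu E G) (y, 0)).comp
      (ContinuousLinearMap.inr ℝ E E)) 0 := by
    have h1 : ContDiffAt ℝ ∞ (fderiv ℝ (mu E G)) ((0 : E), (0 : E)) :=
      (eventually_mu_left E G).self_of_nhds.fderiv_right (by simp)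
    have h2 : ContDiffAt ℝ ∞ (fun y : E => fderiv ℝ (mu E G) (y, 0)) 0 :=
      ContDiffAt.comp (0 : E) (f := fun y : E => (y, (0 : E))) h1 (by fun_prop)
    exact h2.clm_comp contDiffAt_const
  exact h.congr_of_eventuallyEq (eventually_lam_eq E G)

lemma contDiffAt_rho : ContDiffAt ℝ ∞ (rho E G) 0 := by
  have h : ContDiffAt ℝ ∞ (fun y : E => (fderiv ℝ (mu E G) (0, y)).comp
      (ContinuousLinearMap.inl ℝ E E)) 0 := by
    have h1 : ContDiffAt ℝ ∞ (fderiv ℝ (mu E G)) ((0 : E), (0 : E)) :=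
      (eventually_mu_left E G).self_of_nhds.fderiv_right (by simp)
    have h2 : ContDiffAt ℝ ∞ (fun y : E => fderiv ℝ (mu E G) (0, y)) 0 :=
      ContDiffAt.comp (0 : E) (f := fun y : E => ((0 : E), y)) h1 (by fun_prop)
    exact h2.clm_comp contDiffAt_const
  exact h.congr_of_eventuallyEq (eventually_rho_eq E G)

/-- The derivatives at `0` of the left- and right-invariant fields are the two halves of the mixed
second derivative of the multiplication, so they agree up to exchanging the arguments. -/
lemma fderiv_rho_apply (a b : E) :
    fderiv ℝ (rho E G) 0 a b = fderiv ℝ (lam E G) 0 b a := by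
  have hmu : ContDiffAt ℝ ∞ (mu E G) (0, 0) := (eventually_mu_left E G).self_of_nhds
  have hd : HasFDerivAt (fderiv ℝ (mu E G)) (fderiv ℝ (fderiv ℝ (mu E G)) (0, 0)) (0, 0) :=
    ((hmu.fderiv_right (m := ∞) (by simp)).differentiableAt (by simp)).hasFDerivAt
  have hl : HasFDerivAt (fun y : E => fderiv ℝ (mu E G) (y, 0) ((0 : E), a))
      ((ContinuousLinearMap.apply ℝ E ((0 : E), a)).comp
        ((fderiv ℝ (fderiv ℝ (mu E G)) (0, 0)).comp (ContinuousLinearMap.inl ℝ E E))) 0 :=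
    (ContinuousLinearMap.apply ℝ E ((0 : E), a)).hasFDerivAt.comp (0 : E)
      (HasFDerivAt.comp (0 : E) hd (hasFDerivAt_prodMk_left (0 : E) (0 : E)))
  have hr : HasFDerivAt (fun y : E => fderiv ℝ (mu E G) (0, y) (b, (0 : E)))
      ((ContinuousLinearMap.apply ℝ E (b, (0 : E))).comp
        ((fderiv ℝ (fderiv ℝ (mu E G)) (0, 0)).comp (ContinuousLinearMap.inr ℝ E E))) 0 :=
    (ContinuousLinearMap.apply ℝ E (b, (0 : E))).hasFDerivAt.comp (0 : E)
      (HasFDerivAt.comp (0 : E) hd (hasFDerivAt_prodMk_right (0 : E) (0 : E)))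
  have hlam : HasFDerivAt (fun y : E => lam E G y a)
      ((ContinuousLinearMap.apply ℝ E a).comp (fderiv ℝ (lam E G) 0)) 0 :=
    (ContinuousLinearMap.apply ℝ E a).hasFDerivAt.comp (0 : E)
      ((contDiffAt_lam E G).differentiableAt (by simp)).hasFDerivAt
  have hrho : HasFDerivAt (fun y : E => rho E G y b)
      ((ContinuousLinearMap.apply ℝ E b).comp (fderiv ℝ (rho E G) 0)) 0 :=
    (ContinuousLinearMap.apply ℝ E b).hasFDerivAt.comp (0 : E)
      ((contDiffAt_rho E G).differentiableAt (by simp)).hasFDerivAt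
  have e1 := hlam.unique (hl.congr_of_eventuallyEq (by
    filter_upwards [eventually_lam_eq E G] with y hy; rw [hy]; rfl))
  have e2 := hrho.unique (hr.congr_of_eventuallyEq (by
    filter_upwards [eventually_rho_eq E G] with y hy; rw [hy]; rfl))
  have e1' := congrArg (fun L : E →L[ℝ] E => L b) e1
  have e2' := congrArg (fun L : E →L[ℝ] E => L a) e2
  simp only [ContinuousLinearMap.comp_apply, ContinuousLinearMap.apply_apply,
    ContinuousLinearMap.inl_apply, ContinuousLinearMap.inr_apply] at e1' e2'
  rw [e1', e2']
  have h2 : minSmoothness ℝ 2 ≤ (∞ : WithTop ℕ∞) := by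
    simp only [minSmoothness_of_isRCLikeNormedField]
    exact WithTop.coe_le_coe.2 (le_top : (2 : ℕ∞) ≤ ⊤)
  exact (hmu.isSymmSndFDerivAt h2).eq _ _

/-- The derivative of `nu` at `(0, y, 0)`: the outer factors move `ex y` along right- and
left-invariant vector fields. The term in `b` comes from `nu (0, mu (y, w), w) = y`. -/
lemma eventually_hasFDerivAt_nu : ∀ᶠ y in 𝓝 (0 : E), ∃ L : E × E × E →L[ℝ] E,
    HasFDerivAt (nu E G) L (0, y, 0) ∧
    ∀ a v b, L (a, v, b) = rho E G y a + v - lam E G y b := by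
  have h : Tendsto (fun y : E => ((0 : E), y, (0 : E))) (𝓝 0) (𝓝 0) :=
    Continuous.tendsto' (by fun_prop) _ _ rfl
  have h' : Tendsto (fun y : E => (y, (0 : E), (0 : E))) (𝓝 0) (𝓝 0) :=
    Continuous.tendsto' (by fun_prop) _ _ rfl
  filter_upwards [h.eventually (eventually_contDiffAt_nu E G), eventually_mu_left E G,
    eventually_mu_right E G, eventually_mu_zero_left E G, eventually_mu_zero_right E G,
    (eventually_lg_ex E G).eventually_nhds,
    h'.eventually (eventually_ex_nu E G).eventually_nhds] with y h1 h2 h3 h4 h5 h6 h7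
  have hL := (h1.differentiableAt (by simp)).hasFDerivAt
  set L := fderiv ℝ (nu E G) (0, y, 0)
  refine ⟨L, hL, ?_⟩
  -- `nu (z, y, 0) = mu (z, y)`
  have r1 : ∀ a, L (a, 0, 0) = rho E G y a := by
    intro a
    have e := HasFDerivAt.comp (f := fun z => (z, y, (0 : E))) (0 : E) hL
      (hasFDerivAt_prodMk_left (0 : E) (y, (0 : E)))
    have : (nu E G ∘ fun e : E => (e, y, (0 : E))) = fun z => mu E G (z, y) := by
      ext z; exact nu_eq_mu E G (z, y)
    rw [this] at e
    rw [rho, e.fderiv]; rfl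
  -- `nu (0, z, 0) = z`
  have r2 : ∀ v, L (0, v, 0) = v := by
    intro v
    have e := HasFDerivAt.comp (f := fun z => ((0 : E), z, (0 : E))) y hL
      ((hasFDerivAt_const (0 : E) y).prodMk (hasFDerivAt_prodMk_left y (0 : E)))
    have e' : HasFDerivAt (id : E → E) _ y := e.congr_of_eventuallyEq (by
      filter_upwards [h6] with z hz
      simp [nu, hz])
    have := congrArg (fun T : E →L[ℝ] E => T v) (e'.unique (hasFDerivAt_id y))
    simpa using this
  have r3 : ∀ b, L (0, lam E G y b, b) = 0 := by
    intro b
    have hm : HasFDerivAt (fun w => mu E G (y, w)) (lam E G y) 0 := by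
      have := (HasFDerivAt.comp (0 : E) (h2.differentiableAt (by simp)).hasFDerivAt
        (hasFDerivAt_prodMk_right y (0 : E)))
      exact this.differentiableAt.hasFDerivAt
    have hc : HasFDerivAt (fun w : E => ((0 : E), mu E G (y, w), w))
        ((0 : E →L[ℝ] E).prod ((lam E G y).prod (ContinuousLinearMap.id ℝ E))) 0 :=
      (hasFDerivAt_const _ _).prodMk (hm.prodMk (hasFDerivAt_id _))
    have hL' : HasFDerivAt (nu E G) L ((fun w : E => ((0 : E), mu E G (y, w), w)) 0) := by
      simpa [h5] using hL
    have e := HasFDerivAt.comp (0 : E) hL' hc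
    have hev : ∀ᶠ w in 𝓝 (0 : E), ex E G (mu E G (y, w)) = ex E G y * ex E G w := by
      have hc : Tendsto (fun w : E => (y, w, (0 : E))) (𝓝 0) (𝓝 (y, 0, 0)) :=
        Continuous.tendsto' (by fun_prop) _ _ rfl
      filter_upwards [hc.eventually h7] with w hw
      simpa [nu_eq_mu E G (y, w)] using hw
    have e' : HasFDerivAt (fun _ : E => y) _ (0 : E) := e.congr_of_eventuallyEq (by
      filter_upwards [hev] with z hz
      simp only [nu, Function.comp, hz, ex_zero, one_mul, mul_inv_cancel_right]
      exact h6.self_of_nhds.symm)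
    have := congrArg (fun T : E →L[ℝ] E => T b) (e'.unique (hasFDerivAt_const y (0 : E)))
    simpa using this
  intro a v b
  have : ((a, v, b) : E × E × E) = (a, 0, 0) + (0, v, 0) + ((0, lam E G y b, b) - (0, lam E G y b,
      0)) := by
    simp
  rw [this, map_add, map_add, map_sub, r1, r2, r2, r3]
  abel

end LocalProduct

/-! ### Left-invariant derivatives and the Lie bracket in the chart -/

section Bracket

variable {E : Type*} [NormedAddCommGroup E] [NormedSpace ℝ E]
  {G : Type*} [TopologicalSpace G] [ChartedSpace E G] [Group G] [LieGroup 𝓘(ℝ, E) ∞ G]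
  {F : Type*} [NormedAddCommGroup F] [NormedSpace ℝ F]

/-- `leftDeriv f g a` is the derivative of `f` at `g` in the direction of the left-invariant vector
field with value `a` at `1`. -/
noncomputable def leftDeriv (f : G → F) (g : G) : E →L[ℝ] F := fderiv ℝ (fun z : E => f (g * ex E G
    z)) 0

/-- The manifold derivative at `1` is the derivative in the preferred chart. -/
lemma mfderiv_one_eq {f : G → F} (hf : MDifferentiableAt 𝓘(ℝ, E) 𝓘(ℝ, F) f 1) (a : E) :
    mfderiv 𝓘(ℝ, E) 𝓘(ℝ, F) f (1 : G) a = fderiv ℝ (fun z : E => f (ex E G z)) 0 a := by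
  have h1 : (fun z : E => f (ex E G z)) = fun z : E =>
      (f ∘ (extChartAt 𝓘(ℝ, E) (1 : G)).symm) (z + extChartAt 𝓘(ℝ, E) (1 : G) 1) := rfl
  rw [h1, fderiv_comp_add_right, zero_add]
  have h2 : (mfderiv 𝓘(ℝ, E) 𝓘(ℝ, F) f (1 : G) : E →L[ℝ] F) = fderivWithin ℝ
      (f ∘ (extChartAt 𝓘(ℝ, E) (1 : G)).symm) (range (fun x : E => x))
        (extChartAt 𝓘(ℝ, E) (1 : G) 1) := hf.mfderiv
  rw [range_id', fderivWithin_univ] at h2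
  exact DFunLike.congr_fun h2 a

/-- The manifold derivative along a left-invariant vector field is `leftDeriv`. -/
lemma mfderiv_comp_mulInvariant {f : G → F} {g : G}
    (hf : MDifferentiableAt 𝓘(ℝ, E) 𝓘(ℝ, F) f g) (a : GroupLieAlgebra 𝓘(ℝ, E) G) :
    mfderiv 𝓘(ℝ, E) 𝓘(ℝ, F) f g (mulInvariantVectorField a g) = leftDeriv (E := E) f g a := by
  have hm : MDifferentiableAt 𝓘(ℝ, E) 𝓘(ℝ, E) (fun h : G => g * h) 1 :=
    (contMDiff_mul_left (I := 𝓘(ℝ, E)) (n := ∞) (a := g)).contMDiffAt.mdifferentiableAt (by simp)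
  have hf' : MDifferentiableAt 𝓘(ℝ, E) 𝓘(ℝ, F) f (g * 1) := by rwa [mul_one]
  have h := mfderiv_comp (I'' := 𝓘(ℝ, F)) (1 : G) (g := f) hf' hm
  have h2 := mfderiv_one_eq (f := fun h : G => f (g * h)) (hf'.comp (1 : G) hm) a
  rw [leftDeriv, ← h2]
  have h3 : mfderiv 𝓘(ℝ, E) 𝓘(ℝ, F) (fun h : G => f (g * h)) 1 =
    (mfderiv 𝓘(ℝ, E) 𝓘(ℝ, F) f (g * 1)).comp (mfderiv 𝓘(ℝ, E) 𝓘(ℝ, E) (fun h : G => g * h) 1) := h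
  rw [h3]
  -- The tangent space depends on the base point, so `g * 1` cannot be rewritten to `g` in place.
  have h4 : ∀ (g' : G), g' = g → ∀ X : E, (mfderiv 𝓘(ℝ, E) 𝓘(ℝ, F) f g' : E →L[ℝ] F) X =
      (mfderiv 𝓘(ℝ, E) 𝓘(ℝ, F) f g : E →L[ℝ] F) X := by
    rintro _ rfl X; rfl
  exact (h4 (g * 1) (mul_one g) _).symm

/-- The vector `g · a`, seen in `V`, is the left-invariant derivative of `ι`. -/
lemma leftTranslate_eq {ι : G → F} (hι : ContMDiff 𝓘(ℝ, E) 𝓘(ℝ, F) ∞ ι) (g : G)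
    (a : GroupLieAlgebra 𝓘(ℝ, E) G) : leftTranslate ι g a = leftDeriv (E := E) ι g a :=
  mfderiv_comp_mulInvariant (hι.contMDiffAt.mdifferentiableAt (by simp)) a

variable (E G) in
/-- The commutator form of the Lie algebra in the chart at `1`: the antisymmetrization of the
derivative of `lam` at `0`. It is the Lie bracket by `bracket_eq_br`. -/
noncomputable def br (a b : E) : E := fderiv ℝ (lam E G) 0 a b - fderiv ℝ (lam E G) 0 b a

lemma mfderiv_extChartAt_one :
    (mfderiv 𝓘(ℝ, E) 𝓘(ℝ, E) (extChartAt 𝓘(ℝ, E) (1 : G)) (1 : G) : E →L[ℝ] E) =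
      ContinuousLinearMap.id ℝ E := by
  have hd : MDifferentiableAt 𝓘(ℝ, E) 𝓘(ℝ, E) (extChartAt 𝓘(ℝ, E) (1 : G)) (1 : G) :=
    mdifferentiableAt_extChartAt (by simp)
  refine ContinuousLinearMap.ext fun a => (mfderiv_one_eq hd a).trans ?_
  have : (fun z : E => extChartAt 𝓘(ℝ, E) (1 : G) (ex E G z)) =ᶠ[𝓝 0]
      fun z => z + extChartAt 𝓘(ℝ, E) (1 : G) 1 := by
    filter_upwards [eventually_lg_ex E G] with z hz
    rw [lg, sub_eq_iff_eq_add] at hz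
    exact hz
  rw [this.fderiv_eq]
  simp
  rfl

/-- Left-invariant vector fields, pulled back to the chart at `1`, are given by `lam`. -/
lemma mpullbackWithin_mulInvariant (a : GroupLieAlgebra 𝓘(ℝ, E) G) :
    ∀ᶠ y in 𝓝 (extChartAt 𝓘(ℝ, E) (1 : G) 1),
      VectorField.mpullbackWithin 𝓘(ℝ, E) 𝓘(ℝ, E) (extChartAt 𝓘(ℝ, E) (1 : G)).symm
        (mulInvariantVectorField a) (range 𝓘(ℝ, E)) y =
      lam E G (y - extChartAt 𝓘(ℝ, E) (1 : G) 1) a := by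
  filter_upwards [extChartAt_target_mem_nhds (I := 𝓘(ℝ, E)) (1 : G)] with y hy
  have h1 := mfderiv_extChartAt_comp_mfderivWithin_extChartAt_symm (I := 𝓘(ℝ, E)) hy
  have h2 := mfderivWithin_extChartAt_symm_comp_mfderiv_extChartAt (I := 𝓘(ℝ, E)) hy
  rw [VectorField.mpullbackWithin_apply, ContinuousLinearMap.inverse_eq h2 h1]
  have hd : MDifferentiableAt 𝓘(ℝ, E) 𝓘(ℝ, E) (extChartAt 𝓘(ℝ, E) (1 : G))
      ((extChartAt 𝓘(ℝ, E) (1 : G)).symm y) :=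
    mdifferentiableAt_extChartAt (by simpa using (extChartAt 𝓘(ℝ, E) (1 : G)).map_target hy)
  have := mfderiv_comp_mulInvariant hd a
  refine this.trans ?_
  rw [leftDeriv, lam]
  have e : (fun z : E => mu E G (y - extChartAt 𝓘(ℝ, E) (1 : G) 1, z)) = fun z =>
      extChartAt 𝓘(ℝ, E) (1 : G) ((extChartAt 𝓘(ℝ, E) (1 : G)).symm y * ex E G z)
        - extChartAt 𝓘(ℝ, E) (1 : G) 1 := by
    ext z; simp [mu, lg, ex]
  rw [e, fderiv_sub_const]

lemma lieBracket_eq_br {VA VB : E → E} {o a b : E}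
    (ha : VA =ᶠ[𝓝 o] fun y => lam E G (y - o) a) (hb : VB =ᶠ[𝓝 o] fun y => lam E G (y - o) b) :
    VectorField.lieBracketWithin ℝ VA VB (univ ∩ range (fun x : E => x)) o = br E G a b := by
  have key : ∀ c : E, fderiv ℝ (fun y => lam E G (y - o) c)
      o =
        (ContinuousLinearMap.apply ℝ E c).comp (fderiv ℝ (lam E G) 0) := by
    intro c
    have h0 : HasFDerivAt (lam E G) (fderiv ℝ (lam E G) 0) (o -
        o) := by
      rw [sub_self]
      exact ((contDiffAt_lam E G).differentiableAt (by simp)).hasFDerivAt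
    exact ((ContinuousLinearMap.apply ℝ E c).hasFDerivAt.comp _
      (HasFDerivAt.comp (f := fun y => y - o) _ h0
        ((hasFDerivAt_id _).sub_const _))).fderiv
  rw [range_id', univ_inter, VectorField.lieBracketWithin_univ, VectorField.lieBracket,
    ha.fderiv_eq, hb.fderiv_eq, key, key, ha.self_of_nhds, hb.self_of_nhds]
  simp only [sub_self, lam_zero]
  rfl

/-- The Lie bracket of `GroupLieAlgebra` is the bracket at `1` of left-invariant vector fields, and
these are given by `lam` in the chart. -/
lemma bracket_eq_br (a b : GroupLieAlgebra 𝓘(ℝ, E) G) : ⁅a, b⁆ = br E G a b := by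
  let VA : E → E := VectorField.mpullbackWithin 𝓘(ℝ, E) 𝓘(ℝ, E)
    (extChartAt 𝓘(ℝ, E) (1 : G)).symm (mulInvariantVectorField a) (range 𝓘(ℝ, E))
  let VB : E → E := VectorField.mpullbackWithin 𝓘(ℝ, E) 𝓘(ℝ, E)
    (extChartAt 𝓘(ℝ, E) (1 : G)).symm (mulInvariantVectorField b) (range 𝓘(ℝ, E))
  have ha : VA =ᶠ[𝓝 (extChartAt 𝓘(ℝ, E) (1 : G) 1)]
      fun y : E => lam E G (y - extChartAt 𝓘(ℝ, E) (1 : G) 1) (a : E) :=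
    mpullbackWithin_mulInvariant (E := E) a
  have hb : VB =ᶠ[𝓝 (extChartAt 𝓘(ℝ, E) (1 : G) 1)]
      fun y : E => lam E G (y - extChartAt 𝓘(ℝ, E) (1 : G) 1) (b : E) :=
    mpullbackWithin_mulInvariant (E := E) b
  -- The definition of the bracket, with the derivative `D` of the chart at `1` kept as a variable.
  have h1 : ∀ D : E →L[ℝ] E, (mfderiv 𝓘(ℝ, E) 𝓘(ℝ, E) (extChartAt 𝓘(ℝ, E) (1 : G)) (1 : G) :
      E →L[ℝ] E) = D → (⁅a, b⁆ : GroupLieAlgebra 𝓘(ℝ, E) G) = D.inverse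
      (VectorField.lieBracketWithin (E := E) ℝ VA VB (univ ∩ range (fun x : E => x))
        (extChartAt 𝓘(ℝ, E) (1 : G) 1)) := by
    rintro D rfl; rfl
  have h2 := h1 _ mfderiv_extChartAt_one
  have h3 := lieBracket_eq_br (E := E) (G := G) ha hb
  rw [h3, ContinuousLinearMap.inverse_id] at h2
  exact h2

end Bracket

/-! ### Smooth functions of translates of the chart -/

section Translates

variable {E : Type*} [NormedAddCommGroup E] [NormedSpace ℝ E]
  {G : Type*} [TopologicalSpace G] [ChartedSpace E G] [Group G] [LieGroup 𝓘(ℝ, E) ∞ G]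
  {F : Type*} [NormedAddCommGroup F] [NormedSpace ℝ F]

lemma contDiffAt_of_contMDiffAt_comp {X : Type*} [NormedAddCommGroup X] [NormedSpace ℝ X]
    {f : G → F} (hf : ContMDiff 𝓘(ℝ, E) 𝓘(ℝ, F) ∞ f) {u : X → G} {x : X}
    (hu : ContMDiffAt 𝓘(ℝ, X) 𝓘(ℝ, E) ∞ u x) : ContDiffAt ℝ ∞ (fun x => f (u x)) x := by
  rw [← contMDiffAt_iff_contDiffAt]
  exact ContMDiffAt.comp x (g := f) hf.contMDiffAt hu

lemma eventually_contDiffAt_comp_mul_ex_mul {f : G → F} (hf : ContMDiff 𝓘(ℝ, E) 𝓘(ℝ, F) ∞ f) :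
    ∀ᶠ y in 𝓝 (0 : E), ∀ g q : G, ContDiffAt ℝ ∞ (fun y => f (g * ex E G y * q)) y := by
  filter_upwards [contMDiffAt_ex E G] with y hy g q
  exact contDiffAt_of_contMDiffAt_comp hf ((contMDiffAt_const.mul hy).mul contMDiffAt_const)

lemma hasFDerivAt_leftDeriv {f : G → F} (hf : ContMDiff 𝓘(ℝ, E) 𝓘(ℝ, F) ∞ f) (g : G) :
    HasFDerivAt (fun z : E => f (g * ex E G z)) (leftDeriv f g) 0 := by
  have := (eventually_contDiffAt_comp_mul_ex_mul hf).self_of_nhds g 1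
  simp only [mul_one] at this
  exact (this.differentiableAt (by simp)).hasFDerivAt

variable (E) in
lemma eventually_ex_lg_inv_mul (g₀ : G) :
    ∀ᶠ g in 𝓝 g₀, g₀ * ex E G (lg E G (g₀⁻¹ * g)) = g := by
  have := topologicalGroup_of_lieGroup 𝓘(ℝ, E) ∞ (G := G)
  have h : Tendsto (fun g : G => g₀⁻¹ * g) (𝓝 g₀) (𝓝 1) :=
    Continuous.tendsto' (by fun_prop) _ _ (by simp)
  filter_upwards [h.eventually (eventually_ex_lg E G)] with g hg
  rw [hg, mul_inv_cancel_left]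

variable (E) in
lemma eventually_ex_lg_mul_inv (g₀ : G) :
    ∀ᶠ g in 𝓝 g₀, ex E G (lg E G (g * g₀⁻¹)) * g₀ = g := by
  have := topologicalGroup_of_lieGroup 𝓘(ℝ, E) ∞ (G := G)
  have h : Tendsto (fun g : G => g * g₀⁻¹) (𝓝 g₀) (𝓝 1) :=
    Continuous.tendsto' (by fun_prop) _ _ (by simp)
  filter_upwards [h.eventually (eventually_ex_lg E G)] with g hg
  rw [hg, inv_mul_cancel_right]

variable (E) in
lemma tendsto_lg_inv_mul (g₀ : G) :
    Tendsto (fun g : G => lg E G (g₀⁻¹ * g)) (𝓝 g₀) (𝓝 0) := by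
  have := topologicalGroup_of_lieGroup 𝓘(ℝ, E) ∞ (G := G)
  have h : Tendsto (fun g : G => g₀⁻¹ * g) (𝓝 g₀) (𝓝 1) :=
    Continuous.tendsto' (by fun_prop) _ _ (by simp)
  have h2 := (contMDiffAt_lg E G).self_of_nhds.continuousAt.tendsto.comp h
  rw [lg_one] at h2
  exact h2

variable (E) in
lemma tendsto_lg_mul_inv (g₀ : G) :
    Tendsto (fun g : G => lg E G (g * g₀⁻¹)) (𝓝 g₀) (𝓝 0) := by
  have := topologicalGroup_of_lieGroup 𝓘(ℝ, E) ∞ (G := G)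
  have h : Tendsto (fun g : G => g * g₀⁻¹) (𝓝 g₀) (𝓝 1) :=
    Continuous.tendsto' (by fun_prop) _ _ (by simp)
  have h2 := (contMDiffAt_lg E G).self_of_nhds.continuousAt.tendsto.comp h
  rw [lg_one] at h2
  exact h2

lemma continuous_leftDeriv {f : G → F} (hf : ContMDiff 𝓘(ℝ, E) 𝓘(ℝ, F) ∞ f) :
    Continuous (leftDeriv (E := E) f) := by
  rw [continuous_iff_continuousAt]
  intro g₀
  set Φ : E × E → F := fun p => f (g₀ * ex E G p.1 * ex E G p.2) with hΦ
  have hΦs : ∀ᶠ p in 𝓝 (0 : E × E), ContDiffAt ℝ ∞ Φ p := by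
    have h1 : Tendsto (fun p : E × E => p.1) (𝓝 0) (𝓝 0) := continuous_fst.tendsto' _ _ rfl
    have h2 : Tendsto (fun p : E × E => p.2) (𝓝 0) (𝓝 0) := continuous_snd.tendsto' _ _ rfl
    filter_upwards [h1.eventually (contMDiffAt_ex E G), h2.eventually (contMDiffAt_ex E G)]
      with p p1 p2
    exact contDiffAt_of_contMDiffAt_comp hf
      ((contMDiffAt_const.mul (ex_comp G (u := fun p : E × E => p.1) p1 (by fun_prop))).mul
        (ex_comp G (u := fun p : E × E => p.2) p2 (by fun_prop)))
  have ha : Tendsto (fun a : E => (a, (0 : E))) (𝓝 0) (𝓝 0) :=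
    Continuous.tendsto' (by fun_prop) _ _ rfl
  have h3 : ∀ᶠ a in 𝓝 (0 : E), leftDeriv (E := E) f (g₀ * ex E G a) =
      (fderiv ℝ Φ (a, 0)).comp (ContinuousLinearMap.inr ℝ E E) := by
    filter_upwards [ha.eventually hΦs] with a h
    exact (HasFDerivAt.comp (0 : E) (h.differentiableAt (by simp)).hasFDerivAt
      (hasFDerivAt_prodMk_right a (0 : E))).fderiv
  have h4 : ContinuousAt (fun a : E => (fderiv ℝ Φ (a, 0)).comp
      (ContinuousLinearMap.inr ℝ E E)) 0 := by
    have h5 : ContinuousAt (fderiv ℝ Φ) ((0 : E), (0 : E)) :=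
      (hΦs.self_of_nhds.fderiv_right (m := ∞) (by simp)).continuousAt
    have h6 : ContinuousAt (fun a : E => fderiv ℝ Φ (a, 0)) 0 :=
      ContinuousAt.comp (f := fun a : E => (a, (0 : E))) h5 (by fun_prop)
    exact h6.clm_comp continuousAt_const
  have h7 : Tendsto (fun a : E => leftDeriv (E := E) f (g₀ * ex E G a)) (𝓝 0) (𝓝 (leftDeriv f g₀))
      := by
    have := h4.tendsto.congr' (h3.mono fun a h => h.symm)
    rw [← h3.self_of_nhds] at this
    simpa using this
  refine (h7.comp (tendsto_lg_inv_mul E g₀)).congr' ?_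
  filter_upwards [eventually_ex_lg_inv_mul E g₀] with g hg
  simp [Function.comp, hg]

lemma exists_bound_leftDeriv [CompactSpace G] {f : G → F} (hf : ContMDiff 𝓘(ℝ, E) 𝓘(ℝ, F) ∞ f) :
    ∃ K : ℝ, 0 ≤ K ∧ ∀ g, ‖leftDeriv (E := E) f g‖ ≤ K := by
  obtain ⟨K, hK⟩ := (isCompact_univ (X := G)).exists_bound_of_continuousOn
    (continuous_leftDeriv hf).continuousOn
  exact ⟨K, (norm_nonneg _).trans (hK 1 trivial), fun g => hK g trivial⟩

/-- The maps `y ↦ f (g * ex y * q)` are Lipschitz near `0`, uniformly in `g` and `q`. -/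
lemma exists_lipschitz_comp_mul_ex_mul [CompactSpace G] {f : G → F}
    (hf : ContMDiff 𝓘(ℝ, E) 𝓘(ℝ, F) ∞ f) :
    ∃ K : ℝ, 0 ≤ K ∧ ∃ r > 0, ∀ g q : G, ∀ y ∈ Metric.ball (0 : E) r, ∀ y' ∈ Metric.ball (0 : E) r,
      ‖f (g * ex E G y * q) - f (g * ex E G y' * q)‖ ≤ K * ‖y - y'‖ := by
  have loc : ∀ p : G × G, ∃ s ∈ 𝓝 p, ∃ K : ℝ, 0 ≤ K ∧ ∃ r > 0, ∀ x ∈ s,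
      ∀ y ∈ Metric.ball (0 : E) r, ∀ y' ∈ Metric.ball (0 : E) r,
      ‖f (x.1 * ex E G y * x.2) - f (x.1 * ex E G y' * x.2)‖ ≤ K * ‖y - y'‖ := by
    rintro ⟨g₀, q₀⟩
    -- The outer factors near `g₀` and `q₀` are also written in the chart, so that the constants of
    -- a single smooth function on `E × E × E` serve for all of them.
    set Φ : E × E × E → F := fun p => f (g₀ * ex E G p.1 * ex E G p.2.1 * (ex E G p.2.2 * q₀))
    have hΦ : ContDiffAt ℝ ∞ Φ (0, 0, 0) := by
      have h := (contMDiffAt_ex E G).self_of_nhds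
      exact contDiffAt_of_contMDiffAt_comp hf
        (((contMDiffAt_const.mul (ex_comp G (u := fun p : E × E × E => p.1) h (by fun_prop))).mul
          (ex_comp G (u := fun p : E × E × E => p.2.1) h (by fun_prop))).mul
          ((ex_comp G (u := fun p : E × E × E => p.2.2) h (by fun_prop)).mul contMDiffAt_const))
    obtain ⟨K, t, ht, hK⟩ := (hΦ.of_le (m := 1) (by simp)).exists_lipschitzOnWith
    obtain ⟨r, hr, hrt⟩ := Metric.mem_nhds_iff.1 ht
    refine ⟨{x | (g₀ * ex E G (lg E G (g₀⁻¹ * x.1)) = x.1 ∧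
        lg E G (g₀⁻¹ * x.1) ∈ Metric.ball (0 : E) r) ∧
        (ex E G (lg E G (x.2 * q₀⁻¹)) * q₀ = x.2 ∧ lg E G (x.2 * q₀⁻¹) ∈ Metric.ball (0 : E) r)},
        ?_, K, K.2, r, hr, ?_⟩
    · exact prod_mem_nhds
        ((eventually_ex_lg_inv_mul E g₀).and
          ((tendsto_lg_inv_mul E g₀) (Metric.ball_mem_nhds _ hr)))
        ((eventually_ex_lg_mul_inv E q₀).and
          ((tendsto_lg_mul_inv E q₀) (Metric.ball_mem_nhds _ hr)))
    · rintro ⟨g, q⟩ ⟨⟨h1, h2⟩, h3, h4⟩ y hy y' hy'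
      simp only [Metric.mem_ball, dist_zero_right] at h1 h2 h3 h4 hy hy'
      have m1 : (lg E G (g₀⁻¹ * g), y, lg E G (q * q₀⁻¹)) ∈ t := hrt (by
        rw [Metric.mem_ball, ← Prod.zero_eq_mk, ← Prod.zero_eq_mk, dist_zero_right]
        simp [Prod.norm_def, h2, h4, hy])
      have m2 : (lg E G (g₀⁻¹ * g), y', lg E G (q * q₀⁻¹)) ∈ t := hrt (by
        rw [Metric.mem_ball, ← Prod.zero_eq_mk, ← Prod.zero_eq_mk, dist_zero_right]
        simp [Prod.norm_def, h2, h4, hy'])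
      have := hK.norm_sub_le m1 m2
      simpa [Φ, h1, h3, Prod.norm_def] using this
  choose s hs K hK0 r hr h using loc
  obtain ⟨t, ht⟩ := finite_cover_nhds hs
  rcases t.eq_empty_or_nonempty with rfl | hne
  · simp only [Finset.notMem_empty, iUnion_of_empty, iUnion_empty] at ht
    exact (Set.empty_ne_univ ht).elim
  refine ⟨t.sup' hne K, ?_, t.inf' hne r, ?_, ?_⟩
  · obtain ⟨b, hb⟩ := hne
    exact (hK0 b).trans (Finset.le_sup' K hb)
  · rw [gt_iff_lt, Finset.lt_inf'_iff]; exact fun i _ => hr i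
  · intro g q y hy y' hy'
    have : (g, q) ∈ ⋃ x ∈ t, s x := by rw [ht]; trivial
    simp only [mem_iUnion] at this
    obtain ⟨p, hp, hgq⟩ := this
    have hle : t.inf' hne r ≤ r p := Finset.inf'_le r hp
    refine (h p (g, q) hgq y (Metric.ball_subset_ball hle hy) y'
      (Metric.ball_subset_ball hle hy')).trans ?_
    gcongr
    exact Finset.le_sup' K hp

end Translates

/-! ### A bi-invariant distance -/

section GroupDist

/-- A bi-invariant distance on `G`, the supremum over all two-sided translates of the distance
induced by `ι : G → V`. The supremum is finite when `G` is compact and `ι` is continuous. -/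
noncomputable def gdist {G V : Type*} [Group G] [NormedAddCommGroup V] (ι : G → V) (g h : G) : ℝ :=
  ⨆ p : G × G, ‖ι (p.1 * g * p.2) - ι (p.1 * h * p.2)‖

variable {E : Type*} [NormedAddCommGroup E] [NormedSpace ℝ E]
  {G : Type*} [TopologicalSpace G] [ChartedSpace E G] [Group G] [LieGroup 𝓘(ℝ, E) ∞ G]
  [CompactSpace G] {V : Type*} [NormedAddCommGroup V] [NormedSpace ℝ V]
  {ι : G → V}

lemma gdist_le {g h : G} {c : ℝ} (H : ∀ k l, ‖ι (k * g * l) - ι (k * h * l)‖ ≤ c) :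
    gdist ι g h ≤ c := ciSup_le fun p => H p.1 p.2

lemma gdist_self (g : G) : gdist ι g g = 0 := by simp [gdist]

lemma gdist_comm (g h : G) : gdist ι g h = gdist ι h g := by
  simp only [gdist]; congr 1; ext p; exact norm_sub_rev _ _

lemma gdist_nonneg (g h : G) : 0 ≤ gdist ι g h := Real.iSup_nonneg fun _ => norm_nonneg _

variable (hι : Continuous ι)
include hι

lemma norm_sub_le_gdist (g h k l : G) : ‖ι (k * g * l) - ι (k * h * l)‖ ≤ gdist ι g h := by
  obtain ⟨C, hC⟩ := (isCompact_univ (X := G)).exists_bound_of_continuousOn hι.continuousOn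
  refine le_ciSup (f := fun p : G × G => ‖ι (p.1 * g * p.2) - ι (p.1 * h * p.2)‖) ?_ (k, l)
  refine ⟨C + C, ?_⟩
  rintro _ ⟨p, rfl⟩
  exact (norm_sub_le _ _).trans (add_le_add (hC _ trivial) (hC _ trivial))

lemma norm_sub_le_gdist' (g h : G) : ‖ι g - ι h‖ ≤ gdist ι g h := by
  simpa using norm_sub_le_gdist hι g h 1 1

lemma gdist_triangle (g h k : G) : gdist ι g k ≤ gdist ι g h + gdist ι h k :=
  gdist_le fun a b => (norm_sub_le_norm_sub_add_norm_sub _ (ι (a * h * b)) _).trans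
    (add_le_add (norm_sub_le_gdist hι _ _ _ _) (norm_sub_le_gdist hι _ _ _ _))

lemma gdist_mul_left (k g h : G) : gdist ι (k * g) (k * h) = gdist ι g h := by
  have key : ∀ k g h : G, gdist ι (k * g) (k * h) ≤ gdist ι g h := fun k g h =>
    gdist_le fun a b => by simpa [mul_assoc] using norm_sub_le_gdist hι g h (a * k) b
  refine le_antisymm (key k g h) ?_
  simpa using key k⁻¹ (k * g) (k * h)

lemma gdist_mul_right (g h k : G) : gdist ι (g * k) (h * k) = gdist ι g h := by
  have key : ∀ k g h : G, gdist ι (g * k) (h * k) ≤ gdist ι g h := fun k g h =>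
    gdist_le fun a b => by simpa [mul_assoc] using norm_sub_le_gdist hι g h a (k * b)
  refine le_antisymm (key k g h) ?_
  simpa using key k⁻¹ (g * k) (h * k)

lemma gdist_inv (g h : G) : gdist ι g⁻¹ h⁻¹ = gdist ι g h := by
  rw [← gdist_mul_left hι g, ← gdist_mul_right hι _ _ h, gdist_comm]
  simp

lemma gdist_mul_le (g h g' h' : G) : gdist ι (g * h) (g' * h') ≤ gdist ι g g' + gdist ι h h' := by
  refine (gdist_triangle hι _ (g' * h) _).trans ?_
  rw [gdist_mul_right hι, gdist_mul_left hι]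

lemma eq_of_gdist_le_zero (hinj : Function.Injective ι) {g h : G} (H : gdist ι g h ≤ 0) :
    g = h := by
  apply hinj
  rw [← sub_eq_zero, ← norm_le_zero_iff]
  exact (norm_sub_le_gdist' hι g h).trans H

omit hι

/-- Every translated chart of `G` is, near its centre, the restriction along `ι` of a map on `V`
that is smooth at the image of the centre. -/
lemma exists_chart_extension (hι : Manifold.IsSmoothEmbedding 𝓘(ℝ, E) 𝓘(ℝ, V) ∞ ι) (g₀ : G) :
    ∃ κ : V → E, ContDiffAt ℝ ∞ κ (ι g₀) ∧ ∀ᶠ g in 𝓝 g₀, κ (ι g) = lg E G (g₀⁻¹ * g) := by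
  obtain ⟨P, hP, hPι⟩ := exists_local_left_inverse (hι.isImmersion.isImmersionAt g₀)
  refine ⟨fun v => lg E G (g₀⁻¹ * P v), ?_, ?_⟩
  · rw [← contMDiffAt_iff_contDiffAt]
    have h1 : ContMDiffAt 𝓘(ℝ, V) 𝓘(ℝ, E) ∞ (fun v => g₀⁻¹ * P v) (ι g₀) :=
      contMDiffAt_const.mul hP
    have h2 : ContMDiffAt 𝓘(ℝ, E) 𝓘(ℝ, E) ∞ (lg E G) (g₀⁻¹ * P (ι g₀)) := by
      rw [hPι.self_of_nhds, inv_mul_cancel]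
      exact (contMDiffAt_lg E G).self_of_nhds
    exact ContMDiffAt.comp _ (g := lg E G) h2 h1
  · filter_upwards [hPι] with g hg
    rw [hg]

/-- The bi-invariant distance is equivalent to the one induced by `ι`. -/
lemma exists_gdist_le (hι : Manifold.IsSmoothEmbedding 𝓘(ℝ, E) 𝓘(ℝ, V) ∞ ι) :
    ∃ C : ℝ, 0 ≤ C ∧ ∀ g h : G, gdist ι g h ≤ C * ‖ι g - ι h‖ := by
  have hc := hι.contMDiff
  have hcont : Continuous ι := hc.continuous
  obtain ⟨B, hB⟩ := (isCompact_univ (X := G)).exists_bound_of_continuousOn hcont.continuousOn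
  obtain ⟨K, hK0, r, hr, hK⟩ := exists_lipschitz_comp_mul_ex_mul hc
  have loc : ∀ p : G × G, ∃ s ∈ 𝓝 p, ∃ C : ℝ, 0 ≤ C ∧ ∀ x ∈ s,
      gdist ι x.1 x.2 ≤ C * ‖ι x.1 - ι x.2‖ := by
    rintro ⟨g₀, h₀⟩
    by_cases heq : g₀ = h₀
    -- Near the diagonal, both sides are compared with the distance in a chart.
    · subst heq
      obtain ⟨κ, hκ, hκι⟩ := exists_chart_extension hι g₀
      obtain ⟨L, t, ht, hL⟩ := (hκ.of_le (m := 1) (by simp)).exists_lipschitzOnWith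
      set s : Set G := {g | (κ (ι g) = lg E G (g₀⁻¹ * g) ∧ g₀ * ex E G (lg E G (g₀⁻¹ * g)) = g) ∧
        lg E G (g₀⁻¹ * g) ∈ Metric.ball (0 : E) r ∧ ι g ∈ t}
      have hs : s ∈ 𝓝 g₀ := (hκι.and (eventually_ex_lg_inv_mul E g₀)).and
          (((tendsto_lg_inv_mul E g₀).eventually (Metric.ball_mem_nhds _ hr)).and
            (hcont.continuousAt.eventually ht))
      refine ⟨s ×ˢ s, prod_mem_nhds hs hs, K * L, by positivity, ?_⟩
      rintro ⟨g, h⟩ ⟨⟨⟨g1, g2⟩, g3, g4⟩, ⟨h1, h2⟩, h3, h4⟩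
      refine gdist_le fun k l => ?_
      have e := hK (k * g₀) l _ g3 _ h3
      rw [mul_assoc k g₀, g2, mul_assoc k g₀, h2] at e
      refine e.trans ?_
      rw [mul_assoc]
      gcongr
      rw [← g1, ← h1]
      exact hL.norm_sub_le g4 h4
    -- Away from the diagonal, `gdist` is bounded and `‖ι g - ι h‖` is bounded below.
    · have hne : 0 < ‖ι g₀ - ι h₀‖ := by
        rw [norm_sub_pos_iff]; exact fun h => heq (hι.isEmbedding.injective h)
      set δ := ‖ι g₀ - ι h₀‖ / 2
      have hδ : 0 < δ := by positivity
      have hB0 : 0 ≤ B := (norm_nonneg _).trans (hB 1 trivial)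
      refine ⟨{x | δ < ‖ι x.1 - ι x.2‖}, ?_, 2 * B / δ, by positivity, ?_⟩
      · have : Continuous fun x : G × G => ‖ι x.1 - ι x.2‖ := by fun_prop
        exact this.continuousAt.eventually (lt_mem_nhds (by simp only [δ]; linarith))
      · rintro ⟨g, h⟩ hgh
        refine gdist_le fun k l => ?_
        have h1 : ‖ι (k * g * l) - ι (k * h * l)‖ ≤ 2 * B :=
          (norm_sub_le _ _).trans (by linarith [hB (k * g * l) trivial, hB (k * h * l) trivial])
        refine h1.trans ?_
        rw [div_mul_eq_mul_div, le_div_iff₀ hδ]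
        have h2 : δ < ‖ι g - ι h‖ := hgh
        gcongr
  choose s hs C hC0 h using loc
  obtain ⟨t, ht⟩ := finite_cover_nhds hs
  refine ⟨∑ p ∈ t, C p, Finset.sum_nonneg fun p _ => hC0 p, fun g k => ?_⟩
  have : (g, k) ∈ ⋃ x ∈ t, s x := by rw [ht]; trivial
  simp only [mem_iUnion] at this
  obtain ⟨p, hp, hgq⟩ := this
  refine (h p (g, k) hgq).trans ?_
  gcongr
  exact Finset.single_le_sum (fun q _ => hC0 q) hp

end GroupDist

/-! ### Solutions of `γ' = γ · a` with integrable `a` -/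

section AbsCont

variable {F : Type*} [NormedAddCommGroup F] [NormedSpace ℝ F]

lemma absolutelyContinuousOnInterval_of_dist_le {Ψ : ℝ → F} {β : ℝ → ℝ} {s t : ℝ}
    (hβ : AbsolutelyContinuousOnInterval β s t)
    (h : ∀ x ∈ uIcc s t, ∀ y ∈ uIcc s t, dist (Ψ x) (Ψ y) ≤ dist (β x) (β y)) :
    AbsolutelyContinuousOnInterval Ψ s t := by
  refine squeeze_zero' (.of_forall fun _ => Finset.sum_nonneg fun _ _ => dist_nonneg) ?_ hβ
  filter_upwards [eventually_inf_principal.2 (.of_forall fun _ h => h)] with I hI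
  exact Finset.sum_le_sum fun i hi => h _ (hI.1 i hi).1 _ (hI.1 i hi).2

/-- A fundamental theorem of calculus: a function whose increments are dominated by an integral, and
which has an integrable derivative almost everywhere, is the primitive of this derivative. -/
lemma sub_eq_integral_of_ae_hasDerivAt [FiniteDimensional ℝ F] {Φ φ : ℝ → F} {w h : ℝ → ℝ}
    {s t : ℝ} (hst : s ≤ t)
    (hw : IntervalIntegrable w volume s t) (hh : IntervalIntegrable h volume s t)
    (hΦ : ∀ x ∈ Icc s t, ∀ y ∈ Icc s t, x ≤ y → ‖Φ y - Φ x‖ ≤ ∫ τ in x..y, w τ)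
    (hd : ∀ᵐ τ, τ ∈ Icc s t → HasDerivAt Φ (φ τ) τ) (hφ : ∀ᵐ τ, τ ∈ Icc s t → ‖φ τ‖ ≤ h τ) :
    IntervalIntegrable φ volume s t ∧ Φ t - Φ s = ∫ τ in s..t, φ τ := by
  have : CompleteSpace F := FiniteDimensional.complete ℝ F
  have hφi : IntervalIntegrable φ volume s t := by
    rw [intervalIntegrable_iff_integrableOn_Icc_of_le hst] at hh ⊢
    refine Integrable.mono' hh ?_ ?_
    · refine (aestronglyMeasurable_deriv Φ _).congr ?_
      rw [EventuallyEq, ae_restrict_iff' measurableSet_Icc]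
      filter_upwards [hd] with τ h1 h2 using (h1 h2).deriv
    · rw [ae_restrict_iff' measurableSet_Icc]; exact hφ
  refine ⟨hφi, ?_⟩
  set β : ℝ → ℝ := fun x => ∫ τ in s..x, (w τ + ‖φ τ‖)
  have hβi : IntervalIntegrable (fun τ => w τ + ‖φ τ‖) volume s t := hw.add hφi.norm
  have hβ : AbsolutelyContinuousOnInterval β s t :=
    hβi.absolutelyContinuousOnInterval_intervalIntegral left_mem_uIcc
  have sub : ∀ x ∈ Icc s t, ∀ y ∈ Icc s t, uIcc x y ⊆ uIcc s t := fun x hx y hy =>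
    uIcc_subset_uIcc (by rwa [uIcc_of_le hst]) (by rwa [uIcc_of_le hst])
  have hs : s ∈ Icc s t := left_mem_Icc.2 hst
  have ht : t ∈ Icc s t := right_mem_Icc.2 hst
  -- `Ψ` is absolutely continuous, its increments being dominated by those of `β`, and its
  -- derivative vanishes almost everywhere.
  set Ψ : ℝ → F := fun x => Φ x - ∫ τ in s..x, φ τ
  have key : ∀ x ∈ Icc s t, ∀ y ∈ Icc s t, x ≤ y → dist (Ψ x) (Ψ y) ≤ dist (β x) (β y) := by
    intro x hx y hy hxy
    have e1 : Ψ y - Ψ x = (Φ y - Φ x) - ∫ τ in x..y, φ τ := by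
      have := intervalIntegral.integral_interval_sub_left
        (hφi.mono_set (sub s hs y hy)) (hφi.mono_set (sub s hs x hx))
      rw [← this]; simp only [Ψ]; abel
    have e2 : β y - β x = ∫ τ in x..y, (w τ + ‖φ τ‖) :=
      intervalIntegral.integral_interval_sub_left
        (hβi.mono_set (sub s hs y hy)) (hβi.mono_set (sub s hs x hx))
    rw [dist_comm, dist_eq_norm, dist_comm (β x), Real.dist_eq, e1, e2]
    refine (norm_sub_le _ _).trans (le_trans ?_ (le_abs_self _))
    rw [intervalIntegral.integral_add (hw.mono_set (sub x hx y hy))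
      (hφi.norm.mono_set (sub x hx y hy))]
    exact add_le_add (hΦ x hx y hy hxy) (intervalIntegral.norm_integral_le_integral_norm hxy)
  have hΨ : AbsolutelyContinuousOnInterval Ψ s t := by
    refine absolutelyContinuousOnInterval_of_dist_le hβ ?_
    rw [uIcc_of_le hst]
    intro x hx y hy
    rcases le_total x y with h | h
    · exact key x hx y hy h
    · rw [dist_comm, dist_comm (β x)]; exact key y hy x hx h
  obtain ⟨c, hc⟩ := hΨ.const_of_ae_hasDerivAt_zero (by
    filter_upwards [hd, hφi.ae_hasDerivAt_integral] with τ h1 h2 h3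
    have := (h1 (by rwa [uIcc_of_le hst] at h3)).sub (h2 h3 s left_mem_uIcc)
    rwa [sub_self] at this)
  have c1 := hc s left_mem_uIcc
  have c2 := hc t right_mem_uIcc
  simp only [Ψ, intervalIntegral.integral_same, sub_zero] at c1 c2
  rw [c1, ← c2]; abel

end AbsCont

section Sol

variable {E : Type*} [NormedAddCommGroup E] [NormedSpace ℝ E] [FiniteDimensional ℝ E]
  {G : Type*} [TopologicalSpace G] [ChartedSpace E G] [Group G] [LieGroup 𝓘(ℝ, E) ∞ G]
  [CompactSpace G] {V : Type*} [NormedAddCommGroup V] [NormedSpace ℝ V] [FiniteDimensional ℝ V]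
  {ι : G → V}

/-- `γ` is a solution on `[0,1]` of the ordinary differential equation `γ' = γ · a`, in integrated
form. -/
structure IsSol (ι : G → V) (a : ℝ → E) (γ : ℝ → G) : Prop where
  cont : ContinuousOn γ (Icc 0 1)
  eq : ∀ t ∈ Icc (0 : ℝ) 1, ι (γ t) = ι (γ 0) + ∫ τ in (0 : ℝ)..t, leftDeriv (E := E) ι (γ τ) (a τ)

/-- `γ` has derivative `γ(τ) · a` at `τ`, read in the chart centred at `γ(τ)`. -/
def HasLogDerivAt (γ : ℝ → G) (a : E) (τ : ℝ) : Prop :=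
  ContinuousAt γ τ ∧ HasDerivAt (fun σ => lg E G ((γ τ)⁻¹ * γ σ)) a τ

/-- The logarithmic derivative determines the derivative of every smooth function along the path. -/
lemma HasLogDerivAt.hasDerivAt {F : Type*} [NormedAddCommGroup F] [NormedSpace ℝ F] {f : G → F}
    (hf : ContMDiff 𝓘(ℝ, E) 𝓘(ℝ, F) ∞ f) {γ : ℝ → G} {a : E}
    {τ : ℝ} (h : HasLogDerivAt γ a τ) : HasDerivAt (fun t => f (γ t)) (leftDeriv f (γ τ) a) τ := by
  have h1 : HasFDerivAt (fun z : E => f (γ τ * ex E G z)) (leftDeriv f (γ τ))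
      (lg E G ((γ τ)⁻¹ * γ τ)) := by
    rw [inv_mul_cancel, lg_one]
    exact hasFDerivAt_leftDeriv hf _
  refine (h1.comp_hasDerivAt τ h.2).congr_of_eventuallyEq ?_
  filter_upwards [h.1.eventually (eventually_ex_lg_inv_mul E (γ τ))] with t ht
  simp [ht]

/-- The derivative of `ι ∘ γ` determines the logarithmic derivative, because `ι` is an immersion. -/
lemma hasLogDerivAt_of_hasDerivAt (hι : Manifold.IsSmoothEmbedding 𝓘(ℝ, E) 𝓘(ℝ, V) ∞ ι)
    {γ : ℝ → G} {a : E} {τ : ℝ} (hγ : ContinuousAt γ τ)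
    (h : HasDerivAt (fun t => ι (γ t)) (leftDeriv ι (γ τ) a) τ) : HasLogDerivAt γ a τ := by
  refine ⟨hγ, ?_⟩
  obtain ⟨κ, hκ, hκι⟩ := exists_chart_extension hι (γ τ)
  have hκd := (hκ.differentiableAt (by simp)).hasFDerivAt
  have h1 := hκd.comp_hasDerivAt τ h
  have h2 : HasFDerivAt (fun z : E => ι (γ τ * ex E G z)) (leftDeriv ι (γ τ)) 0 :=
    hasFDerivAt_leftDeriv hι.contMDiff _
  have h3 : HasFDerivAt κ (fderiv ℝ κ (ι (γ τ))) (ι (γ τ * ex E G (0 : E))) := by simpa using hκd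
  have h4 := HasFDerivAt.comp (0 : E) h3 h2
  have := topologicalGroup_of_lieGroup 𝓘(ℝ, E) ∞ (G := G)
  have hex : Tendsto (fun z => γ τ * ex E G z) (𝓝 (0 : E)) (𝓝 (γ τ)) := by
    have := ((continuous_const_mul (γ τ)).continuousAt (x := ex E G 0)).tendsto.comp
      (contMDiffAt_ex E G).self_of_nhds.continuousAt.tendsto
    simpa [Function.comp_def] using this
  have h5 : HasFDerivAt (id : E → E) ((fderiv ℝ κ (ι (γ τ))).comp (leftDeriv ι (γ τ))) 0 := by
    refine h4.congr_of_eventuallyEq ?_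
    filter_upwards [hex.eventually hκι, eventually_lg_ex E G] with z hz hz'
    simp [Function.comp, hz, hz']
  have h6 := congrArg (fun L : E →L[ℝ] E => L a) (h5.unique (hasFDerivAt_id 0))
  simp only [ContinuousLinearMap.comp_apply, ContinuousLinearMap.coe_id', id_eq] at h6
  rw [h6] at h1
  refine h1.congr_of_eventuallyEq ?_
  filter_upwards [hγ.eventually hκι] with t ht
  simp [Function.comp, ht]

lemma integrable_leftDeriv_apply {f : G → V} (hf : ContMDiff 𝓘(ℝ, E) 𝓘(ℝ, V) ∞ f)
    {X : Type*} [MeasurableSpace X] {ν : Measure X} {u : X → G} {a : X → E}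
    (hu : AEStronglyMeasurable (fun x => leftDeriv (E := E) f (u x)) ν) (ha : Integrable a ν) :
    Integrable (fun x => leftDeriv (E := E) f (u x) (a x)) ν := by
  obtain ⟨K, hK0, hK⟩ := exists_bound_leftDeriv hf
  refine (ha.norm.const_mul K).mono' ?_ (.of_forall fun x => ?_)
  · exact (isBoundedBilinearMap_apply (𝕜 := ℝ) (E := E) (F :=
        V)).continuous.comp_aestronglyMeasurable
      (hu.prodMk ha.1)
  · exact (ContinuousLinearMap.le_opNorm _ _).trans (by gcongr; exact hK _)

lemma intervalIntegrable_leftDeriv_apply {f : G → V} (hf : ContMDiff 𝓘(ℝ, E) 𝓘(ℝ, V) ∞ f) {a : ℝ →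
    E}
    {γ : ℝ → G} (hγ : ContinuousOn γ (Icc 0 1)) (ha : IntervalIntegrable a volume 0 1) :
    IntervalIntegrable (fun τ => leftDeriv (E := E) f (γ τ) (a τ)) volume 0 1 := by
  rw [intervalIntegrable_iff_integrableOn_Icc_of_le zero_le_one] at ha ⊢
  exact integrable_leftDeriv_apply hf
    (((continuous_leftDeriv hf).comp_continuousOn hγ).aestronglyMeasurable measurableSet_Icc) ha

lemma uIcc_subset_uIcc_zero_one {s t : ℝ} (hs : s ∈ Icc (0 : ℝ) 1) (ht : t ∈ Icc (0 : ℝ) 1) :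
    uIcc s t ⊆ uIcc (0 : ℝ) 1 :=
  uIcc_subset_uIcc (by rwa [uIcc_of_le zero_le_one]) (by rwa [uIcc_of_le zero_le_one])

lemma IsSol.sub_eq (hι : ContMDiff 𝓘(ℝ, E) 𝓘(ℝ, V) ∞ ι) {a : ℝ → E} {γ : ℝ → G}
    (h : IsSol ι a γ) (ha : IntervalIntegrable a volume 0 1) {s t : ℝ}
    (hs : s ∈ Icc (0 : ℝ) 1) (ht : t ∈ Icc (0 : ℝ) 1) :
    ι (γ t) - ι (γ s) = ∫ τ in s..t, leftDeriv (E := E) ι (γ τ) (a τ) := by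
  have hi := intervalIntegrable_leftDeriv_apply hι h.cont ha
  have h0 : (0 : ℝ) ∈ Icc (0 : ℝ) 1 := by simp
  rw [h.eq t ht, h.eq s hs, ← intervalIntegral.integral_interval_sub_left
    (hi.mono_set (uIcc_subset_uIcc_zero_one h0 ht))
    (hi.mono_set (uIcc_subset_uIcc_zero_one h0 hs))]
  abel

/-- The distance travelled by a solution is controlled by the integral of the driving function. -/
lemma exists_gdist_isSol_le (hι : Manifold.IsSmoothEmbedding 𝓘(ℝ, E) 𝓘(ℝ, V) ∞ ι) :
    ∃ C : ℝ, 0 ≤ C ∧ ∀ (a : ℝ → E) (γ : ℝ → G), IsSol ι a γ → IntervalIntegrable a volume 0 1 →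
      ∀ s ∈ Icc (0 : ℝ) 1, ∀ t ∈ Icc (0 : ℝ) 1, s ≤ t →
        gdist ι (γ t) (γ s) ≤ C * ∫ τ in s..t, ‖a τ‖ := by
  obtain ⟨C, hC0, hC⟩ := exists_gdist_le hι
  obtain ⟨K, hK0, hK⟩ := exists_bound_leftDeriv hι.contMDiff
  refine ⟨C * K, by positivity, fun a γ h ha s hs t ht hst => (hC _ _).trans ?_⟩
  rw [mul_assoc]
  gcongr
  rw [h.sub_eq hι.contMDiff ha hs ht, ← intervalIntegral.integral_const_mul]
  refine intervalIntegral.norm_integral_le_of_norm_le hst (.of_forall fun τ _ => ?_)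
    ((ha.norm.mono_set (uIcc_subset_uIcc_zero_one hs ht)).const_mul K)
  exact (ContinuousLinearMap.le_opNorm _ _).trans (by gcongr; exact hK _)

lemma IsSol.ae_hasLogDerivAt (hι : Manifold.IsSmoothEmbedding 𝓘(ℝ, E) 𝓘(ℝ, V) ∞ ι)
    {a : ℝ → E} {γ : ℝ → G} (h : IsSol ι a γ) (ha : IntervalIntegrable a volume 0 1) :
    ∀ᵐ τ, τ ∈ Icc (0 : ℝ) 1 → HasLogDerivAt γ (a τ) τ := by
  have : CompleteSpace V := FiniteDimensional.complete ℝ V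
  have hi := intervalIntegrable_leftDeriv_apply hι.contMDiff h.cont ha
  have h0 : ∀ᵐ x : ℝ, x ≠ 0 := by simp [ae_iff, measure_singleton]
  have h1 : ∀ᵐ x : ℝ, x ≠ 1 := by simp [ae_iff, measure_singleton]
  filter_upwards [hi.ae_hasDerivAt_integral, h0, h1] with τ hτ n0 n1 hm
  have hn : Icc (0 : ℝ) 1 ∈ 𝓝 τ := Icc_mem_nhds (lt_of_le_of_ne hm.1 n0.symm)
    (lt_of_le_of_ne hm.2 n1)
  refine hasLogDerivAt_of_hasDerivAt hι (h.cont.continuousAt hn) ?_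
  have := (hτ (by rwa [uIcc_of_le zero_le_one]) 0 left_mem_uIcc).const_add (ι (γ 0))
  refine this.congr_of_eventuallyEq ?_
  filter_upwards [hn] with t ht
  exact h.eq t ht

end Sol

/-! ### Comparison of solutions -/

section Compare

variable {E : Type*} [NormedAddCommGroup E] [NormedSpace ℝ E] [FiniteDimensional ℝ E]
  {G : Type*} [TopologicalSpace G] [ChartedSpace E G] [Group G] [LieGroup 𝓘(ℝ, E) ∞ G]
  [CompactSpace G] {V : Type*} [NormedAddCommGroup V] [NormedSpace ℝ V] [FiniteDimensional ℝ V]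
  {ι : G → V}

/-- The derivative of `S · ex y · R⁻¹` for paths `S` and `R` with logarithmic derivatives `a` and
`b`; it follows from the derivative of `nu`. -/
lemma eventually_hasDerivAt_mul_ex_mul_inv (hι : ContMDiff 𝓘(ℝ, E) 𝓘(ℝ, V) ∞ ι) :
    ∀ᶠ y₀ in 𝓝 (0 : E), ∀ (S R : ℝ → G) (y : ℝ → E) (a v b : E) (τ : ℝ) (k l : G),
      HasLogDerivAt S a τ → HasLogDerivAt R b τ → HasDerivAt y v τ → y τ = y₀ →
      HasDerivAt (fun t => ι (k * (S t * ex E G (y t) * (R t)⁻¹) * l))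
        (fderiv ℝ (fun z : E => ι (k * S τ * ex E G z * ((R τ)⁻¹ * l))) y₀
          (rho E G y₀ a + v - lam E G y₀ b)) τ := by
  have h : Tendsto (fun y : E => ((0 : E), y, (0 : E))) (𝓝 0) (𝓝 0) :=
    Continuous.tendsto' (by fun_prop) _ _ rfl
  filter_upwards [eventually_contDiffAt_comp_mul_ex_mul hι, eventually_hasFDerivAt_nu E G,
    eventually_lg_ex E G, h.eventually (eventually_ex_nu E G).eventually_nhds] with y₀ h1 h2 h3 h4
    S R y a v b τ k l hS hR hy hyτ
  obtain ⟨L, hL, hLe⟩ := h2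
  obtain ⟨p, hp⟩ : ∃ p : ℝ → E × E × E, ∀ t, p t =
    (lg E G ((S τ)⁻¹ * S t), y t, lg E G ((R τ)⁻¹ * R t)) := ⟨_, fun _ => rfl⟩
  have e1 : HasDerivAt p (a, v, b) τ := by
    rw [show p = _ from funext hp]
    exact hS.2.prodMk (hy.prodMk hR.2)
  have p0 : p τ = (0, y₀, 0) := by simp [hp, hyτ]
  rw [← p0] at hL
  have e2 := hL.comp_hasDerivAt τ e1
  rw [hLe] at e2
  have e3 := ((h1 (k * S τ) ((R τ)⁻¹ * l)).differentiableAt (by simp)).hasFDerivAt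
  have n0 : (nu E G ∘ p) τ = y₀ := by simp [nu, h3, p0]
  have e3' : HasFDerivAt (fun y => ι (k * S τ * ex E G y * ((R τ)⁻¹ * l)))
      (fderiv ℝ (fun y => ι (k * S τ * ex E G y * ((R τ)⁻¹ * l))) y₀) ((nu E G ∘ p) τ) := by
    rw [n0]; exact e3
  refine (e3'.comp_hasDerivAt τ e2).congr_of_eventuallyEq ?_
  have hc := e1.continuousAt.tendsto
  rw [p0] at hc
  filter_upwards [hc.eventually h4, hS.1.eventually (eventually_ex_lg_inv_mul E (S τ)),
    hR.1.eventually (eventually_ex_lg_inv_mul E (R τ))] with t t1 t2 t3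
  rw [← eq_inv_mul_iff_mul_eq] at t2 t3
  simp only [Function.comp, t1]
  simp only [hp]
  rw [t2, t3]
  congr 1
  group

/-- The comparison estimate: for solutions `S` and `R` linked by a short path `ex ∘ y`, the product
`S · ex y · R⁻¹` moves with a speed controlled by the mismatch of the driving functions. -/
lemma exists_gdist_mul_ex_mul_inv_le (hι : Manifold.IsSmoothEmbedding 𝓘(ℝ, E) 𝓘(ℝ, V) ∞ ι) :
    ∃ K : ℝ, 0 ≤ K ∧ ∃ r > 0, (∀ x ∈ Metric.ball (0 : E) r, DifferentiableAt ℝ (rho E G) x ∧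
        DifferentiableAt ℝ (lam E G) x) ∧ ∀ (a b : ℝ → E) (S R : ℝ → G) (y v : ℝ → E) (s t : ℝ),
      IsSol ι a S → IsSol ι b R → IntervalIntegrable a volume 0 1 →
      IntervalIntegrable b volume 0 1 → s ∈ Icc (0 : ℝ) 1 → t ∈ Icc (0 : ℝ) 1 → s ≤ t →
      (∀ τ ∈ Icc s t, HasDerivAt y (v τ) τ) → ContinuousOn v (Icc s t) →
      (∀ τ ∈ Icc s t, y τ ∈ Metric.ball (0 : E) r) →
      gdist ι (S t * ex E G (y t) * (R t)⁻¹) (S s * ex E G (y s) * (R s)⁻¹) ≤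
        K * ∫ τ in s..t, ‖rho E G (y τ) (a τ) + v τ - lam E G (y τ) (b τ)‖ := by
  have hc := hι.contMDiff
  have : CompleteSpace E := FiniteDimensional.complete ℝ E
  obtain ⟨K, hK0, r₁, hr₁, hK⟩ := exists_lipschitz_comp_mul_ex_mul hc
  obtain ⟨C, hC0, hC⟩ := exists_gdist_isSol_le hι
  have ev : ∀ᶠ x in 𝓝 (0 : E), DifferentiableAt ℝ (rho E G) x ∧ DifferentiableAt ℝ (lam E G) x := by
    filter_upwards [((contDiffAt_rho E G).of_le (m := 1) (by simp)).eventually (by simp),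
      ((contDiffAt_lam E G).of_le (m := 1) (by simp)).eventually (by simp)] with x h1 h2
    exact ⟨h1.differentiableAt (by simp), h2.differentiableAt (by simp)⟩
  obtain ⟨r, hr, hball⟩ := Metric.eventually_nhds_iff_ball.1
    ((ev.and (eventually_hasDerivAt_mul_ex_mul_inv hc)).and (Metric.ball_mem_nhds (0 : E) hr₁))
  refine ⟨K, hK0, r, hr, fun x hx => (hball x hx).1.1, ?_⟩
  intro a b S R y v s t hS hR ha hb hs ht hst hy hv hyr
  have hycont : ContinuousOn y (Icc s t) := fun τ hτ => (hy τ hτ).continuousAt.continuousWithinAt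
  have hai := ha.mono_set (uIcc_subset_uIcc_zero_one hs ht)
  have hbi := hb.mono_set (uIcc_subset_uIcc_zero_one hs ht)
  have hvi : IntervalIntegrable v volume s t := hv.intervalIntegrable_of_Icc hst
  have clm : ∀ (T : E → E →L[ℝ] E) (c : ℝ → E), (∀ x ∈ Metric.ball (0 : E) r, ContinuousAt T x) →
      IntervalIntegrable c volume s t → IntervalIntegrable (fun τ => T (y τ) (c τ)) volume s t := by
    intro T c hT hci
    have hTc : ContinuousOn (fun τ => T (y τ)) (Icc s t) := fun τ hτ =>
      (hT _ (hyr τ hτ)).comp_continuousWithinAt (hycont τ hτ)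
    obtain ⟨B, hB⟩ := isCompact_Icc.exists_bound_of_continuousOn hTc
    rw [intervalIntegrable_iff_integrableOn_Icc_of_le hst] at hci ⊢
    refine (hci.norm.const_mul B).mono' ?_ ?_
    · exact (isBoundedBilinearMap_apply (𝕜 := ℝ) (E := E)
        (F := E)).continuous.comp_aestronglyMeasurable
          ((hTc.aestronglyMeasurable measurableSet_Icc).prodMk hci.1)
    · rw [ae_restrict_iff' measurableSet_Icc]
      exact .of_forall fun τ hτ => (ContinuousLinearMap.le_opNorm _ _).trans
        (by gcongr; exact hB τ hτ)
  have hhi : IntervalIntegrable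
      (fun τ => ‖rho E G (y τ) (a τ) + v τ - lam E G (y τ) (b τ)‖) volume s t :=
    (((clm _ _ (fun x hx => (hball x hx).1.1.1.continuousAt) hai).add hvi).sub
      (clm _ _ (fun x hx => (hball x hx).1.1.2.continuousAt) hbi)).norm
  refine gdist_le fun k l => ?_
  have hw : IntervalIntegrable (fun τ => C * ‖a τ‖ + K * ‖v τ‖ + C * ‖b τ‖) volume s t :=
    ((hai.norm.const_mul C).add (hvi.norm.const_mul K)).add (hbi.norm.const_mul C)
  have main := sub_eq_integral_of_ae_hasDerivAt
    (Φ := fun t => ι (k * (S t * ex E G (y t) * (R t)⁻¹) * l))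
    (φ := fun τ => fderiv ℝ (fun z : E => ι (k * S τ * ex E G z * ((R τ)⁻¹ * l))) (y τ)
          (rho E G (y τ) (a τ) + v τ - lam E G (y τ) (b τ))) hst hw (hhi.const_mul K) ?_ ?_ ?_
  · rw [main.2]
    refine (intervalIntegral.norm_integral_le_of_norm_le hst (.of_forall fun τ hτ => ?_)
      (hhi.const_mul K)).trans (intervalIntegral.integral_const_mul _ _).le
    refine (ContinuousLinearMap.le_opNorm _ _).trans ?_
    gcongr
    have hyτ := (hball _ (hyr τ ⟨hτ.1.le, hτ.2⟩)).2
    refine norm_fderiv_le_of_lip' ℝ hK0 ?_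
    filter_upwards [Metric.isOpen_ball.mem_nhds hyτ] with z hz
    exact hK _ _ z hz _ hyτ
  · intro x hx x' hx' hxx'
    have hx01 : x ∈ Icc (0 : ℝ) 1 := ⟨hs.1.trans hx.1, hx.2.trans ht.2⟩
    have hx01' : x' ∈ Icc (0 : ℝ) 1 := ⟨hs.1.trans hx'.1, hx'.2.trans ht.2⟩
    have hsub : uIcc x x' ⊆ uIcc s t := uIcc_subset_uIcc (by rwa [uIcc_of_le hst])
      (by rwa [uIcc_of_le hst])
    refine (norm_sub_le_gdist hc.continuous _ _ _ _).trans ?_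
    refine (gdist_mul_le hc.continuous _ _ _ _).trans ?_
    rw [intervalIntegral.integral_add (((hai.norm.const_mul C).add
      (hvi.norm.const_mul K)).mono_set hsub) ((hbi.norm.const_mul C).mono_set hsub),
      intervalIntegral.integral_add ((hai.norm.const_mul C).mono_set hsub)
      ((hvi.norm.const_mul K).mono_set hsub), intervalIntegral.integral_const_mul,
      intervalIntegral.integral_const_mul, intervalIntegral.integral_const_mul]
    refine add_le_add ((gdist_mul_le hc.continuous _ _ _ _).trans (add_le_add ?_ ?_)) ?_
    · exact hC a S hS ha x hx01 x' hx01' hxx'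
    · refine gdist_le fun k l => (hK k l _ (hball _ (hyr x' hx')).2 _ (hball _ (hyr x hx)).2).trans
          ?_
      gcongr
      rw [← intervalIntegral.integral_eq_sub_of_hasDerivAt (f := y) (f' := v) (a := x) (b := x')]
      · exact intervalIntegral.norm_integral_le_integral_norm hxx'
      · intro τ hτ
        exact hy τ (by have := hsub hτ; rwa [uIcc_of_le hst] at this)
      · exact hvi.mono_set hsub
    · rw [gdist_inv hc.continuous]
      exact hC b R hR hb x hx01 x' hx01' hxx'
  · filter_upwards [hS.ae_hasLogDerivAt hι ha, hR.ae_hasLogDerivAt hι hb] with τ h1 h2 hτ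
    have h01 : τ ∈ Icc (0 : ℝ) 1 := ⟨hs.1.trans hτ.1, hτ.2.trans ht.2⟩
    exact (hball _ (hyr τ hτ)).1.2 S R y _ _ _ τ k l (h1 h01) (h2 h01) (hy τ hτ) rfl
  · refine .of_forall fun τ hτ => (ContinuousLinearMap.le_opNorm _ _).trans ?_
    gcongr
    have hyτ := (hball _ (hyr τ hτ)).2
    refine norm_fderiv_le_of_lip' ℝ hK0 ?_
    filter_upwards [Metric.isOpen_ball.mem_nhds hyτ] with z hz
    exact hK _ _ z hz _ hyτ

/-- Solutions depend in a Lipschitz way on the driving function: the comparison estimate with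
`y = 0`. -/
lemma exists_gdist_mul_inv_le (hι : Manifold.IsSmoothEmbedding 𝓘(ℝ, E) 𝓘(ℝ, V) ∞ ι) :
    ∃ K : ℝ, 0 ≤ K ∧ ∀ (a b : ℝ → E) (S R : ℝ → G) (s t : ℝ),
      IsSol ι a S → IsSol ι b R → IntervalIntegrable a volume 0 1 →
      IntervalIntegrable b volume 0 1 → s ∈ Icc (0 : ℝ) 1 → t ∈ Icc (0 : ℝ) 1 → s ≤ t →
      gdist ι (S t * (R t)⁻¹) (S s * (R s)⁻¹) ≤ K * ∫ τ in s..t, ‖a τ - b τ‖ := by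
  obtain ⟨K, hK0, r, hr, -, hK⟩ := exists_gdist_mul_ex_mul_inv_le hι
  refine ⟨K, hK0, fun a b S R s t hS hR ha hb hs ht hst => ?_⟩
  have := hK a b S R (fun _ => 0) (fun _ => 0) s t hS hR ha hb hs ht hst
    (fun τ _ => hasDerivAt_const _ _) continuousOn_const (fun τ _ => Metric.mem_ball_self hr)
  simpa [rho_zero, lam_zero] using this

end Compare

/-! ### Existence of solutions and transport -/

section Existence

variable {E : Type*} [NormedAddCommGroup E] [NormedSpace ℝ E] [FiniteDimensional ℝ E]
  {G : Type*} [TopologicalSpace G] [ChartedSpace E G] [Group G] [LieGroup 𝓘(ℝ, E) ∞ G]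
  [CompactSpace G] {V : Type*} [NormedAddCommGroup V] [NormedSpace ℝ V] [FiniteDimensional ℝ V]
  {ι : G → V}

/-- A path whose increments are dominated by an integral, and which has logarithmic derivative `a`
almost everywhere, is a solution. -/
lemma isSol_of_ae_hasLogDerivAt (hι : Manifold.IsSmoothEmbedding 𝓘(ℝ, E) 𝓘(ℝ, V) ∞ ι)
    {a : ℝ → E} {γ : ℝ → G} {w : ℝ → ℝ} (ha : IntervalIntegrable a volume 0 1)
    (hw : IntervalIntegrable w volume 0 1) (hγ : ContinuousOn γ (Icc 0 1))
    (hγw : ∀ s ∈ Icc (0 : ℝ) 1, ∀ t ∈ Icc (0 : ℝ) 1, s ≤ t → ‖ι (γ t) - ι (γ s)‖ ≤ ∫ τ in s..t, w τ)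
    (hd : ∀ᵐ τ, τ ∈ Icc (0 : ℝ) 1 → HasLogDerivAt γ (a τ) τ) : IsSol ι a γ := by
  refine ⟨hγ, fun t ht => ?_⟩
  obtain ⟨K, hK0, hK⟩ := exists_bound_leftDeriv hι.contMDiff
  have h0 : (0 : ℝ) ∈ Icc (0 : ℝ) 1 := by simp
  have hsub := uIcc_subset_uIcc_zero_one h0 ht
  have hle : ∀ x ∈ Icc 0 t, x ∈ Icc (0 : ℝ) 1 := fun x hx => ⟨hx.1, hx.2.trans ht.2⟩
  have := sub_eq_integral_of_ae_hasDerivAt (Φ := fun t => ι (γ t))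
    (φ := fun τ => leftDeriv (E := E) ι (γ τ) (a τ)) (h := fun τ => K * ‖a τ‖) ht.1 (hw.mono_set
        hsub)
    ((ha.norm.mono_set hsub).const_mul K)
    (fun x hx y hy hxy => hγw x (hle x hx) y (hle y hy) hxy)
    (by filter_upwards [hd] with τ hτ h using (hτ (hle τ h)).hasDerivAt hι.contMDiff)
    (.of_forall fun τ _ => (ContinuousLinearMap.le_opNorm _ _).trans (by gcongr; exact hK _))
  rw [← this.2]; simp

/-- Two solutions for the same driving function differ by a constant left translation. -/
lemma isSol_mul_inv_eq (hι : Manifold.IsSmoothEmbedding 𝓘(ℝ, E) 𝓘(ℝ, V) ∞ ι) {a : ℝ → E}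
    {S R : ℝ → G} (hS : IsSol ι a S) (hR : IsSol ι a R) (ha : IntervalIntegrable a volume 0 1)
    {s t : ℝ} (hs : s ∈ Icc (0 : ℝ) 1) (ht : t ∈ Icc (0 : ℝ) 1) :
    S t * (R t)⁻¹ = S s * (R s)⁻¹ := by
  wlog hst : s ≤ t generalizing s t
  · exact (this ht hs (le_of_not_ge hst)).symm
  obtain ⟨K, hK0, hK⟩ := exists_gdist_mul_inv_le hι
  refine eq_of_gdist_le_zero hι.contMDiff.continuous hι.isEmbedding.injective ?_
  refine (hK a a S R s t hS hR ha ha hs ht hst).trans ?_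
  simp

variable (E G) in
lemma eventually_ex_mu : ∀ᶠ y in 𝓝 (0 : E), ∀ᶠ z in 𝓝 (0 : E),
    ex E G (mu E G (y, z)) = ex E G y * ex E G z := by
  have h' : Tendsto (fun y : E => (y, (0 : E), (0 : E))) (𝓝 0) (𝓝 0) :=
    Continuous.tendsto' (by fun_prop) _ _ rfl
  filter_upwards [h'.eventually (eventually_ex_nu E G).eventually_nhds] with y hy
  have hc : Tendsto (fun w : E => (y, w, (0 : E))) (𝓝 0) (𝓝 (y, 0, 0)) :=
    Continuous.tendsto' (by fun_prop) _ _ rfl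
  filter_upwards [hc.eventually hy] with w hw
  simpa [nu_eq_mu E G (y, w)] using hw

/-- In the chart, the derivative of `ι` along left-invariant fields is expressed by `lam`. -/
lemma eventually_leftDeriv_ex (hι : ContMDiff 𝓘(ℝ, E) 𝓘(ℝ, V) ∞ ι) :
    ∀ᶠ y in 𝓝 (0 : E), leftDeriv (E := E) ι (ex E G y) =
      (fderiv ℝ (fun y => ι (ex E G y)) y).comp (lam E G y) := by
  filter_upwards [eventually_contDiffAt_comp_mul_ex_mul hι, eventually_ex_mu E G,
      eventually_mu_left E G,
    eventually_mu_zero_right E G] with y h1 h2 h3 h4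
  have e1 := (h1 1 1).differentiableAt (by simp)
  simp only [one_mul, mul_one] at e1
  have hm : HasFDerivAt (fun w => mu E G (y, w)) (lam E G y) 0 := by
    have := (HasFDerivAt.comp (0 : E) (h3.differentiableAt (by simp)).hasFDerivAt
      (hasFDerivAt_prodMk_right y (0 : E)))
    exact this.differentiableAt.hasFDerivAt
  have e2 : HasFDerivAt (fun y => ι (ex E G y)) (fderiv ℝ (fun y => ι (ex E G y)) y)
      (mu E G (y, 0)) := by rw [h4]; exact e1.hasFDerivAt
  have e3 := HasFDerivAt.comp (0 : E) e2 hm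
  refine (hasFDerivAt_leftDeriv hι (ex E G y)).unique (e3.congr_of_eventuallyEq ?_)
  filter_upwards [h2] with z hz
  simp [hz]

/-- Existence of solutions for driving functions with small integral, by the contraction principle
in the chart at `1`. -/
lemma exists_isSol_of_small (hι : Manifold.IsSmoothEmbedding 𝓘(ℝ, E) 𝓘(ℝ, V) ∞ ι) :
    ∃ δ > 0, ∀ a : ℝ → E, IntervalIntegrable a volume 0 1 → ∫ τ in (0 : ℝ)..1, ‖a τ‖ ≤ δ →
      ∃ γ : ℝ → G, IsSol ι a γ ∧ γ 0 = 1 := by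
  have : CompleteSpace E := FiniteDimensional.complete ℝ E
  have hc := hι.contMDiff
  obtain ⟨K, hK0, r₁, hr₁, hK⟩ := exists_lipschitz_comp_mul_ex_mul hc
  obtain ⟨L₀, s, hs, hL₀⟩ := ((contDiffAt_lam E G).of_le (m := 1) (by simp)).exists_lipschitzOnWith
  -- `lam` is Lipschitz only near `0`. The contraction uses a global Lipschitz extension `Y`; the
  -- fixed point stays in the ball where `Y` and `lam` agree.
  obtain ⟨Y, hY, hYs⟩ := hL₀.extend_finite_dimension
  set L := lipschitzExtensionConstant (E →L[ℝ] E) * L₀ with hL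
  obtain ⟨r, hr, hball⟩ := Metric.eventually_nhds_iff_ball.1
    (((eventually_leftDeriv_ex hc).and (eventually_contDiffAt_comp_mul_ex_mul hc)).and
      ((contMDiffAt_ex E G).and ((Metric.isOpen_ball.eventually_mem (Metric.mem_ball_self hr₁)).and
          hs)))
  have hY0 : Y 0 = ContinuousLinearMap.id ℝ E := by
    rw [← hYs (mem_of_mem_nhds hs), lam_zero]
  have hYn : ∀ x, ‖Y x‖ ≤ 1 + L * ‖x‖ := by
    intro x
    have h1 := hY.norm_sub_le x 0
    have h2 : ‖Y 0‖ ≤ 1 := by rw [hY0]; exact ContinuousLinearMap.norm_id_le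
    have h3 : ‖Y x‖ ≤ ‖Y x - Y 0‖ + ‖Y 0‖ := by simpa using norm_add_le (Y x - Y 0) (Y 0)
    rw [sub_zero] at h1
    linarith
  set δ : ℝ := min (1 / (2 * (L + 1))) (r / 4) with hδ
  have hL0 : (0 : ℝ) ≤ L := L.2
  have hδ0 : 0 < δ := by positivity
  have hδL : L * δ ≤ 1 / 2 := by
    have : δ ≤ 1 / (2 * (L + 1)) := min_le_left _ _
    calc L * δ ≤ (L + 1) * (1 / (2 * (L + 1))) := by gcongr; linarith
      _ = 1 / 2 := by field_simp
  have hδr : δ ≤ r / 4 := min_le_right _ _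
  refine ⟨δ, hδ0, fun a ha hδa => ?_⟩
  have hint : ∀ y : C(Icc (0 : ℝ) 1, E), IntervalIntegrable
      (fun τ => Y (y (projIcc 0 1 zero_le_one τ)) (a τ)) volume 0 1 := by
    intro y
    rw [intervalIntegrable_iff] at ha ⊢
    have hcont : Continuous fun τ => Y (y (projIcc 0 1 zero_le_one τ)) :=
      hY.continuous.comp (y.continuous.comp continuous_projIcc)
    refine (ha.norm.const_mul (1 + L * ‖y‖)).mono' ?_ (.of_forall fun τ => ?_)
    · exact (isBoundedBilinearMap_apply (𝕜 := ℝ) (E := E)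
        (F := E)).continuous.comp_aestronglyMeasurable (hcont.aestronglyMeasurable.prodMk ha.1)
    · refine (ContinuousLinearMap.le_opNorm _ _).trans ?_
      gcongr
      refine (hYn _).trans ?_
      gcongr
      exact y.norm_coe_le_norm _
  have hsub : ∀ t : Icc (0 : ℝ) 1, uIcc (0 : ℝ) t ⊆ uIcc (0 : ℝ) 1 := fun t =>
    uIcc_subset_uIcc_zero_one (by simp) t.2
  have hΓc : ∀ y : C(Icc (0 : ℝ) 1, E), Continuous fun t : Icc (0 : ℝ) 1 =>
      ∫ τ in (0 : ℝ)..t, Y (y (projIcc 0 1 zero_le_one τ)) (a τ) := by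
    intro y
    have := intervalIntegral.continuousOn_primitive_interval' (hint y) left_mem_uIcc
    rw [uIcc_of_le zero_le_one] at this
    exact this.comp_continuous continuous_subtype_val fun t => t.2
  -- The Picard operator.
  set Γ : C(Icc (0 : ℝ) 1, E) → C(Icc (0 : ℝ) 1, E) := fun y => ⟨_, hΓc y⟩
  have hΓ : ∀ y t, Γ y t = ∫ τ in (0 : ℝ)..t, Y (y (projIcc 0 1 zero_le_one τ)) (a τ) :=
    fun _ _ => rfl
  have hmono : ∀ t : Icc (0 : ℝ) 1, ∫ τ in (0 : ℝ)..t, ‖a τ‖ ≤ δ := fun t =>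
    (intervalIntegral.integral_mono_interval le_rfl t.2.1 t.2.2
      (.of_forall fun _ => norm_nonneg _) ha.norm).trans hδa
  have hbound : ∀ (f : ℝ → E) (M : ℝ), 0 ≤ M → (∀ τ, ‖f τ‖ ≤ M * ‖a τ‖) → ∀ t : Icc (0 : ℝ) 1,
      ‖∫ τ in (0 : ℝ)..t, f τ‖ ≤ M * δ := by
    intro f M hM hf t
    refine (intervalIntegral.norm_integral_le_of_norm_le t.2.1 (.of_forall fun τ _ => hf τ)
      ((ha.norm.mono_set (hsub t)).const_mul M)).trans ?_
    rw [intervalIntegral.integral_const_mul]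
    gcongr
    exact hmono t
  have hcontr : ContractingWith (1 / 2) Γ := by
    refine ⟨by rw [← NNReal.coe_lt_coe]; norm_num, LipschitzWith.of_dist_le_mul fun y y' => ?_⟩
    rw [ContinuousMap.dist_le (by positivity)]
    intro t
    rw [hΓ, hΓ, dist_eq_norm, ← intervalIntegral.integral_sub ((hint y).mono_set (hsub t))
      ((hint y').mono_set (hsub t))]
    refine (hbound _ (L * dist y y') (by positivity) (fun τ => ?_) t).trans ?_
    · rw [← _root_.sub_apply]
      refine (ContinuousLinearMap.le_opNorm _ _).trans ?_
      gcongr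
      refine (hY.norm_sub_le _ _).trans ?_
      gcongr
      rw [← dist_eq_norm]
      exact ContinuousMap.dist_apply_le_dist _
    · push_cast
      nlinarith [dist_nonneg (x := y) (y := y')]
  set y := hcontr.fixedPoint Γ
  have hfix : Γ y = y := hcontr.fixedPoint_isFixedPt
  have hyn : ‖y‖ ≤ (1 + L * ‖y‖) * δ := by
    rw [ContinuousMap.norm_le _ (by positivity)]
    intro t
    rw [← congrArg (fun f : C(Icc (0 : ℝ) 1, E) => f t) hfix]
    refine hbound _ _ (by positivity) (fun τ => ?_) t
    refine (ContinuousLinearMap.le_opNorm _ _).trans ?_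
    gcongr
    refine (hYn _).trans ?_
    gcongr
    exact y.norm_coe_le_norm _
  have hyr : ‖y‖ < r := by nlinarith [norm_nonneg y]
  set z : ℝ → E := fun t => y (projIcc 0 1 zero_le_one t) with hz
  have hzr : ∀ t, z t ∈ Metric.ball (0 : E) r := fun t => by
    rw [Metric.mem_ball, dist_zero_right]; exact (y.norm_coe_le_norm _).trans_lt hyr
  have hzc : Continuous z := y.continuous.comp continuous_projIcc
  have hzeq : ∀ t ∈ Icc (0 : ℝ) 1, z t = ∫ τ in (0 : ℝ)..t, lam E G (z τ) (a τ) := by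
    intro t ht
    have h1 : z t = (Γ y) ⟨t, ht⟩ := by rw [hfix]; simp only [hz, projIcc_of_mem _ ht]
    rw [h1, hΓ]
    refine intervalIntegral.integral_congr fun τ _ => ?_
    exact (congrArg (fun T : E →L[ℝ] E => T (a τ)) (hYs (hball _ (hzr τ)).2.2.2)).symm
  have hzi : IntervalIntegrable (fun τ => lam E G (z τ) (a τ)) volume 0 1 := by
    convert! hint y using 2 with τ
    rw [hYs (hball _ (hzr τ)).2.2.2]
  have hγc : Continuous (fun t => ex E G (z t)) := continuous_iff_continuousAt.2 fun t =>
    (hball _ (hzr t)).2.1.continuousAt.comp hzc.continuousAt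
  have h0 : (0 : ℝ) ∈ Icc (0 : ℝ) 1 := by simp
  have hzd : ∀ s ∈ Icc (0 : ℝ) 1, ∀ t ∈ Icc (0 : ℝ) 1, z t - z s =
      ∫ τ in s..t, lam E G (z τ) (a τ) := by
    intro s hs t ht
    rw [hzeq s hs, hzeq t ht]
    exact intervalIntegral.integral_interval_sub_left
      (hzi.mono_set (uIcc_subset_uIcc_zero_one h0 ht))
      (hzi.mono_set (uIcc_subset_uIcc_zero_one h0 hs))
  refine ⟨fun t => ex E G (z t), ?_, ?_⟩
  · refine isSol_of_ae_hasLogDerivAt hι ha (hzi.norm.const_mul K) hγc.continuousOn ?_ ?_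
    · intro s hs t ht hst
      rw [intervalIntegral.integral_const_mul]
      have := hK 1 1 (z t) (hball _ (hzr t)).2.2.1 (z s) (hball _ (hzr s)).2.2.1
      simp only [one_mul, mul_one] at this
      refine this.trans ?_
      gcongr
      rw [hzd s hs t ht]
      exact intervalIntegral.norm_integral_le_integral_norm hst
    · have n0 : ∀ᵐ x : ℝ, x ≠ 0 := by simp [ae_iff, measure_singleton]
      have n1 : ∀ᵐ x : ℝ, x ≠ 1 := by simp [ae_iff, measure_singleton]
      filter_upwards [hzi.ae_hasDerivAt_integral, n0, n1] with τ hτ n0 n1 hm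
      have hn : Icc (0 : ℝ) 1 ∈ 𝓝 τ := Icc_mem_nhds (lt_of_le_of_ne hm.1 n0.symm)
        (lt_of_le_of_ne hm.2 n1)
      have hzτ : HasDerivAt z (lam E G (z τ) (a τ)) τ := by
        refine (hτ (by rwa [uIcc_of_le zero_le_one]) 0 left_mem_uIcc).congr_of_eventuallyEq ?_
        filter_upwards [hn] with t ht
        exact hzeq t ht
      refine hasLogDerivAt_of_hasDerivAt hι hγc.continuousAt ?_
      obtain ⟨⟨b1, b2⟩, -⟩ := hball _ (hzr τ)
      have e1 := ((b2 1 1).differentiableAt (by simp)).hasFDerivAt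
      simp only [one_mul, mul_one] at e1
      have e2 := e1.comp_hasDerivAt τ hzτ
      rw [b1]
      exact e2
  · simp [hzeq 0 h0]

/-- Concatenation: a solution that is driven up to time `c` only is continued by a solution that is
driven after time `c` only. The product is a solution because at each time at most one of the
factors moves. -/
lemma IsSol.mul (hι : Manifold.IsSmoothEmbedding 𝓘(ℝ, E) 𝓘(ℝ, V) ∞ ι) {a b : ℝ → E}
    {S R : ℝ → G} {c : ℝ} (ha : IntervalIntegrable a volume 0 1)
    (hb : IntervalIntegrable b volume 0 1) (hS : IsSol ι a S) (hR : IsSol ι b R) (hR0 : R 0 = 1)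
    (hac : ∀ τ, c < τ → a τ = 0) (hbc : ∀ τ, τ ≤ c → b τ = 0) :
    IsSol ι (fun τ => a τ + b τ) (fun τ => S τ * R τ) := by
  have := topologicalGroup_of_lieGroup 𝓘(ℝ, E) ∞ (G := G)
  obtain ⟨C, hC0, hC⟩ := exists_gdist_isSol_le hι
  have hcont := hι.contMDiff.continuous
  have hinj := hι.isEmbedding.injective
  have h0 : (0 : ℝ) ∈ Icc (0 : ℝ) 1 := by simp
  have hRc : ∀ t ∈ Icc (0 : ℝ) 1, t ≤ c → R t = 1 := by
    intro t ht htc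
    rw [← hR0]
    refine eq_of_gdist_le_zero hcont hinj ((hC b R hR hb 0 h0 t ht ht.1).trans ?_)
    rw [intervalIntegral.integral_congr (g := fun _ => (0 : ℝ))]
    · simp
    · intro τ hτ
      rw [uIcc_of_le ht.1] at hτ
      simp [hbc τ (hτ.2.trans htc)]
  have hSc : ∀ s ∈ Icc (0 : ℝ) 1, ∀ t ∈ Icc (0 : ℝ) 1, c < s → s ≤ t → S t = S s := by
    intro s hs t ht hcs hst
    refine eq_of_gdist_le_zero hcont hinj ((hC a S hS ha s hs t ht hst).trans ?_)
    rw [intervalIntegral.integral_congr (g := fun _ => (0 : ℝ))]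
    · simp
    · intro τ hτ
      rw [uIcc_of_le hst] at hτ
      simp [hac τ (hcs.trans_le hτ.1)]
  refine isSol_of_ae_hasLogDerivAt hι (ha.add hb) ((ha.norm.const_mul C).add (hb.norm.const_mul C))
    (hS.cont.mul hR.cont) ?_ ?_
  · intro s hs t ht hst
    have hsub := uIcc_subset_uIcc_zero_one hs ht
    rw [intervalIntegral.integral_add ((ha.norm.const_mul C).mono_set hsub)
      ((hb.norm.const_mul C).mono_set hsub), intervalIntegral.integral_const_mul,
      intervalIntegral.integral_const_mul]
    exact (norm_sub_le_gdist' hcont _ _).trans ((gdist_mul_le hcont _ _ _ _).trans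
      (add_le_add (hC a S hS ha s hs t ht hst) (hC b R hR hb s hs t ht hst)))
  · have n0 : ∀ᵐ x : ℝ, x ≠ 0 := by simp [ae_iff, measure_singleton]
    have n1 : ∀ᵐ x : ℝ, x ≠ 1 := by simp [ae_iff, measure_singleton]
    have nc : ∀ᵐ x : ℝ, x ≠ c := by simp [ae_iff, measure_singleton]
    filter_upwards [hS.ae_hasLogDerivAt hι ha, hR.ae_hasLogDerivAt hι hb, n0, n1, nc]
      with τ h1 h2 n0 n1 nc hτ
    have hn : Icc (0 : ℝ) 1 ∈ 𝓝 τ := Icc_mem_nhds (lt_of_le_of_ne hτ.1 n0.symm)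
        (lt_of_le_of_ne hτ.2 n1)
    refine ⟨(h1 hτ).1.mul (h2 hτ).1, ?_⟩
    rcases lt_or_gt_of_ne nc with hlt | hgt
    · rw [hbc τ hlt.le, add_zero]
      refine (h1 hτ).2.congr_of_eventuallyEq ?_
      filter_upwards [hn, gt_mem_nhds hlt] with σ hσ hσc
      rw [hRc τ hτ hlt.le, hRc σ hσ (le_of_lt hσc)]
      simp
    · rw [hac τ hgt, zero_add]
      refine (h2 hτ).2.congr_of_eventuallyEq ?_
      filter_upwards [hn, lt_mem_nhds hgt] with σ hσ hσc
      have : S σ = S τ := by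
        rcases le_total τ σ with h | h
        · exact hSc τ hτ σ hσ hgt h
        · exact (hSc σ hσ τ hτ hσc h).symm
      rw [this]
      congr 1
      group

/-- Existence of solutions for integrable driving functions. -/
lemma exists_isSol (hι : Manifold.IsSmoothEmbedding 𝓘(ℝ, E) 𝓘(ℝ, V) ∞ ι) {a : ℝ → E}
    (ha : IntervalIntegrable a volume 0 1) : ∃ γ : ℝ → G, IsSol ι a γ ∧ γ 0 = 1 := by
  obtain ⟨δ, hδ, hsmall⟩ := exists_isSol_of_small (G := G) hι
  -- `P` increases to a finite value. Solutions are continued over intervals on which it grows by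
  -- at most `δ`, by induction on the number of these intervals.
  set P : ℝ → ℝ := fun t => ∫ τ in (0 : ℝ)..t, ‖a τ‖ with hP
  have hPc : ContinuousOn P (Icc 0 1) := by
    have := intervalIntegral.continuousOn_primitive_interval' ha.norm
      (left_mem_uIcc (a := (0 : ℝ)) (b := 1))
    rwa [uIcc_of_le zero_le_one] at this
  have hind : ∀ (s : Set ℝ), MeasurableSet s → IntervalIntegrable (s.indicator a) volume 0 1 := by
    intro s hs
    rw [intervalIntegrable_iff] at ha ⊢
    exact ha.indicator hs
  have key : ∀ n : ℕ, ∀ d ∈ Icc (0 : ℝ) 1, P d ≤ n * δ →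
      ∃ γ : ℝ → G, IsSol ι ((Iic d).indicator a) γ ∧ γ 0 = 1 := by
    -- The truncation of `a` to an interval on which `‖a‖` has integral at most `δ` is small.
    have hIoc : ∀ c ∈ Icc (0 : ℝ) 1, ∀ d ∈ Icc (0 : ℝ) 1, c ≤ d → P d - P c ≤ δ →
        ∃ γ : ℝ → G, IsSol ι ((Ioc c d).indicator a) γ ∧ γ 0 = 1 := by
      intro c hc d hd hcd hle
      refine hsmall _ (hind _ measurableSet_Ioc) (le_trans (le_of_eq ?_) hle)
      have h0 : (0 : ℝ) ∈ Icc (0 : ℝ) 1 := by simp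
      rw [hP, intervalIntegral.integral_interval_sub_left
        (ha.norm.mono_set (uIcc_subset_uIcc_zero_one h0 hd))
        (ha.norm.mono_set (uIcc_subset_uIcc_zero_one h0 hc)),
        intervalIntegral.integral_of_le hcd, intervalIntegral.integral_of_le zero_le_one]
      simp_rw [norm_indicator_eq_indicator_norm]
      rw [setIntegral_indicator measurableSet_Ioc,
        inter_eq_self_of_subset_right (Ioc_subset_Ioc hc.1 hd.2)]
    intro n
    induction n with
    | zero =>
      intro d hd hle
      have h0 : (0 : ℝ) ∈ Icc (0 : ℝ) 1 := by simp
      obtain ⟨γ, h1, h2⟩ := hIoc 0 h0 d hd hd.1 (by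
        simp only [hP, intervalIntegral.integral_same] at hle ⊢
        simp only [Nat.cast_zero, zero_mul] at hle
        linarith)
      refine ⟨γ, ⟨h1.cont, fun t ht => ?_⟩, h2⟩
      rw [h1.eq t ht]
      congr 1
      rw [intervalIntegral.integral_of_le ht.1, intervalIntegral.integral_of_le ht.1]
      refine setIntegral_congr_fun measurableSet_Ioc fun τ hτ => ?_
      by_cases h : τ ≤ d <;> simp [indicator, h, hτ.1]
    | succ n ih =>
      intro d hd hle
      by_cases hdn : P d ≤ n * δ
      · exact ih d hd hdn
      · have hmem : (n * δ : ℝ) ∈ Icc (P 0) (P d) := by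
          refine ⟨?_, le_of_not_ge hdn⟩
          simp only [hP, intervalIntegral.integral_same]; positivity
        obtain ⟨c, hc, hcP⟩ := intermediate_value_Icc hd.1
          (hPc.mono (Icc_subset_Icc_right hd.2)) hmem
        have hc1 : c ∈ Icc (0 : ℝ) 1 := ⟨hc.1, hc.2.trans hd.2⟩
        obtain ⟨S, hS, hS0⟩ := ih c hc1 hcP.le
        obtain ⟨R, hR, hR0⟩ := hIoc c hc1 d hd hc.2 (by
          rw [hcP]; push_cast at hle; linarith)
        refine ⟨fun τ => S τ * R τ, ?_, by simp [hS0, hR0]⟩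
        have := hS.mul hι (hind _ measurableSet_Iic) (hind _ measurableSet_Ioc) hR hR0 (c := c)
          (fun τ hτ => by simp [indicator, not_le.2 hτ]) (fun τ hτ => by simp [indicator, hτ])
        convert! this using 1
        ext τ
        by_cases h1 : τ ≤ c
        · simp [indicator, h1, not_lt.2 h1, h1.trans hc.2]
        · simp [indicator, h1, not_le.1 h1]
  obtain ⟨n, hn⟩ := exists_nat_ge (P 1 / δ)
  obtain ⟨γ, hγ, hγ0⟩ := key n 1 (by simp) (by rwa [div_le_iff₀ hδ] at hn)
  refine ⟨γ, ⟨hγ.cont, fun t ht => ?_⟩, hγ0⟩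
  rw [hγ.eq t ht]
  congr 1
  refine intervalIntegral.integral_congr fun τ hτ => ?_
  rw [uIcc_of_le ht.1] at hτ
  simp [indicator, hτ.2.trans ht.2]

open Classical in
/-- The solution of `γ' = γ · a` on `[0,1]` that starts at `1`. It is constant if there is no
solution; there is one if `a` is integrable. -/
noncomputable def trans (ι : G → V) (a : ℝ → E) : ℝ → G :=
  if h : ∃ γ : ℝ → G, IsSol ι a γ ∧ γ 0 = 1 then h.choose else fun _ => 1

lemma isSol_trans (hι : Manifold.IsSmoothEmbedding 𝓘(ℝ, E) 𝓘(ℝ, V) ∞ ι) {a : ℝ → E}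
    (ha : IntervalIntegrable a volume 0 1) : IsSol ι a (trans ι a) := by
  rw [trans, dif_pos (exists_isSol hι ha)]
  exact (exists_isSol hι ha).choose_spec.1

/-- Parallel transport from `s` to `t`, for the driving function `a`. -/
noncomputable def par (ι : G → V) (a : ℝ → E) (s t : ℝ) : G := (trans ι a s)⁻¹ * trans ι a t

lemma IsSol.eq_mul_par (hι : Manifold.IsSmoothEmbedding 𝓘(ℝ, E) 𝓘(ℝ, V) ∞ ι) {a : ℝ → E}
    {γ : ℝ → G} (h : IsSol ι a γ) (ha : IntervalIntegrable a volume 0 1) {s t : ℝ}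
    (hs : s ∈ Icc (0 : ℝ) 1) (ht : t ∈ Icc (0 : ℝ) 1) : γ t = γ s * par ι a s t := by
  have := isSol_mul_inv_eq hι h (isSol_trans hι ha) ha hs ht
  rw [par, ← mul_assoc, ← this]
  simp

end Existence

/-! ### Holonomy around rectangles -/

section Rectangle

variable {E : Type*} [NormedAddCommGroup E] [NormedSpace ℝ E] [FiniteDimensional ℝ E]
  {G : Type*} [TopologicalSpace G] [ChartedSpace E G] [Group G] [LieGroup 𝓘(ℝ, E) ∞ G]
  [CompactSpace G] {V : Type*} [NormedAddCommGroup V] [NormedSpace ℝ V] [FiniteDimensional ℝ V]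
  {ι : G → V}

lemma par_self (ι : G → V) (a : ℝ → E) (s : ℝ) : par ι a s s = 1 := by simp [par]

lemma par_inv (ι : G → V) (a : ℝ → E) (s t : ℝ) : (par ι a s t)⁻¹ = par ι a t s := by simp [par]

lemma par_mul_par (ι : G → V) (a : ℝ → E) (s t r : ℝ) : par ι a s t * par ι a t r = par ι a s r :=
    by
  simp [par, mul_assoc]

lemma continuous_gdist (hι : Manifold.IsSmoothEmbedding 𝓘(ℝ, E) 𝓘(ℝ, V) ∞ ι) :
    Continuous (fun p : G × G => gdist ι p.1 p.2) := by
  have hc := hι.contMDiff.continuous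
  obtain ⟨C, hC0, hC⟩ := exists_gdist_le hι
  rw [continuous_iff_continuousAt]
  intro p
  rw [ContinuousAt, tendsto_iff_dist_tendsto_zero]
  have h : Tendsto (fun q : G × G => C * ‖ι q.1 - ι p.1‖ + C * ‖ι q.2 - ι p.2‖) (𝓝 p) (𝓝 0) :=
    Continuous.tendsto' (by fun_prop) _ _ (by simp)
  refine squeeze_zero (fun _ => dist_nonneg) (fun q => ?_) h
  refine le_trans ?_ (add_le_add (hC _ _) (hC _ _))
  rw [Real.dist_eq, abs_le]
  have t1 := gdist_triangle hc q.1 p.1 q.2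
  have t2 := gdist_triangle hc p.1 p.2 q.2
  have t3 := gdist_triangle hc p.1 q.1 p.2
  have t4 := gdist_triangle hc q.1 q.2 p.2
  rw [gdist_comm p.1 q.1] at t3
  rw [gdist_comm p.2 q.2] at t2
  constructor <;> linarith

/-- Parallel transport depends in a Lipschitz way on the driving function. -/
lemma exists_gdist_par_le (hι : Manifold.IsSmoothEmbedding 𝓘(ℝ, E) 𝓘(ℝ, V) ∞ ι) :
    ∃ K : ℝ, 0 ≤ K ∧ ∀ (a b : ℝ → E) (s t : ℝ), IntervalIntegrable a volume 0 1 →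
      IntervalIntegrable b volume 0 1 → s ∈ Icc (0 : ℝ) 1 → t ∈ Icc (0 : ℝ) 1 →
      gdist ι (par ι a s t) (par ι b s t) ≤ K * ∫ τ in (0 : ℝ)..1, ‖a τ - b τ‖ := by
  have hc := hι.contMDiff.continuous
  obtain ⟨K, hK0, hK⟩ := exists_gdist_mul_inv_le hι
  refine ⟨K, hK0, fun a b s t ha hb hs ht => ?_⟩
  wlog hst : s ≤ t generalizing s t
  · rw [← par_inv ι a, ← par_inv ι b, gdist_inv hc]
    exact this t s ht hs (le_of_not_ge hst)
  have h := hK a b _ _ s t (isSol_trans hι ha) (isSol_trans hι hb) ha hb hs ht hst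
  rw [← gdist_mul_left hc (trans ι a s)⁻¹, ← gdist_mul_right hc _ _ (trans ι b t)] at h
  simp only [mul_assoc, inv_mul_cancel, mul_one, inv_mul_cancel_left] at h
  refine h.trans ?_
  gcongr
  exact intervalIntegral.integral_mono_interval hs.1 hst ht.2
    (.of_forall fun _ => norm_nonneg _) (ha.sub hb).norm

lemma continuousOn_par (hι : Manifold.IsSmoothEmbedding 𝓘(ℝ, E) 𝓘(ℝ, V) ∞ ι) {a : ℝ → E}
    (ha : IntervalIntegrable a volume 0 1) (c : ℝ) : ContinuousOn (par ι a c) (Icc 0 1) := by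
  have := topologicalGroup_of_lieGroup 𝓘(ℝ, E) ∞ (G := G)
  exact continuousOn_const.mul (isSol_trans hι ha).cont

/-- Parallel transport along a short interval agrees to first order with the chart at `1`: the
comparison estimate for the constant solution and the transport, with `y τ = (τ - x) • a x`. -/
lemma eventually_gdist_par_ex_le (hι : Manifold.IsSmoothEmbedding 𝓘(ℝ, E) 𝓘(ℝ, V) ∞ ι) {a : ℝ → E}
    (ha : Continuous a) {x : ℝ} (hx : x ∈ Ico (0 : ℝ) 1) {ε : ℝ} (hε : 0 < ε) :
    ∀ᶠ h in 𝓝[>] (0 : ℝ), gdist ι (par ι a x (x + h)) (ex E G (h • a x)) ≤ ε * h := by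
  have hc := hι.contMDiff.continuous
  obtain ⟨K, hK0, r, hr, hd, hK⟩ := exists_gdist_mul_ex_mul_inv_le hι
  set g : ℝ × ℝ → E := fun p => a x - lam E G ((p.2 - x) • a x) (a p.2)
  have hsm : Tendsto (fun τ : ℝ => (τ - x) • a x) (𝓝 x) (𝓝 0) :=
    Continuous.tendsto' (by fun_prop) _ _ (by simp)
  have hl : Tendsto (fun τ => ‖a x - lam E G ((τ - x) • a x) (a τ)‖) (𝓝 x) (𝓝 0) := by
    have h1 : Tendsto (fun τ => lam E G ((τ - x) • a x)) (𝓝 x) (𝓝 (lam E G 0)) :=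
      (contDiffAt_lam E G).continuousAt.tendsto.comp hsm
    have h2 := (isBoundedBilinearMap_apply (𝕜 := ℝ) (E := E) (F :=
        E)).continuous.continuousAt.tendsto.comp
      (h1.prodMk_nhds (ha.tendsto x))
    have := (tendsto_const_nhds (x := a x)).sub h2
    simpa [lam_zero] using this.norm
  obtain ⟨δ, hδ, hball⟩ := Metric.eventually_nhds_iff_ball.1
    ((hl.eventually_le_const (show 0 < ε / (K + 1) by positivity)).and
      (hsm.eventually (Metric.ball_mem_nhds (0 : E) hr)))
  have hδ' : 0 < min δ (1 - x) := lt_min hδ (by linarith [hx.2])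
  filter_upwards [Ioo_mem_nhdsGT hδ'] with h hh
  have hh1 : h < δ := hh.2.trans_le (min_le_left _ _)
  have hh2 : h < 1 - x := hh.2.trans_le (min_le_right _ _)
  have hh0 := hh.1
  have hmem : ∀ τ ∈ Icc x (x + h), τ ∈ Metric.ball x δ := by
    intro τ hτ
    rw [Metric.mem_ball, Real.dist_eq, abs_of_nonneg (by linarith [hτ.1])]
    linarith [hτ.2]
  have hai := ha.intervalIntegrable (μ := volume) 0 1
  have h1 : IsSol ι (fun _ => (0 : E)) (fun _ => (1 : G)) :=
    ⟨continuousOn_const, fun t _ => by simp⟩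
  have key := hK (fun _ => 0) a (fun _ => 1) (trans ι a) (fun τ => (τ - x) • a x) (fun _ => a x)
    x (x + h) h1 (isSol_trans hι hai) (by simp) hai ⟨hx.1, hx.2.le⟩
    ⟨by linarith [hx.1], by linarith⟩ (by linarith)
    (fun τ _ => by simpa using ((hasDerivAt_id τ).sub_const x).smul_const (a x))
    continuousOn_const (fun τ hτ => (hball τ (hmem τ hτ)).2)
  rw [← gdist_mul_right hc _ _ (trans ι a (x + h))] at key
  simp only [one_mul, add_sub_cancel_left, inv_mul_cancel_right, sub_self, zero_smul, ex_zero,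
    map_zero, zero_add] at key
  rw [gdist_comm]
  refine key.trans ?_
  have : ∫ τ in x..x + h, ‖a x - lam E G ((τ - x) • a x) (a τ)‖ ≤ ε / (K + 1) * h := by
    refine (le_abs_self _).trans ?_
    have := intervalIntegral.norm_integral_le_of_norm_le_const (a := x) (b := x + h)
      (f := fun τ => ‖a x - lam E G ((τ - x) • a x) (a τ)‖) (C := ε / (K + 1)) (fun τ hτ => by
        rw [uIoc_of_le (by linarith)] at hτ
        rw [norm_norm]
        exact (hball τ (hmem τ ⟨hτ.1.le, hτ.2⟩)).1)
    simpa [abs_of_pos hh0] using this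
  calc _ ≤ K * (ε / (K + 1) * h) := by gcongr
    _ = (K / (K + 1)) * (ε * h) := by ring
    _ ≤ 1 * (ε * h) := by
      gcongr
      rw [div_le_one (by positivity)]; linarith
    _ = ε * h := one_mul _

lemma hasDerivAt_apply_smul {T : E → E →L[ℝ] E} (hT : DifferentiableAt ℝ T 0) (a : E)
    {f : ℝ → E} {f' : E} (hf : HasDerivAt f f' 0) :
    HasDerivAt (fun h : ℝ => T (h • a) (f h)) (fderiv ℝ T 0 a (f 0) + T 0 f') 0 := by
  have hyd : HasDerivAt (fun h : ℝ => h • a) a 0 := by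
    simpa using (hasDerivAt_id (0 : ℝ)).smul_const a
  have hTd : HasFDerivAt T (fderiv ℝ T 0) ((0 : ℝ) • a) := by
    rw [zero_smul]; exact hT.hasFDerivAt
  have h1 : HasDerivAt (fun h : ℝ => T (h • a)) (fderiv ℝ T 0 a) 0 :=
    hTd.comp_hasDerivAt (0 : ℝ) hyd
  have h2 := h1.clm_apply hf
  rw [zero_smul] at h2
  exact h2

/-- The mismatch in the comparison estimate with `y = h • a₁`, to first order in `h`. With `a₁`,
`a₂` the components of a form, `d₁ = ∂₂ a₁` and `d₂ = ∂₁ a₂`, this is minus its curvature. -/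
lemma hasDerivAt_mismatch {f : ℝ → E} (a₁ d₁ : E) {a₂ d₂ : E} (hf : HasDerivAt f d₂ 0)
    (hf0 : f 0 = a₂) :
    HasDerivAt (fun h : ℝ => rho E G (h • a₁) a₂ + h • d₁ - lam E G (h • a₁) (f h))
      (-(d₂ - d₁ + br E G a₁ a₂)) 0 := by
  have h1 := hasDerivAt_apply_smul ((contDiffAt_rho E G).differentiableAt (by simp)) a₁
    (hasDerivAt_const (0 : ℝ) a₂)
  have h2 := hasDerivAt_apply_smul ((contDiffAt_lam E G).differentiableAt (by simp)) a₁ hf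
  have h3 : HasDerivAt (fun h : ℝ => h • d₁) d₁ 0 := by
    simpa using (hasDerivAt_id (0 : ℝ)).smul_const d₁
  refine (HasDerivAt.fun_sub (HasDerivAt.fun_add h1 h3) h2).congr_deriv ?_
  rw [fderiv_rho_apply, br, map_zero, lam_zero, hf0, ContinuousLinearMap.id_apply]
  abel

lemma gdist_inv_mul (hι : Continuous ι) (a b c d : G) :
    gdist ι (a⁻¹ * b) (c * d⁻¹) = gdist ι (b * d) (a * c) := by
  rw [← gdist_mul_left hι a, ← gdist_mul_right hι _ _ d]
  congr 1 <;> group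

set_option maxHeartbeats 1000000 in
/-- Holonomy around a thin strip `[x, x + h] × [d, t]`, to first order in `h`. The short sides are
replaced by `ex (h • A₁)`. Here `D₁` stands for `∂₂ A₁` and `D₂` for `∂₁ A₂`. -/
lemma exists_gdist_strip_le (hι : Manifold.IsSmoothEmbedding 𝓘(ℝ, E) 𝓘(ℝ, V) ∞ ι) :
    ∃ K : ℝ, 0 ≤ K ∧ ∀ (A₁ A₂ D₁ D₂ : ℝ → ℝ → E), Continuous (fun p : ℝ × ℝ => A₁ p.1 p.2) →
      Continuous (fun p : ℝ × ℝ => A₂ p.1 p.2) → Continuous (fun p : ℝ × ℝ => D₁ p.1 p.2) →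
      Continuous (fun p : ℝ × ℝ => D₂ p.1 p.2) →
      (∀ x τ, HasDerivAt (fun τ => A₁ x τ) (D₁ x τ) τ) →
      (∀ x τ, HasDerivAt (fun x => A₂ x τ) (D₂ x τ) x) →
      ∀ x ∈ Ico (0 : ℝ) 1, ∀ d ∈ Icc (0 : ℝ) 1, ∀ t ∈ Icc (0 : ℝ) 1, d ≤ t →
      ∀ r, K * ∫ τ in d..t, ‖D₂ x τ - D₁ x τ + br E G (A₁ x τ) (A₂ x τ)‖ < r →
      ∀ᶠ h in 𝓝[>] (0 : ℝ), gdist ι (ex E G (h • A₁ x d) * par ι (A₂ (x + h)) d t)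
        (par ι (A₂ x) d t * ex E G (h • A₁ x t)) ≤ r * h := by
  have hc := hι.contMDiff.continuous
  obtain ⟨K, hK0, r₀, hr₀, hd₀, hK⟩ := exists_gdist_mul_ex_mul_inv_le hι
  refine ⟨K, hK0, ?_⟩
  intro A₁ A₂ D₁ D₂ c1 c2 c1' c2' hA1 hA2 x hx d hd t ht hdt r hr
  -- The mismatch in the comparison of the two long sides of the strip.
  set H : ℝ → ℝ → E := fun h τ => rho E G (h • A₁ x τ) (A₂ x τ) + h • D₁ x τ -
    lam E G (h • A₁ x τ) (A₂ (x + h) τ) with hH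
  have cont2 : ∀ x, Continuous (A₂ x) := fun x => c2.comp (Continuous.prodMk_right x)
  have cont1 : ∀ x, Continuous (A₁ x) := fun x => c1.comp (Continuous.prodMk_right x)
  have cont1' : ∀ x, Continuous (D₁ x) := fun x => c1'.comp (Continuous.prodMk_right x)
  obtain ⟨B, hB⟩ : ∃ B : ℝ, ∀ x ∈ Icc (0 : ℝ) 1, ∀ τ ∈ Icc (0 : ℝ) 1, ‖A₁ x τ‖ ≤ B ∧ ‖A₂ x τ‖ ≤ B ∧
      ‖D₁ x τ‖ ≤ B ∧ ‖D₂ x τ‖ ≤ B := by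
    have hcomp : IsCompact (Icc (0 : ℝ) 1 ×ˢ Icc (0 : ℝ) 1) := isCompact_Icc.prod isCompact_Icc
    obtain ⟨B1, h1⟩ := hcomp.exists_bound_of_continuousOn c1.continuousOn
    obtain ⟨B2, h2⟩ := hcomp.exists_bound_of_continuousOn c2.continuousOn
    obtain ⟨B3, h3⟩ := hcomp.exists_bound_of_continuousOn c1'.continuousOn
    obtain ⟨B4, h4⟩ := hcomp.exists_bound_of_continuousOn c2'.continuousOn
    refine ⟨max (max B1 B2) (max B3 B4), fun x hx τ hτ => ⟨?_, ?_, ?_, ?_⟩⟩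
    · exact (h1 (x, τ) ⟨hx, hτ⟩).trans ((le_max_left _ _).trans (le_max_left _ _))
    · exact (h2 (x, τ) ⟨hx, hτ⟩).trans ((le_max_right _ _).trans (le_max_left _ _))
    · exact (h3 (x, τ) ⟨hx, hτ⟩).trans ((le_max_left _ _).trans (le_max_right _ _))
    · exact (h4 (x, τ) ⟨hx, hτ⟩).trans ((le_max_right _ _).trans (le_max_right _ _))
  have hB0 : 0 ≤ B := (norm_nonneg _).trans (hB x ⟨hx.1, hx.2.le⟩ d hd).1
  obtain ⟨L, hL0, δ, hδ, hL⟩ : ∃ L : ℝ, 0 ≤ L ∧ ∃ δ > 0, ∀ y ∈ Metric.ball (0 : E) δ,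
      ‖rho E G y - rho E G 0‖ ≤ L * ‖y‖ ∧ ‖lam E G y - lam E G 0‖ ≤ L * ‖y‖ := by
    obtain ⟨L1, s1, hs1, h1⟩ := ((contDiffAt_rho E G).of_le (m := 1) (by
        simp)).exists_lipschitzOnWith
    obtain ⟨L2, s2, hs2, h2⟩ := ((contDiffAt_lam E G).of_le (m := 1) (by
        simp)).exists_lipschitzOnWith
    obtain ⟨δ, hδ, hb⟩ := Metric.mem_nhds_iff.1 (inter_mem hs1 hs2)
    refine ⟨max L1 L2, by positivity, δ, hδ, fun y hy => ⟨?_, ?_⟩⟩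
    · have := h1.norm_sub_le (hb hy).1 (mem_of_mem_nhds hs1)
      rw [sub_zero] at this
      exact this.trans (by gcongr; exact le_max_left _ _)
    · have := h2.norm_sub_le (hb hy).2 (mem_of_mem_nhds hs2)
      rw [sub_zero] at this
      exact this.trans (by gcongr; exact le_max_right _ _)
  have hsmall : ∀ᶠ h in 𝓝[>] (0 : ℝ), 0 < h ∧ x + h ≤ 1 ∧ h * B < min δ r₀ := by
    have e1 : ∀ᶠ h in 𝓝[>] (0 : ℝ), 0 < h := eventually_mem_nhdsWithin
    have e2 : ∀ᶠ h in 𝓝[>] (0 : ℝ), h < 1 - x :=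
      eventually_nhdsWithin_of_eventually_nhds (gt_mem_nhds (by linarith [hx.2]))
    have e3 : Tendsto (fun h : ℝ => h * B) (𝓝[>] 0) (𝓝 0) :=
      (Continuous.tendsto' (by fun_prop) _ _ (by simp)).mono_left nhdsWithin_le_nhds
    filter_upwards [e1, e2, e3.eventually_lt_const (lt_min hδ hr₀)] with h a1 a2 a3
    exact ⟨a1, by linarith, a3⟩
  have hx1 : x ∈ Icc (0 : ℝ) 1 := ⟨hx.1, hx.2.le⟩
  have hsub : ∀ τ ∈ Icc d t, τ ∈ Icc (0 : ℝ) 1 := fun τ hτ => ⟨hd.1.trans hτ.1, hτ.2.trans ht.2⟩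
  have hyb : ∀ h, 0 < h → h * B < min δ r₀ → ∀ τ ∈ Icc d t, ‖h • A₁ x τ‖ < min δ r₀ := by
    intro h h0 hlt τ hτ
    rw [norm_smul, Real.norm_of_nonneg h0.le]
    exact lt_of_le_of_lt (by gcongr; exact (hB x hx1 τ (hsub τ hτ)).1) hlt
  -- The mismatch is `h` times the curvature, up to a lower order term.
  have hlim : Tendsto (fun h => ∫ τ in d..t, h⁻¹ * ‖H h τ‖) (𝓝[>] 0)
      (𝓝 (∫ τ in d..t, ‖D₂ x τ - D₁ x τ + br E G (A₁ x τ) (A₂ x τ)‖)) := by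
    refine intervalIntegral.tendsto_integral_filter_of_dominated_convergence
      (fun _ => L * B * B + L * B * B + B + B) ?_ ?_ (by simp) ?_
    · filter_upwards [hsmall] with h ⟨h0, hx', hlt⟩
      rw [uIoc_of_le hdt]
      refine ContinuousOn.aestronglyMeasurable ?_ measurableSet_Ioc
      have hT : ∀ T : E → E →L[ℝ] E, (∀ y ∈ Metric.ball (0 : E) r₀, ContinuousAt T y) →
          ContinuousOn (fun τ => T (h • A₁ x τ)) (Ioc d t) := fun T hT τ hτ =>
        ((hT _ (by
          rw [Metric.mem_ball, dist_zero_right]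
          exact (hyb h h0 hlt τ ⟨hτ.1.le, hτ.2⟩).trans_le (min_le_right _ _))).comp
          (f := fun τ => h • A₁ x τ)
          ((cont1 x).const_smul h).continuousAt).continuousWithinAt
      have hr := hT _ fun y hy => (hd₀ y hy).1.continuousAt
      have hl := hT _ fun y hy => (hd₀ y hy).2.continuousAt
      exact continuousOn_const.mul (((hr.clm_apply (cont2 x).continuousOn).add
        ((cont1' x).const_smul h).continuousOn).sub (hl.clm_apply (cont2 (x +
            h)).continuousOn)).norm
    · filter_upwards [hsmall] with h ⟨h0, hx', hlt⟩
      refine .of_forall fun τ hτ => ?_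
      rw [uIoc_of_le hdt] at hτ
      have hτ' : τ ∈ Icc d t := ⟨hτ.1.le, hτ.2⟩
      have hy := hyb h h0 hlt τ hτ'
      obtain ⟨l1, l2⟩ := hL (h • A₁ x τ) (by
        rw [Metric.mem_ball, dist_zero_right]; exact hy.trans_le (min_le_left _ _))
      obtain ⟨b1, b2, b3, b4⟩ := hB x hx1 τ (hsub τ hτ')
      obtain ⟨-, b2', -, -⟩ := hB (x + h) ⟨by linarith [hx.1], hx'⟩ τ (hsub τ hτ')
      have hn : ‖h • A₁ x τ‖ ≤ h * B := by
        rw [norm_smul, Real.norm_of_nonneg h0.le]; gcongr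
      have hlipA : ‖A₂ (x + h) τ - A₂ x τ‖ ≤ B * h := by
        have := (convex_Icc (0 : ℝ) 1).norm_image_sub_le_of_norm_hasDerivWithin_le
          (f := fun x => A₂ x τ) (f' := fun x => D₂ x τ) (C := B)
          (fun z _ => (hA2 z τ).hasDerivWithinAt) (fun z hz => (hB z hz τ (hsub τ hτ')).2.2.2)
          hx1 (show x + h ∈ Icc (0 : ℝ) 1 from ⟨by linarith [hx.1], hx'⟩)
        simpa [abs_of_pos h0] using this
      have eH : H h τ = (rho E G (h • A₁ x τ) - rho E G 0) (A₂ x τ) -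
          (lam E G (h • A₁ x τ) - lam E G 0) (A₂ (x + h) τ) + h • D₁ x τ -
          (A₂ (x + h) τ - A₂ x τ) := by
        simp only [hH, _root_.sub_apply, rho_zero, lam_zero, ContinuousLinearMap.coe_id', id_eq]
        abel
      have n1 : ‖(rho E G (h • A₁ x τ) - rho E G 0) (A₂ x τ)‖ ≤ L * (h * B) * B :=
        (ContinuousLinearMap.le_opNorm _ _).trans
          (mul_le_mul (l1.trans (by gcongr)) b2 (norm_nonneg _) (by positivity))
      have n2 : ‖(lam E G (h • A₁ x τ) - lam E G 0) (A₂ (x + h) τ)‖ ≤ L * (h * B) * B :=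
        (ContinuousLinearMap.le_opNorm _ _).trans
          (mul_le_mul (l2.trans (by gcongr)) b2' (norm_nonneg _) (by positivity))
      have n3 : ‖h • D₁ x τ‖ ≤ h * B := by
        rw [norm_smul, Real.norm_of_nonneg h0.le]; gcongr
      have nH : ‖H h τ‖ ≤ h * (L * B * B + L * B * B + B + B) := by
        rw [eH]
        refine (norm_sub_le _ _).trans ?_
        refine (add_le_add ((norm_add_le _ _).trans (add_le_add ((norm_sub_le _ _).trans
          (add_le_add n1 n2)) n3)) hlipA).trans (le_of_eq (by ring))
      rw [norm_mul, norm_norm, norm_inv, Real.norm_of_nonneg h0.le, inv_mul_le_iff₀ h0]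
      exact nH
    · refine .of_forall fun τ _ => ?_
      have hA2' : HasDerivAt (fun h : ℝ => A₂ (x + h) τ) (D₂ x τ) 0 :=
        HasDerivAt.comp_const_add x (0 : ℝ) (f := fun x => A₂ x τ) (f' := D₂ x τ)
          (by simpa using hA2 x τ)
      have hsl := (hasDerivAt_mismatch (G := G) (a₂ := A₂ x τ) (A₁ x τ) (D₁ x τ) hA2' (by
          simp)).hasDerivWithinAt
        (s := Ioi 0)
      rw [hasDerivWithinAt_iff_tendsto_slope' (by simp)] at hsl
      have hsl' := hsl.norm
      rw [norm_neg] at hsl'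
      refine hsl'.congr' ?_
      filter_upwards [eventually_mem_nhdsWithin] with h (h0 : 0 < h)
      rw [slope_def_module, norm_smul]
      simp [hH, rho_zero, lam_zero, abs_of_pos h0]
  have hlim' := (hlim.const_mul K).eventually_lt_const hr
  filter_upwards [hsmall, hlim'] with h ⟨h0, hx', hlt⟩ hle
  have ai := (cont2 x).intervalIntegrable (μ := volume) 0 1
  have bi := (cont2 (x + h)).intervalIntegrable (μ := volume) 0 1
  have key := hK (A₂ x) (A₂ (x + h)) _ _ (fun τ => h • A₁ x τ) (fun τ => h • D₁ x τ) d t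
    (isSol_trans hι ai) (isSol_trans hι bi) ai bi hd ht hdt
    (fun τ _ => (hA1 x τ).const_smul h) ((cont1' x).const_smul h).continuousOn
    (fun τ hτ => by
      rw [Metric.mem_ball, dist_zero_right]
      exact (hyb h h0 hlt τ hτ).trans_le (min_le_right _ _))
  rw [← gdist_mul_left hc (trans ι (A₂ x) d)⁻¹, ← gdist_mul_right hc _ _ (trans ι (A₂ (x + h)) t),
    gdist_comm] at key
  simp only [mul_assoc, inv_mul_cancel, mul_one, inv_mul_cancel_left] at key
  rw [par, par, mul_assoc]
  refine key.trans ?_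
  rw [intervalIntegral.integral_const_mul] at hle
  have : K * ∫ τ in d..t, ‖H h τ‖ = (K * (h⁻¹ * ∫ τ in d..t, ‖H h τ‖)) * h := by
    field_simp
  change K * ∫ τ in d..t, ‖H h τ‖ ≤ _
  rw [this]
  gcongr

set_option maxHeartbeats 1000000 in
/-- The nonabelian Stokes inequality: the holonomy around an axis-parallel rectangle is controlled
by the integral of the curvature `∂₁ A₂ - ∂₂ A₁ + [A₁, A₂]`. -/
lemma exists_holonomy_le (hι : Manifold.IsSmoothEmbedding 𝓘(ℝ, E) 𝓘(ℝ, V) ∞ ι) :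
    ∃ K : ℝ, 0 ≤ K ∧ ∀ (A₁ A₂ D₁ D₂ : ℝ → ℝ → E), Continuous (fun p : ℝ × ℝ => A₁ p.1 p.2) →
      Continuous (fun p : ℝ × ℝ => A₂ p.1 p.2) → Continuous (fun p : ℝ × ℝ => D₁ p.1 p.2) →
      Continuous (fun p : ℝ × ℝ => D₂ p.1 p.2) →
      (∀ x τ, HasDerivAt (fun τ => A₁ x τ) (D₁ x τ) τ) →
      (∀ x τ, HasDerivAt (fun x => A₂ x τ) (D₂ x τ) x) →
      ∀ α ∈ Icc (0 : ℝ) 1, ∀ β ∈ Icc (0 : ℝ) 1, ∀ c ∈ Icc α β, ∀ x ∈ Icc α β, ∀ d ∈ Icc α β,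
      ∀ t ∈ Icc α β, gdist ι (par ι (fun x => A₁ x d) c x * par ι (A₂ x) d t)
        (par ι (A₂ c) d t * par ι (fun x => A₁ x t) c x) ≤
        K * ∫ x in α..β, ∫ τ in α..β, ‖D₂ x τ - D₁ x τ + br E G (A₁ x τ) (A₂ x τ)‖ := by
  have := topologicalGroup_of_lieGroup 𝓘(ℝ, E) ∞ (G := G)
  have hc := hι.contMDiff.continuous
  obtain ⟨K, hK0, hK⟩ := exists_gdist_strip_le (G := G) hι
  obtain ⟨K', hK'0, hK'⟩ := exists_gdist_par_le (G := G) hι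
  refine ⟨K, hK0, ?_⟩
  intro A₁ A₂ D₁ D₂ c1 c2 c1' c2' hA1 hA2 α hα β hβ c hcm x hxm d hd t ht
  have sub01 : ∀ z ∈ Icc α β, z ∈ Icc (0 : ℝ) 1 := fun z hz => ⟨hα.1.trans hz.1, hz.2.trans hβ.2⟩
  -- Exchanging `c` and `x`, or `d` and `t`, replaces transports by their inverses.
  wlog hcx : c ≤ x generalizing c x
  · have := this x hxm c hcm (le_of_not_ge hcx)
    rw [← par_inv ι _ c, ← par_inv ι _ c, gdist_inv_mul hc, gdist_comm] at this
    exact this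
  wlog hdt : d ≤ t generalizing d t
  · have := this t ht d hd (le_of_not_ge hdt)
    rw [gdist_comm, ← par_inv ι _ d, ← par_inv ι _ d, gdist_inv_mul hc] at this
    exact this
  set F : ℝ → ℝ → ℝ := fun x τ => ‖D₂ x τ - D₁ x τ + br E G (A₁ x τ) (A₂ x τ)‖ with hF
  have hFc : Continuous (fun p : ℝ × ℝ => F p.1 p.2) := by
    have hb : Continuous (fun p : ℝ × ℝ => br E G (A₁ p.1 p.2) (A₂ p.1 p.2)) := by
      have e1 := (fderiv ℝ (lam E G) 0).isBoundedBilinearMap.continuous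
      exact (e1.comp (c1.prodMk c2)).sub (e1.comp (c2.prodMk c1))
    exact ((c2'.sub c1').add hb).norm
  have hF0 : ∀ x τ, 0 ≤ F x τ := fun _ _ => norm_nonneg _
  have cont2 : ∀ x, Continuous (A₂ x) := fun x => c2.comp (Continuous.prodMk_right x)
  have cont1 : ∀ τ, Continuous (fun x => A₁ x τ) := fun x => c1.comp (Continuous.prodMk_left x)
  have ii2 : ∀ x, IntervalIntegrable (A₂ x) volume 0 1 := fun x => (cont2 x).intervalIntegrable 0 1
  have ii1 : ∀ τ, IntervalIntegrable (fun x => A₁ x τ) volume 0 1 := fun x =>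
    (cont1 x).intervalIntegrable 0 1
  have hpc : ContinuousOn (fun x => par ι (A₂ x) d t) (Icc c x) := by
    refine continuousOn_of_forall_continuousAt fun z _ => ?_
    rw [hι.isEmbedding.continuousAt_iff, ContinuousAt, tendsto_iff_norm_sub_tendsto_zero]
    have hlim : Tendsto (fun x => K' * ∫ τ in (0 : ℝ)..1, ‖A₂ x τ - A₂ z τ‖) (𝓝 z) (𝓝 0) := by
      refine Continuous.tendsto' (continuous_const.mul
        (intervalIntegral.continuous_parametric_intervalIntegral_of_continuous' ?_ 0 1)) _ _ (by
            simp)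
      exact (c2.sub ((cont2 z).comp continuous_snd)).norm
    refine squeeze_zero (fun _ => norm_nonneg _) (fun y => ?_) hlim
    exact (norm_sub_le_gdist' hc _ _).trans
      (hK' _ _ d t (ii2 y) (ii2 z) (sub01 d hd) (sub01 t ht))
  have hIc : ∀ z ∈ Icc c x, z ∈ Icc (0 : ℝ) 1 := fun z hz =>
    sub01 z ⟨hcm.1.trans hz.1, hz.2.trans hxm.2⟩
  set φ : ℝ → ℝ := fun z => gdist ι (par ι (fun x => A₁ x d) c z * par ι (A₂ z) d t)
        (par ι (A₂ c) d t * par ι (fun x => A₁ x t) c z) with hφ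
  have hφc : ContinuousOn φ (Icc c x) :=
    (continuous_gdist hι).comp_continuousOn
      ((((continuousOn_par hι (ii1 d) c).mono hIc).mul hpc).prodMk
        (continuousOn_const.mul ((continuousOn_par hι (ii1 t) c).mono hIc)))
  have hgc : Continuous (fun z => ∫ τ in d..t, F z τ) :=
    intervalIntegral.continuous_parametric_intervalIntegral_of_continuous' hFc d t
  -- The defect `φ z` of the rectangle `[c, z] × [d, t]` grows in `z` at most at the rate given by
  -- the strip estimate.
  have main := image_le_of_liminf_slope_right_le_deriv_boundary (f := φ) (a := c) (b := x) hφc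
    (B := fun z => K * ∫ y in c..z, ∫ τ in d..t, F y τ) (B' := fun z => K * ∫ τ in d..t, F z τ)
    (by simp [hφ, par_self, gdist_self])
    (continuous_const.mul (intervalIntegral.continuous_primitive
      (fun a b => hgc.intervalIntegrable a b) c)).continuousOn
    (fun z _ => ((intervalIntegral.integral_hasDerivAt_right (hgc.intervalIntegrable _ _)
      hgc.stronglyMeasurable.stronglyMeasurableAtFilter hgc.continuousAt).const_mul
        K).hasDerivWithinAt) ?_ (right_mem_Icc.2 hcx)
  · refine main.trans ?_
    gcongr
    have hgc' : Continuous (fun z => ∫ τ in α..β, F z τ) :=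
      intervalIntegral.continuous_parametric_intervalIntegral_of_continuous' hFc α β
    have hαβ : α ≤ β := hcm.1.trans hcm.2
    calc ∫ y in c..x, ∫ τ in d..t, F y τ ≤ ∫ y in c..x, ∫ τ in α..β, F y τ := by
          refine intervalIntegral.integral_mono hcx (hgc.intervalIntegrable _ _)
            (hgc'.intervalIntegrable _ _) fun y => ?_
          exact intervalIntegral.integral_mono_interval hd.1 hdt ht.2
            (.of_forall fun _ => hF0 _ _) ((hFc.comp (Continuous.prodMk_right
                y)).intervalIntegrable _ _)
      _ ≤ _ := intervalIntegral.integral_mono_interval hcm.1 hcx hxm.2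
            (.of_forall fun _ => intervalIntegral.integral_nonneg hαβ fun _ _ => hF0 _ _)
            (hgc'.intervalIntegrable _ _)
  · intro z hz r hr
    have hz1 : z ∈ Icc (0 : ℝ) 1 := hIc z ⟨hz.1, hz.2.le⟩
    have hz2 : z ∈ Ico (0 : ℝ) 1 := ⟨hz1.1, hz.2.trans_le (sub01 x hxm).2⟩
    obtain ⟨r', hr', hrr'⟩ := exists_between hr
    have hε : 0 < (r - r') / 3 := by linarith
    have ev := hK A₁ A₂ D₁ D₂ c1 c2 c1' c2' hA1 hA2 z hz2 d (sub01 d hd) t (sub01 t ht) hdt r' hr'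
    have e1 := eventually_gdist_par_ex_le hι (cont1 d) hz2 hε
    have e2 := eventually_gdist_par_ex_le hι (cont1 t) hz2 hε
    have hev : ∀ᶠ h in 𝓝[>] (0 : ℝ), slope φ z (z + h) < r := by
      filter_upwards [ev, e1, e2, eventually_mem_nhdsWithin] with h a1 a2 a3 (h0 : 0 < h)
      rw [slope_def_field, add_sub_cancel_left, div_lt_iff₀ h0]
      have b1 : φ (z + h) ≤ gdist ι (par ι (fun x => A₁ x d) z (z + h) * par ι (A₂ (z + h)) d t)
          (par ι (A₂ z) d t * par ι (fun x => A₁ x t) z (z + h)) + φ z := by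
        simp only [hφ]
        refine (gdist_triangle hc _ (par ι (fun x => A₁ x d) c z * (par ι (A₂ z) d t *
          par ι (fun x => A₁ x t) z (z + h))) _).trans (add_le_add ?_ ?_)
        · rw [← par_mul_par ι (fun x => A₁ x d) c z (z + h), mul_assoc, gdist_mul_left hc]
        · rw [← par_mul_par ι (fun x => A₁ x t) c z (z + h), ← mul_assoc, ← mul_assoc,
            gdist_mul_right hc]
      have b2 : gdist ι (par ι (fun x => A₁ x d) z (z + h) * par ι (A₂ (z + h)) d t)
          (par ι (A₂ z) d t * par ι (fun x => A₁ x t) z (z + h)) ≤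
          (r - r') / 3 * h + (r' * h + (r - r') / 3 * h) := by
        refine (gdist_triangle hc _ (ex E G (h • A₁ z d) * par ι (A₂ (z + h)) d t) _).trans
          (add_le_add (by rwa [gdist_mul_right hc]) ?_)
        refine (gdist_triangle hc _ (par ι (A₂ z) d t * ex E G (h • A₁ z t)) _).trans
          (add_le_add a1 ?_)
        rw [gdist_mul_left hc, gdist_comm]
        exact a3
      nlinarith
    have hmap : Tendsto (fun y => y - z) (𝓝[>] z) (𝓝[>] 0) := by
      refine tendsto_nhdsWithin_iff.2 ⟨?_, ?_⟩
      · exact (Continuous.tendsto' (by fun_prop) _ _ (by simp)).mono_left nhdsWithin_le_nhds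
      · filter_upwards [eventually_mem_nhdsWithin] with y (hy : z < y)
        exact sub_pos.2 hy
    have := hmap.eventually hev
    simp only [add_sub_cancel] at this
    exact this.frequently

end Rectangle

/-! ### Mollification in `Lᵖ` -/

section Mollify

open scoped ENNReal Convolution

variable {m : ℕ} {F : Type*} [NormedAddCommGroup F] [NormedSpace ℝ F] [FiniteDimensional ℝ F]

/-- Translation is continuous in `Lᵖ`. -/
lemma tendsto_eLpNorm_translate {p : ℝ≥0∞} (hp1 : 1 ≤ p) (hp : p ≠ ⊤) {f : (Fin m → ℝ) → F}
    (hf : MemLp f p volume) :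
    Tendsto (fun z : Fin m → ℝ => eLpNorm (fun x => f (z + x) - f x) p volume) (𝓝 0) (𝓝 0) := by
  have : Fact (1 ≤ p) := ⟨hp1⟩
  have : Fact (p ≠ ⊤) := ⟨hp⟩
  have h1 : Continuous (fun z : Fin m → ℝ => DomAddAct.mk z +ᵥ hf.toLp f) := by
    have : Continuous (fun z : Fin m → ℝ => DomAddAct.mk z) := DomAddAct.continuous_mk
    exact this.vadd continuous_const
  have h2 : Tendsto (fun z : Fin m → ℝ => edist (DomAddAct.mk z +ᵥ hf.toLp f) (hf.toLp f))
      (𝓝 0) (𝓝 0) := by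
    have := (h1.edist (continuous_const (y := hf.toLp f))).tendsto 0
    simpa using this
  refine h2.congr fun z => ?_
  rw [DomAddAct.mk_vadd_toLp, Lp.edist_toLp_toLp]
  rfl

/-- Mollifications converge in `Lᵖ`: by Jensen's inequality, the `Lᵖ` distance from `f` to its
mollification is at most the modulus of continuity of translation in `Lᵖ`. -/
lemma exists_eLpNorm_convolution_sub_le {p : ℝ≥0∞} (hp1 : 1 ≤ p) (hp : p ≠ ⊤)
    {f : (Fin m → ℝ) → F} (hf : MemLp f p volume) {ε : ℝ≥0∞} (hε : 0 < ε) :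
    ∃ δ > 0, ∀ φ : ContDiffBump (0 : Fin m → ℝ), φ.rOut < δ →
      eLpNorm (φ.normed volume ⋆[ContinuousLinearMap.lsmul ℝ ℝ, volume] f - f) p volume ≤ ε := by
  wlog hsm : StronglyMeasurable f generalizing f
  · obtain ⟨g, hg, hfg⟩ := hf.1
    obtain ⟨δ, hδ, h⟩ := this ((memLp_congr_ae hfg).1 hf) hg
    refine ⟨δ, hδ, fun φ hφ => ?_⟩
    rw [convolution_congr _ .rfl hfg]
    refine (eLpNorm_congr_ae ?_).trans_le (h φ hφ)
    exact EventuallyEq.rfl.sub hfg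
  have : CompleteSpace F := FiniteDimensional.complete ℝ F
  obtain ⟨δ, hδ, hball⟩ := Metric.eventually_nhds_iff_ball.1
    ((tendsto_eLpNorm_translate hp1 hp hf).eventually_le_const hε)
  refine ⟨δ, hδ, fun φ hφ => ?_⟩
  have p0 : p ≠ 0 := (zero_lt_one.trans_le hp1).ne'
  have q0 : 0 < p.toReal := ENNReal.toReal_pos p0 hp
  set ψ : (Fin m → ℝ) → ℝ := φ.normed volume with hψ
  have hψc : Continuous ψ := φ.continuous_normed
  set w : (Fin m → ℝ) → ℝ≥0∞ := fun z => ‖ψ z‖ₑ with hw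
  have hwm : Measurable w := hψc.measurable.enorm
  have hw1 : ∫⁻ z, w z = 1 := by
    have h1 := φ.integral_normed (μ := (volume : Measure (Fin m → ℝ)))
    rw [hw, ← ofReal_integral_norm_eq_lintegral_enorm φ.integrable_normed]
    simp_rw [Real.norm_of_nonneg (φ.nonneg_normed _)]
    rw [h1, ENNReal.ofReal_one]
  -- The mollification is an average for the probability measure `π`, and the `L¹` norm with
  -- respect to `π` is at most the `Lᵖ` norm.
  set π : Measure (Fin m → ℝ) := volume.withDensity w
  have : IsProbabilityMeasure π := ⟨by rw [withDensity_apply _ .univ, setLIntegral_univ, hw1]⟩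
  have hloc : LocallyIntegrable f volume := hf.locallyIntegrable hp1
  have hconv : ∀ x, Integrable (fun z => ψ z • f (x - z)) volume := fun x =>
    (φ.hasCompactSupport_normed.convolutionExists_left (ContinuousLinearMap.lsmul ℝ ℝ) hψc hloc x)
  set D : (Fin m → ℝ) → (Fin m → ℝ) → F := fun x z => f (x - z) - f x
  have hDm : StronglyMeasurable (fun q : (Fin m → ℝ) × (Fin m → ℝ) => D q.1 q.2) :=
    (hsm.comp_measurable (by fun_prop)).sub (hsm.comp_measurable (by fun_prop))
  have pt : ∀ x, ‖(ψ ⋆[ContinuousLinearMap.lsmul ℝ ℝ, volume] f - f) x‖ₑ ^ p.toReal ≤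
      ∫⁻ z, w z * ‖D x z‖ₑ ^ p.toReal := by
    intro x
    have e1 : (ψ ⋆[ContinuousLinearMap.lsmul ℝ ℝ, volume] f - f) x = ∫ z, ψ z • D x z := by
      have : ∫ z, ψ z • f x = f x := by
        rw [integral_smul_const, φ.integral_normed, one_smul]
      have e0 : (ψ ⋆[ContinuousLinearMap.lsmul ℝ ℝ, volume] f) x = ∫ z, ψ z • f (x - z) := rfl
      have hi : Integrable (fun z => ψ z • f x) volume := φ.integrable_normed.smul_const _
      simp only [D, smul_sub]
      rw [integral_sub (hconv x) hi, this, Pi.sub_apply, e0]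
    have hDx : StronglyMeasurable (D x) := hDm.comp_measurable measurable_prodMk_left
    have e2 : ‖(ψ ⋆[ContinuousLinearMap.lsmul ℝ ℝ, volume] f - f) x‖ₑ ≤ eLpNorm (D x) p π := by
      rw [e1]
      refine (enorm_integral_le_lintegral_enorm _).trans ?_
      refine le_trans (le_of_eq ?_)
        (eLpNorm_le_eLpNorm_of_exponent_le hp1 hDx.aestronglyMeasurable)
      rw [eLpNorm_one_eq_lintegral_enorm, lintegral_withDensity_eq_lintegral_mul _ hwm
        hDx.enorm]
      simp [enorm_smul, hw]
    refine (ENNReal.rpow_le_rpow e2 q0.le).trans (le_of_eq ?_)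
    rw [eLpNorm_eq_lintegral_rpow_enorm_toReal p0 hp, ← ENNReal.rpow_mul,
      one_div_mul_cancel q0.ne', ENNReal.rpow_one,
      lintegral_withDensity_eq_lintegral_mul _ hwm (hDx.enorm.pow_const _)]
    rfl
  rw [eLpNorm_eq_lintegral_rpow_enorm_toReal p0 hp, one_div, ENNReal.rpow_inv_le_iff q0]
  calc _ ≤ ∫⁻ x, ∫⁻ z, w z * ‖D x z‖ₑ ^ p.toReal := lintegral_mono pt
    _ = ∫⁻ z, ∫⁻ x, w z * ‖D x z‖ₑ ^ p.toReal := by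
        refine lintegral_lintegral_swap (Measurable.aemeasurable ?_)
        exact (hwm.comp measurable_snd).mul (hDm.enorm.pow_const _)
    _ ≤ ∫⁻ z, w z * ε ^ p.toReal := by
        refine lintegral_mono fun z => ?_
        have hDz : StronglyMeasurable (fun x => D x z) := hDm.comp_measurable
            measurable_prodMk_right
        rw [lintegral_const_mul _ (hDz.enorm.pow_const _)]
        by_cases hz : w z = 0
        · simp [hz]
        · gcongr
          have hz' : z ∈ Metric.ball (0 : Fin m → ℝ) φ.rOut := by
            rw [← φ.support_normed_eq (μ := volume)]
            intro h
            exact hz (by simp only [hw, hψ, h, enorm_zero])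
          have := hball (-z) (by
            rw [Metric.mem_ball, dist_zero_right] at hz' ⊢
            rw [norm_neg]; exact hz'.trans hφ)
          rw [eLpNorm_eq_lintegral_rpow_enorm_toReal p0 hp, one_div,
            ENNReal.rpow_inv_le_iff q0] at this
          simpa [D, sub_eq_neg_add] using this
    _ = ε ^ p.toReal := by rw [lintegral_mul_const _ hwm, hw1, one_mul]

end Mollify

/-! ### Lebesgue measure on the cube and on its coordinate lines -/

section CubeMeasure

open scoped ENNReal

variable {m : ℕ}

/-- Lebesgue measure on the unit interval. -/
noncomputable def unitMeasure : Measure ℝ := volume.restrict (Icc 0 1)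

instance : IsProbabilityMeasure unitMeasure := ⟨by simp [unitMeasure]⟩

lemma cubeMeasure_eq_pi : cubeMeasure m = Measure.pi (fun _ => unitMeasure) := by
  rw [cubeMeasure, cube, ← Set.pi_univ_Icc]
  exact Measure.restrict_pi_pi (fun _ : Fin m => (volume : Measure ℝ)) (fun _ => Icc 0 1)

instance : IsProbabilityMeasure (cubeMeasure m) := by
  rw [cubeMeasure_eq_pi]; infer_instance

/-- Replacing one coordinate of a random point of the cube by an independent random number does not
change its distribution. -/
lemma measurePreserving_update (i : Fin m) :
    MeasurePreserving (fun z : ℝ × (Fin m → ℝ) => Function.update z.2 i z.1)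
      (unitMeasure.prod (cubeMeasure m)) (cubeMeasure m) := by
  have hm : Measurable (fun z : ℝ × (Fin m → ℝ) => Function.update z.2 i z.1) := by
    refine measurable_pi_iff.2 fun j => ?_
    by_cases h : j = i
    · subst h; simpa using measurable_fst
    · simpa [Function.update_of_ne h] using! (measurable_pi_apply j).comp measurable_snd
  refine ⟨hm, ?_⟩
  rw [cubeMeasure_eq_pi]
  refine (Measure.pi_eq fun s hs => ?_).symm
  rw [Measure.map_apply hm (MeasurableSet.univ_pi hs)]
  have : (fun z : ℝ × (Fin m → ℝ) => Function.update z.2 i z.1) ⁻¹' (univ.pi s) =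
      s i ×ˢ univ.pi (Function.update s i univ) := by
    ext z
    simp only [mem_preimage, Set.mem_pi, mem_univ, true_implies, mem_prod]
    constructor
    · intro h
      refine ⟨by simpa using h i, fun j => ?_⟩
      by_cases hj : j = i
      · subst hj; simp
      · simpa [hj] using h j
    · rintro ⟨h1, h2⟩ j
      by_cases hj : j = i
      · subst hj; simpa using h1
      · simpa [hj] using h2 j
  rw [this, Measure.prod_prod, Measure.pi_pi, ← Finset.mul_prod_erase _ _ (Finset.mem_univ i),
    ← Finset.mul_prod_erase Finset.univ (fun j => unitMeasure (s j)) (Finset.mem_univ i)]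
  simp only [Function.update_self, measure_univ, one_mul]
  congr 1
  refine Finset.prod_congr rfl fun j hj => ?_
  rw [Function.update_of_ne (Finset.ne_of_mem_erase hj)]

lemma ae_update {p : (Fin m → ℝ) → Prop} (h : ∀ᵐ x ∂(cubeMeasure m), p x) (i : Fin m) :
    ∀ᵐ z ∂(unitMeasure.prod (cubeMeasure m)), p (Function.update z.2 i z.1) :=
  (measurePreserving_update i).quasiMeasurePreserving.ae h

lemma ae_swap {X Y : Type*} [MeasurableSpace X] [MeasurableSpace Y] {μ : Measure X} {ν : Measure Y}
    [SFinite μ] [SFinite ν] {p : X × Y → Prop} (h : ∀ᵐ z ∂(μ.prod ν), p z) :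
    ∀ᵐ z ∂(ν.prod μ), p z.swap :=
  Measure.measurePreserving_swap.quasiMeasurePreserving.ae h

lemma ae_ae_update {p : (Fin m → ℝ) → Prop} (h : ∀ᵐ x ∂(cubeMeasure m), p x) (i : Fin m) :
    ∀ᵐ x ∂(cubeMeasure m), ∀ᵐ s ∂unitMeasure, p (Function.update x i s) :=
  Measure.ae_ae_of_ae_prod (ae_swap (ae_update h i))

lemma ae_mem_Ioo : ∀ᵐ s ∂unitMeasure, s ∈ Ioo (0 : ℝ) 1 := by
  rw [unitMeasure, ← restrict_Ioo_eq_restrict_Icc]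
  exact ae_restrict_mem measurableSet_Ioo

lemma mem_interior_cube {x : Fin m → ℝ} : x ∈ interior (cube m) ↔ ∀ i, x i ∈ Ioo (0 : ℝ) 1 := by
  rw [cube, ← Set.pi_univ_Icc, interior_pi_set finite_univ]
  simp

lemma ae_mem_interior_cube : ∀ᵐ x ∂(cubeMeasure m), x ∈ interior (cube m) := by
  simp only [mem_interior_cube, cubeMeasure_eq_pi]
  rw [eventually_all]
  exact fun i => (Measure.quasiMeasurePreserving_eval _ i).ae ae_mem_Ioo

/-- Fubini's theorem on lines: the integral over the cube is the average of the integrals over the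
lines in the `i`-th direction. -/
lemma lintegral_update {g : (Fin m → ℝ) → ℝ≥0∞} (hg : AEMeasurable g (cubeMeasure m)) (i : Fin m) :
    AEMeasurable (fun x => ∫⁻ s, g (Function.update x i s) ∂unitMeasure) (cubeMeasure m) ∧
      ∫⁻ x, ∫⁻ s, g (Function.update x i s) ∂unitMeasure ∂(cubeMeasure m) =
        ∫⁻ x, g x ∂(cubeMeasure m) := by
  have hmp := measurePreserving_update i
  have h1 : AEMeasurable (fun z : ℝ × (Fin m → ℝ) => g (Function.update z.2 i z.1))
      (unitMeasure.prod (cubeMeasure m)) := hg.comp_quasiMeasurePreserving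
          hmp.quasiMeasurePreserving
  refine ⟨h1.prod_swap.lintegral_prod_right', ?_⟩
  rw [← lintegral_prod_symm _ h1, ← lintegral_map' (by rwa [hmp.map_eq]) hmp.aemeasurable,
    hmp.map_eq]

/-- The Borel–Cantelli principle for fast `L¹` convergence to `0`. -/
lemma ae_tendsto_zero_of_tsum_lintegral {X : Type*} [MeasurableSpace X] {μ : Measure X}
    {g : ℕ → X → ℝ≥0∞} (hg : ∀ n, AEMeasurable (g n) μ) (h : ∑' n, ∫⁻ x, g n x ∂μ ≠ ⊤) :
    ∀ᵐ x ∂μ, Tendsto (fun n => g n x) atTop (𝓝 0) := by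
  rw [← lintegral_tsum hg] at h
  filter_upwards [ae_lt_top' (AEMeasurable.tsum hg) h] with x hx
  exact ENNReal.tendsto_atTop_zero_of_tsum_ne_top hx.ne

variable {F : Type*} [NormedAddCommGroup F]

lemma ae_integrable_line {f : (Fin m → ℝ) → F} (hf : Integrable f (cubeMeasure m)) (i : Fin m) :
    ∀ᵐ x ∂(cubeMeasure m), Integrable (fun s => f (Function.update x i s)) unitMeasure := by
  have := (measurePreserving_update i).integrable_comp_of_integrable hf
  exact this.prod_left_ae

lemma integrable_unitMeasure_iff {a : ℝ → F} :
    Integrable a unitMeasure ↔ IntervalIntegrable a volume 0 1 := by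
  rw [intervalIntegrable_iff_integrableOn_Icc_of_le zero_le_one]; rfl

lemma integral_interval_eq [NormedSpace ℝ F] (a : ℝ → F) :
    ∫ τ in (0 : ℝ)..1, a τ = ∫ τ, a τ ∂unitMeasure := by
  rw [intervalIntegral.integral_of_le zero_le_one, unitMeasure, integral_Icc_eq_integral_Ioc]

/-- Fast `L¹` convergence implies `L¹` convergence on almost every line. -/
lemma ae_tendsto_lintegral_line {f : ℕ → (Fin m → ℝ) → F}
    (hf : ∀ n, AEStronglyMeasurable (f n) (cubeMeasure m))
    (h : ∑' n, ∫⁻ x, ‖f n x‖ₑ ∂(cubeMeasure m) ≠ ⊤) (i : Fin m) :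
    ∀ᵐ x ∂(cubeMeasure m), Tendsto (fun n => ∫⁻ s, ‖f n (Function.update x i s)‖ₑ ∂unitMeasure)
      atTop (𝓝 0) := by
  refine ae_tendsto_zero_of_tsum_lintegral (fun n => (lintegral_update (hf n).enorm i).1) ?_
  simp_rw [(lintegral_update (hf _).enorm i).2]
  exact h

/-- Fast `L¹` convergence implies `L¹` convergence on almost every coordinate plane. -/
lemma ae_tendsto_lintegral_plane {f : ℕ → (Fin m → ℝ) → F}
    (hf : ∀ n, AEStronglyMeasurable (f n) (cubeMeasure m))
    (h : ∑' n, ∫⁻ x, ‖f n x‖ₑ ∂(cubeMeasure m) ≠ ⊤) (i j : Fin m) :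
    ∀ᵐ x ∂(cubeMeasure m), Tendsto (fun n => ∫⁻ s, ∫⁻ t,
      ‖f n (Function.update (Function.update x i s) j t)‖ₑ ∂unitMeasure ∂unitMeasure)
      atTop (𝓝 0) := by
  refine ae_tendsto_zero_of_tsum_lintegral
    (fun n => (lintegral_update (lintegral_update (hf n).enorm j).1 i).1) ?_
  simp_rw [(lintegral_update (lintegral_update (hf _).enorm j).1 i).2,
    (lintegral_update (hf _).enorm j).2]
  exact h

lemma tendsto_intervalIntegral_norm {f : ℕ → ℝ → F}
    (h : Tendsto (fun n => ∫⁻ s, ‖f n s‖ₑ ∂unitMeasure) atTop (𝓝 0)) :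
    Tendsto (fun n => ∫ s in (0 : ℝ)..1, ‖f n s‖) atTop (𝓝 0) := by
  have h' := (ENNReal.tendsto_toReal ENNReal.zero_ne_top).comp h
  rw [ENNReal.toReal_zero] at h'
  refine squeeze_zero' (.of_forall fun n => intervalIntegral.integral_nonneg zero_le_one
    fun _ _ => norm_nonneg _) ?_ h'
  filter_upwards [h.eventually_lt_const zero_lt_one] with n hn
  rw [integral_interval_eq]
  refine (ENNReal.ofReal_le_iff_le_toReal (hn.trans ENNReal.one_lt_top).ne).1 ?_
  refine (Real.ofReal_le_enorm _).trans ((enorm_integral_le_lintegral_enorm _).trans ?_)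
  simp

end CubeMeasure

/-! ### Mollification on the cube -/

section Moll

open scoped ENNReal Convolution

variable {m : ℕ} {F : Type*} [NormedAddCommGroup F] [NormedSpace ℝ F] [FiniteDimensional ℝ F]

/-- The convolution of `φ` with the restriction of `f` to the cube. -/
noncomputable def moll (φ : (Fin m → ℝ) → ℝ) (f : (Fin m → ℝ) → F) (x : Fin m → ℝ) : F :=
  ∫ y, φ (x - y) • f y ∂(cubeMeasure m)

lemma measurableSet_cube : MeasurableSet (cube m) := measurableSet_Icc

lemma moll_eq_convolution (φ : (Fin m → ℝ) → ℝ) (f : (Fin m → ℝ) → F) :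
    moll φ f = φ ⋆[ContinuousLinearMap.lsmul ℝ ℝ, volume] ((cube m).indicator f) := by
  ext x
  rw [convolution_lsmul_swap, moll, cubeMeasure, ← integral_indicator measurableSet_cube]
  congr 1
  ext y
  by_cases h : y ∈ cube m <;> simp [h]

lemma integrable_indicator_cube {f : (Fin m → ℝ) → F} (hf : Integrable f (cubeMeasure m)) :
    Integrable ((cube m).indicator f) volume := (integrable_indicator_iff measurableSet_cube).2 hf

lemma contDiff_moll {φ : (Fin m → ℝ) → ℝ} (hφ : ContDiff ℝ ∞ φ) (hφc : HasCompactSupport φ)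
    {f : (Fin m → ℝ) → F} (hf : Integrable f (cubeMeasure m)) : ContDiff ℝ ∞ (moll φ f) := by
  rw [moll_eq_convolution]
  exact hφc.contDiff_convolution_left _ hφ (integrable_indicator_cube hf).locallyIntegrable

lemma integrable_smul_of_compact {ψ : (Fin m → ℝ) → ℝ} (hψ : Continuous ψ) (hψc : HasCompactSupport
    ψ)
    {f : (Fin m → ℝ) → F} (hf : Integrable f (cubeMeasure m)) (x : Fin m → ℝ) :
    Integrable (fun y => ψ (x - y) • f y) (cubeMeasure m) := by
  obtain ⟨C, hC⟩ := hψ.bounded_above_of_compact_support hψc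
  exact hf.bdd_smul C (by fun_prop) (.of_forall fun y => hC _)

lemma fderiv_moll_apply {φ : (Fin m → ℝ) → ℝ} (hφ : ContDiff ℝ ∞ φ) (hφc : HasCompactSupport φ)
    {f : (Fin m → ℝ) → F} (hf : Integrable f (cubeMeasure m)) (x v : Fin m → ℝ) :
    fderiv ℝ (moll φ f) x v = ∫ y, fderiv ℝ φ (x - y) v • f y ∂(cubeMeasure m) := by
  have : CompleteSpace F := FiniteDimensional.complete ℝ F
  have hfi := (integrable_indicator_cube hf).locallyIntegrable
  have h := hφc.hasFDerivAt_convolution_left (ContinuousLinearMap.lsmul ℝ ℝ)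
    (hφ.of_le (by simp)) hfi x
  have hex := ((hφc.fderiv ℝ).convolutionExists_left
    ((ContinuousLinearMap.lsmul ℝ ℝ).precompL (Fin m → ℝ)) (hφ.continuous_fderiv (by simp)) hfi) x
  rw [moll_eq_convolution, h.fderiv, convolution_def, ContinuousLinearMap.integral_apply hex]
  simp only [ContinuousLinearMap.precompL_apply]
  have := congrFun (moll_eq_convolution (fun y => fderiv ℝ φ y v) f) x
  exact this.symm

/-- Test functions obtained by reflecting and translating a bump. -/
lemma isTestFunction_comp_sub {φ : (Fin m → ℝ) → ℝ} (hφ : ContDiff ℝ ∞ φ) {r : ℝ}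
    (hφr : Function.support φ ⊆ Metric.ball 0 r) {x : Fin m → ℝ}
    {δ : ℝ} (hδ : ∀ i, x i ∈ Icc δ (1 - δ)) (hrδ : r < δ) :
    IsTestFunction (fun y => φ (x - y)) := by
  have hsub : tsupport (fun y => φ (x - y)) ⊆ Metric.closedBall x r := by
    refine closure_minimal (fun y hy => ?_) Metric.isClosed_closedBall
    have := hφr (a := x - y) hy
    rw [Metric.mem_ball, dist_zero_right] at this
    rw [Metric.mem_closedBall, dist_comm, dist_eq_norm]
    exact this.le
  refine ⟨hφ.comp (by fun_prop), HasCompactSupport.of_support_subset_isCompact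
    (isCompact_closedBall x r) (subset_closure.trans hsub), hsub.trans fun y hy => ?_⟩
  rw [mem_interior_cube]
  intro i
  have h1 : |y i - x i| ≤ r := (norm_le_pi_norm (y - x) i).trans (by
    rw [← dist_eq_norm]; exact hy)
  have := hδ i
  rw [abs_le] at h1
  exact ⟨by linarith [this.1, h1.1], by linarith [this.2, h1.2]⟩

lemma partialDeriv_comp_sub {φ : (Fin m → ℝ) → ℝ} (hφ : ContDiff ℝ ∞ φ) (x y : Fin m → ℝ)
    (i : Fin m) : partialDeriv i (fun y => φ (x - y)) y = -fderiv ℝ φ (x - y) (Pi.single i 1) := by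
  have h1 := ((hφ.differentiable (by simp)) (x - y)).hasFDerivAt
  have h2 : HasFDerivAt (fun y => φ (x - y)) _ y := h1.comp y ((hasFDerivAt_id y).const_sub x)
  rw [partialDeriv, h2.fderiv]
  simp

/-- Mollification of a weak derivative, away from the boundary of the cube. -/
lemma HasWeakPartialDeriv.fderiv_moll {i : Fin m} {f g : (Fin m → ℝ) → F}
    (h : HasWeakPartialDeriv i f g) (hf : Integrable f (cubeMeasure m))
    {φ : (Fin m → ℝ) → ℝ} (hφ : ContDiff ℝ ∞ φ) (hφc : HasCompactSupport φ) {x : Fin m → ℝ}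
    (hx : IsTestFunction (fun y => φ (x - y))) :
    fderiv ℝ (moll φ f) x (Pi.single i 1) = moll φ g x := by
  have := h.2.2 _ hx
  rw [fderiv_moll_apply hφ hφc hf, moll]
  simp only [partialDeriv_comp_sub hφ, neg_smul, integral_neg, neg_inj] at this
  exact this

/-- Mollifications converge in `Lᵖ` of the cube. -/
lemma eventually_eLpNorm_moll_sub_le {p : ℝ≥0∞} (hp1 : 1 ≤ p) (hp : p ≠ ⊤)
    {f : (Fin m → ℝ) → F} (hf : MemLp f p (cubeMeasure m)) {ε : ℝ≥0∞} (hε : 0 < ε) :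
    ∀ᶠ δ in 𝓝[>] (0 : ℝ), ∀ φ : ContDiffBump (0 : Fin m → ℝ), φ.rOut = δ →
      eLpNorm (moll (φ.normed volume) f - f) p (cubeMeasure m) ≤ ε := by
  have hf' : MemLp ((cube m).indicator f) p volume := (memLp_indicator_iff_restrict
    measurableSet_cube).2 hf
  obtain ⟨δ, hδ, h⟩ := exists_eLpNorm_convolution_sub_le hp1 hp hf' hε
  filter_upwards [Ioo_mem_nhdsGT hδ] with r hr φ hφ
  refine le_trans ?_ (h φ (by rw [hφ]; exact hr.2))
  rw [← moll_eq_convolution]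
  refine le_trans (le_of_eq ?_) (eLpNorm_mono_measure _
    (Measure.restrict_le_self (s := cube m)))
  refine eLpNorm_congr_ae ?_
  filter_upwards [ae_restrict_mem measurableSet_cube] with x hx
  simp [hx]

/-- A sequence of bumps with radii tending to `0`, each satisfying a condition that holds for all
small radii. -/
lemma exists_bump_seq {Q : ℕ → ContDiffBump (0 : Fin m → ℝ) → Prop}
    (hQ : ∀ n, ∀ᶠ δ in 𝓝[>] (0 : ℝ), ∀ φ : ContDiffBump (0 : Fin m → ℝ), φ.rOut = δ → Q n φ) :
    ∃ φ : ℕ → ContDiffBump (0 : Fin m → ℝ), (∀ n, Q n (φ n)) ∧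
      Tendsto (fun n => (φ n).rOut) atTop (𝓝 0) := by
  have h : ∀ n : ℕ, ∃ φ : ContDiffBump (0 : Fin m → ℝ), Q n φ ∧ φ.rOut < 1 / ((n : ℝ) + 1) := by
    intro n
    obtain ⟨δ, h1, h2⟩ := ((hQ n).and (Ioo_mem_nhdsGT (show (0 : ℝ) < 1 / ((n : ℝ) + 1) by
      positivity))).exists
    exact ⟨⟨δ / 2, δ, by linarith [h2.1], by linarith [h2.1]⟩, h1 _ rfl, h2.2⟩
  choose φ h1 h2 using h
  exact ⟨φ, h1, squeeze_zero (fun n => (φ n).rOut_pos.le) (fun n => (h2 n).le)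
    tendsto_one_div_add_atTop_nhds_zero_nat⟩

end Moll

/-! ### Mollification of forms and of their brackets -/

section MollForm

open scoped ENNReal NNReal

variable {m : ℕ} {E : Type*} [NormedAddCommGroup E] [NormedSpace ℝ E] [FiniteDimensional ℝ E]
  {G : Type*} [TopologicalSpace G] [ChartedSpace E G] [Group G] [LieGroup 𝓘(ℝ, E) ∞ G]

variable (E G) in
lemma exists_norm_br_le : ∃ C : ℝ≥0, ∀ a b : E, ‖br E G a b‖₊ ≤ C * ‖a‖₊ * ‖b‖₊ := by
  set T := fderiv ℝ (lam E G) 0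
  refine ⟨‖T‖₊ + ‖T‖₊, fun a b => ?_⟩
  rw [br, ← NNReal.coe_le_coe]
  push_cast
  refine (norm_sub_le _ _).trans ?_
  have h1 := T.le_opNorm₂ a b
  have h2 := T.le_opNorm₂ b a
  nlinarith

variable (E G) in
lemma continuous_br : Continuous (fun p : E × E => br E G p.1 p.2) := by
  have e1 := (fderiv ℝ (lam E G) 0).isBoundedBilinearMap.continuous
  exact e1.sub (e1.comp continuous_swap)

lemma br_sub_left (a a' b : E) : br E G (a - a') b = br E G a b - br E G a' b := by
  simp only [br, map_sub, _root_.sub_apply]; abel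

lemma br_sub_right (a b b' : E) : br E G a (b - b') = br E G a b - br E G a b' := by
  simp only [br, map_sub, _root_.sub_apply]; abel

variable (E G) in
lemma exists_eLpNorm_br_le : ∃ C : ℝ≥0, ∀ f g : (Fin m → ℝ) → E,
    AEStronglyMeasurable f (cubeMeasure m) → AEStronglyMeasurable g (cubeMeasure m) →
    eLpNorm (fun x => br E G (f x) (g x)) 1 (cubeMeasure m) ≤
      C * eLpNorm f 2 (cubeMeasure m) * eLpNorm g 2 (cubeMeasure m) := by
  obtain ⟨C, hC⟩ := exists_norm_br_le E G
  exact ⟨C, fun f g hf hg => eLpNorm_le_eLpNorm_mul_eLpNorm_of_nnnorm hf hg _ C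
    (.of_forall fun x => hC _ _)⟩

variable (G) in
lemma integrable_br {f g : (Fin m → ℝ) → E} (hf : MemLp f 2 (cubeMeasure m))
    (hg : MemLp g 2 (cubeMeasure m)) :
    Integrable (fun x => br E G (f x) (g x)) (cubeMeasure m) := by
  obtain ⟨C, hC⟩ := exists_eLpNorm_br_le (m := m) E G
  rw [← memLp_one_iff_integrable]
  exact ⟨(continuous_br E G).comp_aestronglyMeasurable (hf.1.prodMk hg.1),
    (hC f g hf.1 hg.1).trans_lt (ENNReal.mul_lt_top (ENNReal.mul_lt_top (by simp) hf.2) hg.2)⟩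

variable (G) in
/-- Mollifications of an `L²` form that converge fast in `L²`, and whose brackets converge fast
in `L¹`. -/
lemma exists_moll_seq {A : Fin m → (Fin m → ℝ) → E} (hA : ∀ i, MemLp (A i) 2 (cubeMeasure m)) :
    ∃ φ : ℕ → ContDiffBump (0 : Fin m → ℝ), Tendsto (fun n => (φ n).rOut) atTop (𝓝 0) ∧
      (∀ i, ∑' n, ∫⁻ x, ‖moll ((φ n).normed volume) (A i) x - A i x‖ₑ ∂(cubeMeasure m) ≠ ⊤) ∧
      ∀ i j, ∑' n, ∫⁻ x, ‖br E G (moll ((φ n).normed volume) (A i) x)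
        (moll ((φ n).normed volume) (A j) x) -
        moll ((φ n).normed volume) (fun y => br E G (A i y) (A j y)) x‖ₑ ∂(cubeMeasure m) ≠ ⊤ := by
  have hAi : ∀ i, Integrable (A i) (cubeMeasure m) := fun i => (hA i).integrable one_le_two
  have h2 : ∀ n : ℕ, (0 : ℝ≥0∞) < 2⁻¹ ^ n := fun n => ENNReal.pow_pos (by simp) n
  obtain ⟨φ, hφ, hφr⟩ := exists_bump_seq (m := m) (Q := fun n φ =>
    (∀ i, eLpNorm (moll (φ.normed volume) (A i) - A i) 2 (cubeMeasure m) ≤ 2⁻¹ ^ n) ∧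
    ∀ i j, eLpNorm (moll (φ.normed volume) (fun y => br E G (A i y) (A j y)) -
      (fun y => br E G (A i y) (A j y))) 1 (cubeMeasure m) ≤ 2⁻¹ ^ n) (fun n => by
    have e1 := eventually_all.2 fun i => eventually_eLpNorm_moll_sub_le one_le_two (by simp) (hA i)
        (h2 n)
    have e2 := eventually_all.2 fun i => eventually_all.2 fun j => eventually_eLpNorm_moll_sub_le
      le_rfl (by simp) (memLp_one_iff_integrable.2 (integrable_br G (hA i) (hA j))) (h2 n)
    filter_upwards [e1, e2] with δ a1 a2 φ hφ using ⟨fun i => a1 i φ hφ, fun i j => a2 i j φ hφ⟩)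
  obtain ⟨C, hC⟩ := exists_eLpNorm_br_le (m := m) E G
  have hMm : ∀ {F : Type _} [NormedAddCommGroup F] [NormedSpace ℝ F] [FiniteDimensional ℝ F] n
      {f : (Fin m → ℝ) → F}, Integrable f (cubeMeasure m) →
      AEStronglyMeasurable (moll ((φ n).normed volume) f) (cubeMeasure m) := fun n f hf =>
    (contDiff_moll (φ n).contDiff_normed (φ n).hasCompactSupport_normed
      hf).continuous.aestronglyMeasurable
  have hfin : ∀ (K : ℝ≥0∞) (a : ℕ → ℝ≥0∞), K ≠ ⊤ → (∀ n, a n ≤ K * 2⁻¹ ^ n) → ∑' n, a n ≠ ⊤ := by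
    intro K a hK h
    refine ne_top_of_le_ne_top ?_ (ENNReal.tsum_le_tsum h)
    rw [ENNReal.tsum_mul_left, ENNReal.tsum_geometric]
    refine ENNReal.mul_ne_top hK ?_
    rw [ENNReal.inv_ne_top]
    exact (tsub_pos_of_lt (ENNReal.inv_lt_one.2 ENNReal.one_lt_two)).ne'
  refine ⟨φ, hφr, fun i => hfin 1 _ (by simp) fun n => ?_, fun i j => hfin
    (C * (eLpNorm (A j) 2 (cubeMeasure m) + 1) + C * eLpNorm (A i) 2 (cubeMeasure m) + 1) _ ?_
      fun n => ?_⟩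
  · rw [one_mul]
    refine le_trans ?_ ((hφ n).1 i)
    refine le_trans (le_of_eq eLpNorm_one_eq_lintegral_enorm.symm) ?_
    exact eLpNorm_le_eLpNorm_of_exponent_le one_le_two ((hMm n (hAi i)).sub (hA i).1)
  · have t1 := (hA i).2.ne
    have t2 := (hA j).2.ne
    finiteness
  · set M := moll ((φ n).normed volume) (A i) with hM
    set N := moll ((φ n).normed volume) (A j) with hN
    set R := moll ((φ n).normed volume) (fun y => br E G (A i y) (A j y)) with hR
    have m1 : AEStronglyMeasurable M (cubeMeasure m) := hMm n (hAi i)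
    have m2 : AEStronglyMeasurable N (cubeMeasure m) := hMm n (hAi j)
    have mb := integrable_br G (hA i) (hA j)
    have m3 : AEStronglyMeasurable R (cubeMeasure m) := hMm n mb
    have s1 := (hφ n).1 i
    have s2 := (hφ n).1 j
    have s3 := (hφ n).2 i j
    rw [← hM] at s1
    rw [← hN] at s2
    rw [← hR] at s3
    have hle1 : (2⁻¹ : ℝ≥0∞) ^ n ≤ 1 := pow_le_one₀ (by simp) (by simp)
    have mbr : ∀ {f g : (Fin m → ℝ) → E}, AEStronglyMeasurable f (cubeMeasure m) →
        AEStronglyMeasurable g (cubeMeasure m) →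
        AEStronglyMeasurable (fun x => br E G (f x) (g x)) (cubeMeasure m) := fun hf hg =>
      (continuous_br E G).comp_aestronglyMeasurable (hf.prodMk hg)
    have b2 : eLpNorm N 2 (cubeMeasure m) ≤ eLpNorm (A j) 2 (cubeMeasure m) + 1 := by
      have : N = A j + (N - A j) := by abel
      rw [this]
      exact (eLpNorm_add_le (hA j).1 (m2.sub (hA j).1) one_le_two).trans
        (by gcongr; exact s2.trans hle1)
    have e : (fun x => br E G (M x) (N x) - R x) =
        (fun x => br E G ((M - A i) x) (N x)) + (fun x => br E G (A i x) ((N - A j) x)) -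
          (R - fun y => br E G (A i y) (A j y)) := by
      ext x
      simp only [Pi.sub_apply, Pi.add_apply, br_sub_left, br_sub_right]
      abel
    rw [← eLpNorm_one_eq_lintegral_enorm, e]
    refine (eLpNorm_sub_le ((mbr (m1.sub (hA i).1) m2).add (mbr (hA i).1 (m2.sub (hA j).1)))
      (m3.sub mb.1) le_rfl).trans ?_
    refine (add_le_add_left (eLpNorm_add_le (mbr (m1.sub (hA i).1) m2)
      (mbr (hA i).1 (m2.sub (hA j).1)) le_rfl) _).trans ?_
    have c1 := hC (M - A i) N (m1.sub (hA i).1) m2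
    have c2 := hC (A i) (N - A j) (hA i).1 (m2.sub (hA j).1)
    calc _ ≤ C * 2⁻¹ ^ n * (eLpNorm (A j) 2 (cubeMeasure m) + 1) +
          C * eLpNorm (A i) 2 (cubeMeasure m) * 2⁻¹ ^ n + 2⁻¹ ^ n := by
          gcongr
          · exact c1.trans (by gcongr)
          · exact c2.trans (by gcongr)
      _ = _ := by ring

end MollForm

/-! ### Flat forms have trivial holonomy -/

section Flat

open scoped ENNReal

variable {m : ℕ} {E : Type*} [NormedAddCommGroup E] [NormedSpace ℝ E] [FiniteDimensional ℝ E]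
  {G : Type*} [TopologicalSpace G] [ChartedSpace E G] [Group G] [LieGroup 𝓘(ℝ, E) ∞ G]
  [CompactSpace G] {V : Type*} [NormedAddCommGroup V] [NormedSpace ℝ V] [FiniteDimensional ℝ V]
  {ι : G → V}

variable (G) in
/-- Distributional flatness of a form with values in the model space `E`, which carries the Lie
bracket `br` of `G`. -/
def IsFlat (A : Fin m → (Fin m → ℝ) → E) : Prop :=
  ∀ (i j : Fin m) (φ : (Fin m → ℝ) → ℝ), IsTestFunction φ →
    ∫ x, (-(partialDeriv i φ x • A j x) + partialDeriv j φ x • A i x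
      + φ x • br E G (A i x) (A j x)) ∂(cubeMeasure m) = 0

/-- The curvature of the mollified form is the defect between the bracket of the mollifications and
the mollification of the bracket. -/
lemma IsFlat.fderiv_moll {A : Fin m → (Fin m → ℝ) → E} (h : IsFlat G A)
    (hA : ∀ i, MemLp (A i) 2 (cubeMeasure m)) {φ : (Fin m → ℝ) → ℝ} (hφ : ContDiff ℝ ∞ φ)
    (hφc : HasCompactSupport φ) {x : Fin m → ℝ} (hx : IsTestFunction (fun y => φ (x - y)))
    (i j : Fin m) :
    fderiv ℝ (moll φ (A j)) x (Pi.single i 1) - fderiv ℝ (moll φ (A i)) x (Pi.single j 1) =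
      - moll φ (fun y => br E G (A i y) (A j y)) x := by
  have hAi : ∀ i, Integrable (A i) (cubeMeasure m) := fun i => (hA i).integrable one_le_two
  have hI : ∀ i k, Integrable (fun y => fderiv ℝ φ (x - y) (Pi.single k 1) • A i y)
      (cubeMeasure m) := fun i k => integrable_smul_of_compact
    (ψ := fun y => fderiv ℝ φ y (Pi.single k 1))
    ((hφ.continuous_fderiv (by simp)).clm_apply continuous_const)
    ((hφc.fderiv ℝ).comp_left (g := fun T : (Fin m → ℝ) →L[ℝ] ℝ => T (Pi.single k 1)) rfl)
    (hAi i) x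
  have hB := integrable_smul_of_compact hφ.continuous hφc (integrable_br G (hA i) (hA j)) x
  have := h i j _ hx
  simp only [partialDeriv_comp_sub hφ, neg_smul, neg_neg] at this
  have hN : Integrable (fun y => -(fderiv ℝ φ (x - y) (Pi.single j 1) • A i y))
      (cubeMeasure m) := (hI i j).neg
  have hS : Integrable (fun y => fderiv ℝ φ (x - y) (Pi.single i 1) • A j y +
      -(fderiv ℝ φ (x - y) (Pi.single j 1) • A i y)) (cubeMeasure m) := (hI j i).add hN
  rw [integral_add hS hB, integral_add (hI j i) hN, integral_neg] at this
  rw [fderiv_moll_apply hφ hφc (hAi j), fderiv_moll_apply hφ hφc (hAi i), moll,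
    ← sub_eq_zero, sub_neg_eq_add, sub_eq_add_neg]
  exact this

/-- Transport along the `i`-th coordinate line through `x`, from the point with `i`-th coordinate
`c` to `x`. -/
noncomputable def lineTransport (ι : G → V) (f : (Fin m → ℝ) → E) (i : Fin m) (c : ℝ)
    (x : Fin m → ℝ) : G :=
  par ι (fun s => f (Function.update x i s)) c (x i)

lemma enorm_intervalIntegral_le {F : Type*} [NormedAddCommGroup F] [NormedSpace ℝ F]
    {g : ℝ → F} {α β : ℝ} (hα : 0 ≤ α) (hαβ : α ≤ β) (hβ : β ≤ 1) :
    ‖∫ s in α..β, g s‖ₑ ≤ ∫⁻ s, ‖g s‖ₑ ∂unitMeasure := by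
  rw [intervalIntegral.integral_of_le hαβ]
  refine (enorm_integral_le_lintegral_enorm _).trans (lintegral_mono' ?_ le_rfl)
  have hsub : Ioc α β ⊆ Icc (0 : ℝ) 1 := fun s hs => ⟨hα.trans hs.1.le, hs.2.trans hβ⟩
  exact Measure.restrict_mono hsub le_rfl

/-- The `i`-th coordinate line through `x` is good for the sequence `M` if `f` is integrable on it
and `M n` converges to `f` in its `L¹` space. -/
def GoodLine (M : ℕ → (Fin m → ℝ) → E) (f : (Fin m → ℝ) → E) (i : Fin m) (x : Fin m → ℝ) : Prop :=
  IntervalIntegrable (fun s => f (Function.update x i s)) volume 0 1 ∧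
    Tendsto (fun n => ∫ s in (0 : ℝ)..1, ‖M n (Function.update x i s) - f (Function.update x i s)‖)
      atTop (𝓝 0)

lemma ae_goodLine {M : ℕ → (Fin m → ℝ) → E} {f : (Fin m → ℝ) → E} (hf : Integrable f (cubeMeasure
    m))
    (hM : ∀ n, Continuous (M n)) (h : ∑' n, ∫⁻ x, ‖M n x - f x‖ₑ ∂(cubeMeasure m) ≠ ⊤) (i : Fin m) :
    ∀ᵐ x ∂(cubeMeasure m), GoodLine M f i x := by
  filter_upwards [ae_integrable_line hf i, ae_tendsto_lintegral_line
    (f := fun n x => M n x - f x) (fun n => (hM n).aestronglyMeasurable.sub hf.1) h i] with x h1 h2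
  exact ⟨integrable_unitMeasure_iff.1 h1, tendsto_intervalIntegral_norm h2⟩

lemma GoodLine.tendsto_gdist (hι : Manifold.IsSmoothEmbedding 𝓘(ℝ, E) 𝓘(ℝ, V) ∞ ι)
    {M : ℕ → (Fin m → ℝ) → E} {f : (Fin m → ℝ) → E} {i : Fin m} {x : Fin m → ℝ}
    (h : GoodLine M f i x) (hM : ∀ n, Continuous (M n)) {c : ℝ} (hc : c ∈ Icc (0 : ℝ) 1)
    (hx : x i ∈ Icc (0 : ℝ) 1) :
    Tendsto (fun n => gdist ι (lineTransport ι (M n) i c x) (lineTransport ι f i c x))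
      atTop (𝓝 0) := by
  obtain ⟨K, hK0, hK⟩ := exists_gdist_par_le (G := G) hι
  have h2 := h.2.const_mul K
  rw [mul_zero] at h2
  refine squeeze_zero (fun n => gdist_nonneg _ _) (fun n => ?_) h2
  refine hK _ _ c (x i) (Continuous.intervalIntegrable ?_ 0 1) h.1 hc hx
  exact (hM n).comp (continuous_const.update i continuous_id)

lemma eventually_mem_Icc_margin {t : ℝ} (ht : t ∈ Ioo (0 : ℝ) 1) :
    ∀ᶠ δ in 𝓝[>] (0 : ℝ), t ∈ Icc δ (1 - δ) := by
  filter_upwards [Ioo_mem_nhdsGT (lt_min ht.1 (sub_pos.2 ht.2))] with δ hδ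
  have h1 := hδ.2.trans_le (min_le_left _ _)
  have h2 := hδ.2.trans_le (min_le_right _ _)
  exact ⟨h1.le, by linarith⟩

/-- A form which is flat in the sense of distributions has trivial holonomy around almost every
coordinate rectangle. -/
lemma IsFlat.ae_lineTransport_comm (hι : Manifold.IsSmoothEmbedding 𝓘(ℝ, E) 𝓘(ℝ, V) ∞ ι)
    {A : Fin m → (Fin m → ℝ) → E} (h : IsFlat G A) (hA : ∀ i, MemLp (A i) 2 (cubeMeasure m))
    {i j : Fin m} (hij : i ≠ j) :
    ∀ᵐ z ∂(unitMeasure.prod (unitMeasure.prod (cubeMeasure m))),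
      lineTransport ι (A i) i z.2.1 (Function.update z.2.2 j z.1) *
        lineTransport ι (A j) j z.1 z.2.2 =
      lineTransport ι (A j) j z.1 (Function.update z.2.2 i z.2.1) *
        lineTransport ι (A i) i z.2.1 z.2.2 := by
  have hιc := hι.contMDiff.continuous
  have hAi : ∀ i, Integrable (A i) (cubeMeasure m) := fun i => (hA i).integrable one_le_two
  obtain ⟨φ, hφr, hφ1, hφ2⟩ := exists_moll_seq G hA
  set M : ℕ → Fin m → (Fin m → ℝ) → E := fun n i => moll ((φ n).normed volume) (A i) with hM
  set R : ℕ → (Fin m → ℝ) → E := fun n x => br E G (M n i x) (M n j x) -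
    moll ((φ n).normed volume) (fun y => br E G (A i y) (A j y)) x with hR
  have hMs : ∀ n i, ContDiff ℝ ∞ (M n i) := fun n i =>
    contDiff_moll (φ n).contDiff_normed (φ n).hasCompactSupport_normed (hAi i)
  have hMc : ∀ n i, Continuous (M n i) := fun n i => (hMs n i).continuous
  have hRc : ∀ n, Continuous (R n) := fun n =>
    ((continuous_br E G).comp ((hMc n i).prodMk (hMc n j))).sub
      (contDiff_moll (φ n).contDiff_normed (φ n).hasCompactSupport_normed
        (integrable_br G (hA i) (hA j))).continuous
  have g1 := ae_goodLine (hAi i) (fun n => hMc n i) (hφ1 i) i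
  have g2 := ae_goodLine (hAi j) (fun n => hMc n j) (hφ1 j) j
  have g3 := ae_tendsto_lintegral_plane (fun n => (hRc n).aestronglyMeasurable) (hφ2 i j) i j
  -- A point `z = (d, c, x)` stands for the rectangle with corners `x` and its image under setting
  -- the coordinates `i` and `j` to `c` and `d`.
  have q1 : Measure.QuasiMeasurePreserving (fun z : ℝ × ℝ × (Fin m → ℝ) => z.2)
      (unitMeasure.prod (unitMeasure.prod (cubeMeasure m))) (unitMeasure.prod (cubeMeasure m)) :=
    Measure.quasiMeasurePreserving_snd
  have q2 : Measure.QuasiMeasurePreserving (fun z : ℝ × ℝ × (Fin m → ℝ) => z.2.2)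
      (unitMeasure.prod (unitMeasure.prod (cubeMeasure m))) (cubeMeasure m) :=
    Measure.quasiMeasurePreserving_snd.comp q1
  have q3 : Measure.QuasiMeasurePreserving (fun z : ℝ × ℝ × (Fin m → ℝ) =>
      Function.update z.2.2 i z.2.1)
      (unitMeasure.prod (unitMeasure.prod (cubeMeasure m))) (cubeMeasure m) :=
    (measurePreserving_update i).quasiMeasurePreserving.comp q1
  have q4 : Measure.QuasiMeasurePreserving (fun z : ℝ × ℝ × (Fin m → ℝ) =>
      Function.update z.2.2 j z.1)
      (unitMeasure.prod (unitMeasure.prod (cubeMeasure m))) (cubeMeasure m) :=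
    (measurePreserving_update j).quasiMeasurePreserving.comp
      (MeasureTheory.QuasiMeasurePreserving.prodMap (Measure.QuasiMeasurePreserving.id _)
        Measure.quasiMeasurePreserving_snd)
  have q5 : Measure.QuasiMeasurePreserving (fun z : ℝ × ℝ × (Fin m → ℝ) => z.1)
      (unitMeasure.prod (unitMeasure.prod (cubeMeasure m))) unitMeasure :=
    Measure.quasiMeasurePreserving_fst
  have q6 : Measure.QuasiMeasurePreserving (fun z : ℝ × ℝ × (Fin m → ℝ) => z.2.1)
      (unitMeasure.prod (unitMeasure.prod (cubeMeasure m))) unitMeasure :=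
    Measure.quasiMeasurePreserving_fst.comp q1
  filter_upwards [q4.ae g1, q2.ae g1, q2.ae g2, q3.ae g2, q2.ae g3, q2.ae ae_mem_interior_cube,
    q5.ae ae_mem_Ioo, q6.ae ae_mem_Ioo]
  rintro ⟨d, c, x⟩ a1 a2 a3 a4 a5 a6 hd hc
  simp only at a1 a2 a3 a4 a5 a6 hd hc ⊢
  rw [mem_interior_cube] at a6
  -- A margin `δ` separating all relevant points from the boundary.
  obtain ⟨δ, hδ0, hδx, hδc, hδd⟩ : ∃ δ > 0, (∀ k, x k ∈ Icc δ (1 - δ)) ∧ c ∈ Icc δ (1 - δ) ∧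
      d ∈ Icc δ (1 - δ) := by
    obtain ⟨δ, ⟨⟨e1, e2⟩, e3⟩, e4⟩ := ((((eventually_all.2 fun k => eventually_mem_Icc_margin (a6
        k)).and
      (eventually_mem_Icc_margin hc)).and (eventually_mem_Icc_margin hd)).and
          (eventually_mem_nhdsWithin (a := (0 : ℝ)) (s := Ioi 0))).exists
    exact ⟨δ, e4, e1, e2, e3⟩
  have hc' : c ∈ Icc (0 : ℝ) 1 := ⟨hc.1.le, hc.2.le⟩
  have hd' : d ∈ Icc (0 : ℝ) 1 := ⟨hd.1.le, hd.2.le⟩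
  have hx' : ∀ k, x k ∈ Icc (0 : ℝ) 1 := fun k => ⟨(a6 k).1.le, (a6 k).2.le⟩
  have t1 := a1.tendsto_gdist hι (fun n => hMc n i) hc' (by simpa [hij] using hx' i)
  have t2 := a2.tendsto_gdist hι (fun n => hMc n i) hc' (hx' i)
  have t3 := a3.tendsto_gdist hι (fun n => hMc n j) hd' (hx' j)
  have t4 := a4.tendsto_gdist hι (fun n => hMc n j) hd' (by simpa [hij.symm] using hx' j)
  obtain ⟨K, hK0, hK⟩ := exists_holonomy_le (G := G) hι
  have t5 := ((ENNReal.tendsto_toReal ENNReal.zero_ne_top).comp a5).const_mul K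
  rw [ENNReal.toReal_zero, mul_zero] at t5
  refine eq_of_gdist_le_zero hιc hι.isEmbedding.injective ?_
  have tsum := ((t1.add t3).add t5).add (t4.add t2)
  simp only [add_zero] at tsum
  refine ge_of_tendsto tsum ?_
  filter_upwards [hφr.eventually_lt_const hδ0, a5.eventually_lt_const zero_lt_one] with n hn hn1
  have hα : δ ∈ Icc (0 : ℝ) 1 := ⟨hδ0.le, by linarith [hδc.1.trans hδc.2]⟩
  have hβ : 1 - δ ∈ Icc (0 : ℝ) 1 := ⟨by linarith [hα.2], by linarith⟩
  have hαβ : δ ≤ 1 - δ := hδc.1.trans hδc.2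
  have cu : Continuous (fun p : ℝ × ℝ => Function.update (Function.update x i p.1) j p.2) := by
    have : Continuous (fun p : ℝ × ℝ => Function.update x i p.1) :=
      continuous_const.update i continuous_fst
    exact this.update j continuous_snd
  have hol := hK (fun s t => M n i (Function.update (Function.update x i s) j t))
    (fun s t => M n j (Function.update (Function.update x i s) j t))
    (fun s t => fderiv ℝ (M n i) (Function.update (Function.update x i s) j t) (Pi.single j 1))
    (fun s t => fderiv ℝ (M n j) (Function.update (Function.update x i s) j t) (Pi.single i 1))
    ((hMc n i).comp cu) ((hMc n j).comp cu)
    ((((hMs n i).continuous_fderiv (by simp)).comp cu).clm_apply continuous_const)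
    ((((hMs n j).continuous_fderiv (by simp)).comp cu).clm_apply continuous_const)
    (fun s t => (((hMs n i).differentiable (by simp)) _).hasFDerivAt.comp_hasDerivAt t
      (hasDerivAt_update _ j t))
    (fun s t => by
      simp only [Function.update_comm hij]
      exact (((hMs n j).differentiable (by simp)) _).hasFDerivAt.comp_hasDerivAt s
        (hasDerivAt_update _ i s))
    δ hα (1 - δ) hβ c hδc (x i) (hδx i) d hδd (x j) (hδx j)
  -- Inside the margin, the curvature of the mollified form is `R n`.
  have hcurv : ∫ s in δ..1 - δ, ∫ t in δ..1 - δ,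
      ‖fderiv ℝ (M n j) (Function.update (Function.update x i s) j t) (Pi.single i 1) -
        fderiv ℝ (M n i) (Function.update (Function.update x i s) j t) (Pi.single j 1) +
        br E G (M n i (Function.update (Function.update x i s) j t))
          (M n j (Function.update (Function.update x i s) j t))‖ ≤
      (∫⁻ s, ∫⁻ t, ‖R n (Function.update (Function.update x i s) j t)‖ₑ
        ∂unitMeasure ∂unitMeasure).toReal := by
    have e : ∫ s in δ..1 - δ, ∫ t in δ..1 - δ,
      ‖fderiv ℝ (M n j) (Function.update (Function.update x i s) j t) (Pi.single i 1) -
        fderiv ℝ (M n i) (Function.update (Function.update x i s) j t) (Pi.single j 1) +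
        br E G (M n i (Function.update (Function.update x i s) j t))
          (M n j (Function.update (Function.update x i s) j t))‖ =
        ∫ s in δ..1 - δ, ∫ t in δ..1 - δ, ‖R n (Function.update (Function.update x i s) j t)‖ := by
      refine intervalIntegral.integral_congr fun s hs => intervalIntegral.integral_congr fun t ht
          => ?_
      rw [uIcc_of_le hαβ] at hs ht
      have htest : IsTestFunction (fun y => (φ n).normed volume
          (Function.update (Function.update x i s) j t - y)) := by
        refine isTestFunction_comp_sub (φ n).contDiff_normed (φ n).support_normed_eq.subset
          (fun k => ?_) hn
        by_cases hk : k = j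
        · subst hk; simpa using ht
        · by_cases hk' : k = i
          · subst hk'; simpa [hk] using hs
          · simpa [hk, hk'] using hδx k
      have := h.fderiv_moll hA (φ n).contDiff_normed (φ n).hasCompactSupport_normed htest i j
      simp only [hM, hR]
      rw [this]
      congr 1
      abel
    rw [e]
    refine (ENNReal.ofReal_le_iff_le_toReal (hn1.trans ENNReal.one_lt_top).ne).1 ?_
    refine (Real.ofReal_le_enorm _).trans
      ((enorm_intervalIntegral_le hα.1 hαβ hβ.2).trans (lintegral_mono fun s => ?_))
    refine (enorm_intervalIntegral_le hα.1 hαβ hβ.2).trans (lintegral_mono fun t => ?_)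
    simp
  have hL : par ι (fun s => M n i (Function.update (Function.update x i s) j d)) c (x i) *
      par ι (fun t => M n j (Function.update (Function.update x i (x i)) j t)) d (x j) =
      lineTransport ι (M n i) i c (Function.update x j d) * lineTransport ι (M n j) j d x := by
    simp only [lineTransport, Function.update_comm hij, Function.update_of_ne hij,
      Function.update_eq_self]
  have hR' : par ι (fun t => M n j (Function.update (Function.update x i c) j t)) d (x j) *
      par ι (fun s => M n i (Function.update (Function.update x i s) j (x j))) c (x i) =
      lineTransport ι (M n j) j d (Function.update x i c) * lineTransport ι (M n i) i c x := by
    have : ∀ s, Function.update (Function.update x i s) j (x j) = Function.update x i s := by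
      intro s; rw [Function.update_comm hij, Function.update_eq_self]
    simp only [lineTransport, this, Function.update_of_ne hij.symm]
  rw [hL, hR'] at hol
  refine (gdist_triangle hιc _ (lineTransport ι (M n i) i c (Function.update x j d) *
    lineTransport ι (M n j) j d x) _).trans ?_
  refine (add_le_add_right (gdist_triangle hιc _ (lineTransport ι (M n j) j d
    (Function.update x i c) * lineTransport ι (M n i) i c x) _) _).trans ?_
  rw [← add_assoc]
  refine add_le_add (add_le_add ?_ ?_) (gdist_mul_le hιc _ _ _ _)
  · rw [gdist_comm]; exact gdist_mul_le hιc _ _ _ _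
  · exact hol.trans (by simp only [Function.comp]; gcongr)

end Flat

/-! ### Gauge fixing -/

section Gauge

variable {m : ℕ}

/-- Acting on the last factor by `f`, with an additional random parameter in the first factor,
preserves null sets if `f` does. -/
lemma quasiMeasurePreserving_parallel {X Y : Type*} [MeasurableSpace X] [MeasurableSpace Y]
    {μ : Measure X} {ρ : Measure Y} [SFinite μ] [SFinite ρ] {f : ℝ × Y → Y}
    (hf : Measure.QuasiMeasurePreserving f (unitMeasure.prod ρ) ρ) :
    Measure.QuasiMeasurePreserving (fun z : ℝ × X × Y => (z.2.1, f (z.1, z.2.2)))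
      (unitMeasure.prod (μ.prod ρ)) (μ.prod ρ) := by
  have h1 : MeasurePreserving (fun z : ℝ × X × Y => ((z.1, z.2.1), z.2.2))
      (unitMeasure.prod (μ.prod ρ)) ((unitMeasure.prod μ).prod ρ) :=
    (measurePreserving_prodAssoc unitMeasure μ ρ).symm MeasurableEquiv.prodAssoc
  have h2 : MeasurePreserving (Prod.map Prod.swap id : (ℝ × X) × Y → (X × ℝ) × Y)
      ((unitMeasure.prod μ).prod ρ) ((μ.prod unitMeasure).prod ρ) :=
    Measure.measurePreserving_swap.prod (.id _)
  have h3 := measurePreserving_prodAssoc μ unitMeasure ρ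
  have h4 : Measure.QuasiMeasurePreserving (Prod.map (id : X → X) f)
      (μ.prod (unitMeasure.prod ρ)) (μ.prod ρ) :=
    MeasureTheory.QuasiMeasurePreserving.prodMap (.id _) hf
  exact h4.comp ((h3.comp h2).comp h1).quasiMeasurePreserving

/-- Gauge fixing. Here `P i c x` is the transport along the `i`-th line from the coordinate `c` to
`x`. Transports in the directions of `J` that compose along each line and commute around almost
every coordinate rectangle are the transition functions of a single map: transport first in a
hyperplane, where the map is given by induction, and then along the remaining direction. -/
lemma exists_gauge {G : Type*} [TopologicalSpace G] [Group G] [ContinuousMul G]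
    (J : Finset (Fin m)) : ∀ P : Fin m → ℝ → (Fin m → ℝ) → G,
    (∀ i ∈ J, AEStronglyMeasurable (fun z : ℝ × (Fin m → ℝ) => P i z.1 z.2)
      (unitMeasure.prod (cubeMeasure m))) →
    (∀ i ∈ J, ∀ x c d, P i d (Function.update x i c) * P i c x = P i d x) →
    (∀ i ∈ J, ∀ j ∈ J, i ≠ j → ∀ᵐ z ∂(unitMeasure.prod (unitMeasure.prod (cubeMeasure m))),
      P i z.2.1 (Function.update z.2.2 j z.1) * P j z.1 z.2.2 =
        P j z.1 (Function.update z.2.2 i z.2.1) * P i z.2.1 z.2.2) →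
    ∃ u : (Fin m → ℝ) → G, AEStronglyMeasurable u (cubeMeasure m) ∧
      ∀ i ∈ J, ∀ᵐ z ∂(unitMeasure.prod (cubeMeasure m)),
        u z.2 = u (Function.update z.2 i z.1) * P i z.1 z.2 := by
  induction J using Finset.induction_on with
  | empty => exact fun P _ _ _ => ⟨fun _ => 1, aestronglyMeasurable_const, by simp⟩
  | insert k J hk ih =>
    intro P hM hC hR
    have hkJ : k ∈ insert k J := Finset.mem_insert_self k J
    have hJ : ∀ i ∈ J, i ∈ insert k J := fun i hi => Finset.mem_insert_of_mem hi
    have hne : ∀ i ∈ J, i ≠ k := fun i hi h => hk (h ▸ hi)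
    have hU := (measurePreserving_update k).quasiMeasurePreserving
    have hU1 := quasiMeasurePreserving_parallel (μ := unitMeasure) hU
    have hU2 := quasiMeasurePreserving_parallel (μ := unitMeasure) hU1
    -- At a generic value `d` of the `k`-th coordinate, the transports in the other directions
    -- satisfy the hypotheses on the hyperplane `x k = d`, and commute with the transport from it.
    have d1 : ∀ᵐ d ∂unitMeasure, ∀ i ∈ J, AEStronglyMeasurable
        (fun z : ℝ × (Fin m → ℝ) => P i z.1 (Function.update z.2 k d))
        (unitMeasure.prod (cubeMeasure m)) := by
      rw [Finset.eventually_all]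
      exact fun i hi => ((hM i (hJ i hi)).comp_quasiMeasurePreserving hU1).prodMk_left
    have d2 : ∀ᵐ d ∂unitMeasure, ∀ i ∈ J, ∀ j ∈ J, i ≠ j →
        ∀ᵐ z ∂(unitMeasure.prod (unitMeasure.prod (cubeMeasure m))),
        P i z.2.1 (Function.update (Function.update z.2.2 j z.1) k d) *
          P j z.1 (Function.update z.2.2 k d) =
        P j z.1 (Function.update (Function.update z.2.2 i z.2.1) k d) *
          P i z.2.1 (Function.update z.2.2 k d) := by
      rw [Finset.eventually_all]
      intro i hi
      rw [Finset.eventually_all]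
      intro j hj
      by_cases hij : i = j
      · exact .of_forall fun _ h => absurd hij h
      filter_upwards [Measure.ae_ae_of_ae_prod (hU2.ae (hR i (hJ i hi) j (hJ j hj) hij))]
        with d hd _
      filter_upwards [hd] with z hz
      rw [Function.update_comm (hne i hi), Function.update_comm (hne j hj)]
      exact hz
    have d3 : ∀ᵐ d ∂unitMeasure, ∀ i ∈ J, ∀ᵐ z ∂(unitMeasure.prod (cubeMeasure m)),
        P i z.1 (Function.update z.2 k d) * P k d z.2 =
          P k d (Function.update z.2 i z.1) * P i z.1 z.2 := by
      rw [Finset.eventually_all]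
      exact fun i hi => Measure.ae_ae_of_ae_prod (hR i (hJ i hi) k hkJ (hne i hi))
    have d4 : ∀ᵐ d ∂unitMeasure, AEStronglyMeasurable (fun x => P k d x) (cubeMeasure m) :=
      (hM k hkJ).prodMk_left
    obtain ⟨d, e1, e2, e3, e4⟩ := (d1.and (d2.and (d3.and d4))).exists
    obtain ⟨w, hw, hwP⟩ := ih (fun i c x => P i c (Function.update x k d)) e1
      (fun i hi x c d' => by
        rw [Function.update_comm (hne i hi)]
        exact hC i (hJ i hi) _ c d') e2
    -- The map `w` given by induction is a map on the hyperplane, but only up to null sets; freezing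
    -- its `k`-th coordinate at a generic value `e` makes it independent of this coordinate.
    have f1 : ∀ᵐ e ∂unitMeasure, ∀ i ∈ J, ∀ᵐ z ∂(unitMeasure.prod (cubeMeasure m)),
        w (Function.update z.2 k e) = w (Function.update (Function.update z.2 i z.1) k e) *
          P i z.1 (Function.update z.2 k d) := by
      rw [Finset.eventually_all]
      intro i hi
      filter_upwards [Measure.ae_ae_of_ae_prod (hU1.ae (hwP i hi))] with e he
      filter_upwards [he] with z hz
      rw [Function.update_comm (hne i hi)]
      simpa using hz
    have f2 : ∀ᵐ e ∂unitMeasure, AEStronglyMeasurable (fun x => w (Function.update x k e))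
        (cubeMeasure m) := (hw.comp_quasiMeasurePreserving hU).prodMk_left
    obtain ⟨e, g1, g2⟩ := (f1.and f2).exists
    refine ⟨fun x => w (Function.update x k e) * P k d x, g2.mul e4, fun i hi => ?_⟩
    rcases Finset.mem_insert.1 hi with rfl | hi
    · refine .of_forall fun z => ?_
      simp only [Function.update_idem, mul_assoc, hC _ hkJ]
    · filter_upwards [g1 i hi, e3 i hi] with z h1 h2
      rw [h1, mul_assoc, h2, mul_assoc]

/-- A map that does not depend, up to null sets, on any of the coordinates is constant almost
everywhere. -/
lemma ae_eq_const_of_ae_update {Y : Type*} {w : (Fin m → ℝ) → Y}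
    (hw : ∀ i, ∀ᵐ z ∂(unitMeasure.prod (cubeMeasure m)), w z.2 = w (Function.update z.2 i z.1)) :
    ∃ g, ∀ᵐ x ∂(cubeMeasure m), w x = g := by
  -- The coordinates in `J` are replaced one at a time by generic constants.
  have key : ∀ J : Finset (Fin m), ∃ y : Fin m → ℝ,
      ∀ᵐ x ∂(cubeMeasure m), w x = w (J.piecewise y x) := by
    intro J
    induction J using Finset.induction_on with
    | empty => exact ⟨0, by simp⟩
    | insert k J hk ih =>
      obtain ⟨y, hy⟩ := ih
      obtain ⟨c, h1, h2⟩ := ((Measure.ae_ae_of_ae_prod (hw k)).and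
        (Measure.ae_ae_of_ae_prod (ae_update hy k))).exists
      refine ⟨Function.update y k c, ?_⟩
      filter_upwards [h1, h2] with x a1 a2
      rw [a1, a2]
      congr 1
      ext j
      by_cases hj : j = k
      · subst hj; simp [hk]
      · by_cases hjJ : j ∈ J <;> simp [hj, hjJ]
  obtain ⟨y, hy⟩ := key Finset.univ
  exact ⟨w y, by simpa using hy⟩

end Gauge

section Measurability

variable {m : ℕ} {E : Type*} [NormedAddCommGroup E] [NormedSpace ℝ E] [FiniteDimensional ℝ E]
  {G : Type*} [TopologicalSpace G] [ChartedSpace E G] [Group G] [LieGroup 𝓘(ℝ, E) ∞ G]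
  [CompactSpace G] {V : Type*} [NormedAddCommGroup V] [NormedSpace ℝ V] [FiniteDimensional ℝ V]
  {ι : G → V}

/-- Convergence in `gdist` is convergence in `G`. -/
lemma tendsto_of_tendsto_gdist (hι : Manifold.IsSmoothEmbedding 𝓘(ℝ, E) 𝓘(ℝ, V) ∞ ι)
    {X : Type*} {l : Filter X} {g : X → G} {g₀ : G}
    (h : Tendsto (fun x => gdist ι (g x) g₀) l (𝓝 0)) : Tendsto g l (𝓝 g₀) := by
  rw [hι.isEmbedding.tendsto_nhds_iff, tendsto_iff_norm_sub_tendsto_zero]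
  exact squeeze_zero (fun _ => norm_nonneg _)
    (fun _ => norm_sub_le_gdist' hι.contMDiff.continuous _ _) h

lemma continuousOn_lineTransport (hι : Manifold.IsSmoothEmbedding 𝓘(ℝ, E) 𝓘(ℝ, V) ∞ ι)
    {f : (Fin m → ℝ) → E} (hf : Continuous f) (i : Fin m) :
    ContinuousOn (fun z : ℝ × (Fin m → ℝ) => lineTransport ι f i z.1 z.2)
      (Icc 0 1 ×ˢ cube m) := by
  have := topologicalGroup_of_lieGroup 𝓘(ℝ, E) ∞ (G := G)
  have hιc := hι.contMDiff.continuous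
  obtain ⟨K, hK0, hK⟩ := exists_gdist_par_le (G := G) hι
  have hl : ∀ x, Continuous (fun s => f (Function.update x i s)) := fun x =>
    hf.comp (continuous_const.update i continuous_id)
  rintro ⟨c₀, x₀⟩ ⟨hc₀, hx₀⟩
  have hii := (hl x₀).intervalIntegrable (μ := volume) 0 1
  refine tendsto_of_tendsto_gdist hι ?_
  have t1 : Tendsto (fun z : ℝ × (Fin m → ℝ) => K * ∫ τ in (0 : ℝ)..1,
      ‖f (Function.update z.2 i τ) - f (Function.update x₀ i τ)‖)
      (𝓝[Icc 0 1 ×ˢ cube m] (c₀, x₀)) (𝓝 0) := by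
    refine (Continuous.tendsto' (continuous_const.mul
      (intervalIntegral.continuous_parametric_intervalIntegral_of_continuous' ?_ 0 1)) _ _
        (by simp)).mono_left nhdsWithin_le_nhds
    have h1 : Continuous (fun p : (ℝ × (Fin m → ℝ)) × ℝ => Function.update p.1.2 i p.2) :=
      (continuous_snd.comp continuous_fst).update i continuous_snd
    exact ((hf.comp h1).sub ((hl x₀).comp continuous_snd)).norm
  have t2 : Tendsto (fun z : ℝ × (Fin m → ℝ) => gdist ι
      (par ι (fun s => f (Function.update x₀ i s)) z.1 (z.2 i))
      (par ι (fun s => f (Function.update x₀ i s)) c₀ (x₀ i)))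
      (𝓝[Icc 0 1 ×ˢ cube m] (c₀, x₀)) (𝓝 0) := by
    have hS := (isSol_trans hι hii).cont
    have e1 : ContinuousOn (fun z : ℝ × (Fin m → ℝ) =>
        par ι (fun s => f (Function.update x₀ i s)) z.1 (z.2 i)) (Icc 0 1 ×ˢ cube m) :=
      (hS.comp continuousOn_fst fun z hz => hz.1).inv.mul
        (hS.comp ((continuous_apply i).comp continuous_snd).continuousOn
          fun z hz => ⟨hz.2.1 i, hz.2.2 i⟩)
    have e2 := (continuous_gdist hι).continuousAt.tendsto.comp
      ((e1 (c₀, x₀) ⟨hc₀, hx₀⟩).tendsto.prodMk_nhds (tendsto_const_nhds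
        (x := par ι (fun s => f (Function.update x₀ i s)) c₀ (x₀ i))))
    simpa only [gdist_self, Function.comp_def] using e2
  have t3 := t1.add t2
  rw [add_zero] at t3
  refine squeeze_zero' (.of_forall fun _ => gdist_nonneg _ _) ?_ t3
  filter_upwards [self_mem_nhdsWithin] with z hz
  refine (gdist_triangle hιc _ (par ι (fun s => f (Function.update x₀ i s)) z.1 (z.2 i)) _).trans
    (add_le_add ?_ le_rfl)
  exact hK _ _ _ _ ((hl z.2).intervalIntegrable 0 1) hii hz.1 ⟨hz.2.1 i, hz.2.2 i⟩

/-- The line transports of an integrable function are measurable, as limits almost everywhere of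
those of continuous functions. -/
lemma aestronglyMeasurable_lineTransport (hι : Manifold.IsSmoothEmbedding 𝓘(ℝ, E) 𝓘(ℝ, V) ∞ ι)
    {M : ℕ → (Fin m → ℝ) → E} {f : (Fin m → ℝ) → E} (hf : Integrable f (cubeMeasure m))
    (hM : ∀ n, Continuous (M n)) (h : ∑' n, ∫⁻ x, ‖M n x - f x‖ₑ ∂(cubeMeasure m) ≠ ⊤) (i : Fin m) :
    AEStronglyMeasurable (fun z : ℝ × (Fin m → ℝ) => lineTransport ι f i z.1 z.2)
      (unitMeasure.prod (cubeMeasure m)) := by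
  have hιc := hι.contMDiff.continuous
  have : TopologicalSpace.PseudoMetrizableSpace G := hι.isEmbedding.isInducing.pseudoMetrizableSpace
  rw [← hι.isEmbedding.aestronglyMeasurable_comp_iff]
  refine aestronglyMeasurable_of_tendsto_ae atTop
    (f := fun n z => ι (lineTransport ι (M n) i z.1 z.2)) (fun n => ?_) ?_
  · rw [unitMeasure, cubeMeasure, Measure.prod_restrict]
    exact (hιc.comp_continuousOn (continuousOn_lineTransport hι (hM n) i)).aestronglyMeasurable
      (measurableSet_Icc.prod measurableSet_cube)
  · have q1 : Measure.QuasiMeasurePreserving (fun z : ℝ × (Fin m → ℝ) => z.2)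
      (unitMeasure.prod (cubeMeasure m)) (cubeMeasure m) := Measure.quasiMeasurePreserving_snd
    have q2 : Measure.QuasiMeasurePreserving (fun z : ℝ × (Fin m → ℝ) => z.1)
      (unitMeasure.prod (cubeMeasure m)) unitMeasure := Measure.quasiMeasurePreserving_fst
    filter_upwards [q1.ae (ae_goodLine hf hM h i), q1.ae ae_mem_interior_cube, q2.ae ae_mem_Ioo]
      with z h1 h2 h3
    have hx := mem_interior_cube.1 h2 i
    exact (hιc.tendsto _).comp (tendsto_of_tendsto_gdist hι
      (h1.tendsto_gdist hι hM ⟨h3.1.le, h3.2.le⟩ ⟨hx.1.le, hx.2.le⟩))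

/-- For a flat form there is a measurable map that follows its transports on almost every coordinate
line. -/
lemma IsFlat.exists_gauge (hι : Manifold.IsSmoothEmbedding 𝓘(ℝ, E) 𝓘(ℝ, V) ∞ ι)
    {A : Fin m → (Fin m → ℝ) → E} (h : IsFlat G A) (hA : ∀ i, MemLp (A i) 2 (cubeMeasure m)) :
    ∃ u : (Fin m → ℝ) → G, AEStronglyMeasurable u (cubeMeasure m) ∧
      ∀ i, ∀ᵐ z ∂(unitMeasure.prod (cubeMeasure m)),
        u z.2 = u (Function.update z.2 i z.1) * lineTransport ι (A i) i z.1 z.2 := by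
  have := topologicalGroup_of_lieGroup 𝓘(ℝ, E) ∞ (G := G)
  obtain ⟨φ, -, hφ, -⟩ := exists_moll_seq G hA
  have hAi : ∀ i, Integrable (A i) (cubeMeasure m) := fun i => (hA i).integrable one_le_two
  obtain ⟨u, hu, huP⟩ := FlatForms.exists_gauge Finset.univ
    (fun i c x => lineTransport ι (A i) i c x)
    (fun i _ => aestronglyMeasurable_lineTransport hι (hAi i)
      (fun n => (contDiff_moll (φ n).contDiff_normed (φ n).hasCompactSupport_normed
        (hAi i)).continuous) (hφ i) i)
    (fun i _ x c d => by
      simp only [lineTransport, Function.update_idem, Function.update_self, par_mul_par])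
    (fun i _ j _ hij => h.ae_lineTransport_comm hι hA hij)
  exact ⟨u, hu, fun i => huP i (Finset.mem_univ i)⟩

end Measurability

/-! ### Weak derivatives of maps that follow the transports -/

section WeakDerivative

variable {m : ℕ} {E : Type*} [NormedAddCommGroup E] [NormedSpace ℝ E] [FiniteDimensional ℝ E]
  {G : Type*} [TopologicalSpace G] [ChartedSpace E G] [Group G] [LieGroup 𝓘(ℝ, E) ∞ G]
  [CompactSpace G] {V : Type*} [NormedAddCommGroup V] [NormedSpace ℝ V] [FiniteDimensional ℝ V]
  {ι : G → V}

lemma HasLogDerivAt.const_mul {γ : ℝ → G} {a : E} {τ : ℝ} (h : HasLogDerivAt γ a τ) (g : G) :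
    HasLogDerivAt (fun t => g * γ t) a τ := by
  have := topologicalGroup_of_lieGroup 𝓘(ℝ, E) ∞ (G := G)
  refine ⟨continuousAt_const.mul h.1, ?_⟩
  simpa [mul_assoc] using h.2

lemma integral_update {F : Type*} [NormedAddCommGroup F] [NormedSpace ℝ F] {h : (Fin m → ℝ) → F}
    (hh : Integrable h (cubeMeasure m)) (i : Fin m) :
    ∫ x, ∫ s, h (Function.update x i s) ∂unitMeasure ∂(cubeMeasure m) =
      ∫ x, h x ∂(cubeMeasure m) := by
  have hmp := measurePreserving_update i
  have h1 := hmp.integrable_comp_of_integrable hh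
  refine (integral_prod_symm _ h1).symm.trans ?_
  have h2 := integral_map (μ := unitMeasure.prod (cubeMeasure m)) hmp.aemeasurable (f := h)
    (by rw [hmp.map_eq]; exact hh.1)
  rw [hmp.map_eq] at h2
  exact h2.symm

/-- Integration by parts along one line: the derivative of `ψ • f` along a translate of a solution
has integral `0` if `ψ` vanishes at both ends. -/
lemma integral_by_parts_line (hι : Manifold.IsSmoothEmbedding 𝓘(ℝ, E) 𝓘(ℝ, V) ∞ ι) {f : G → V}
    (hf : ContMDiff 𝓘(ℝ, E) 𝓘(ℝ, V) ∞ f) (hfd : ∀ g h, ‖f g - f h‖ ≤ gdist ι g h)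
    {a : ℝ → E} (ha : IntervalIntegrable a volume 0 1) (g : G) {ψ ψ' : ℝ → ℝ}
    (hψ : ∀ τ, HasDerivAt ψ (ψ' τ) τ) (hψ' : Continuous ψ') (h0 : ψ 0 = 0) (h1 : ψ 1 = 0) :
    ∫ τ in (0 : ℝ)..1, (ψ' τ • f (g * trans ι a τ) +
      ψ τ • leftDeriv (E := E) f (g * trans ι a τ) (a τ)) = 0 := by
  have hιc := hι.contMDiff.continuous
  obtain ⟨C, hC0, hC⟩ := exists_gdist_isSol_le (G := G) hι
  obtain ⟨K, hK0, hK⟩ := exists_bound_leftDeriv (E := E) hf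
  obtain ⟨Bf, hBf⟩ := (isCompact_univ (X := G)).exists_bound_of_continuousOn
    hf.continuous.continuousOn
  have hBf0 : 0 ≤ Bf := (norm_nonneg _).trans (hBf 1 (mem_univ _))
  have hψc : Continuous ψ := continuous_iff_continuousAt.2 fun τ => (hψ τ).continuousAt
  obtain ⟨B, hB⟩ := isCompact_Icc.exists_bound_of_continuousOn (hψc.continuousOn (s := Icc 0 1))
  obtain ⟨B', hB'⟩ := isCompact_Icc.exists_bound_of_continuousOn (hψ'.continuousOn (s := Icc 0 1))
  have hB0 : 0 ≤ B := (norm_nonneg _).trans (hB 0 (by simp))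
  have hB'0 : 0 ≤ B' := (norm_nonneg _).trans (hB' 0 (by simp))
  have hS := isSol_trans (G := G) hι ha
  have hint : ∀ k : ℝ, IntervalIntegrable (fun τ => B' * Bf + k * ‖a τ‖) volume 0 1 := fun k =>
    intervalIntegrable_const.add (ha.norm.const_mul k)
  have main := sub_eq_integral_of_ae_hasDerivAt (s := 0) (t := 1)
    (Φ := fun τ => ψ τ • f (g * trans ι a τ))
    (φ := fun τ => ψ' τ • f (g * trans ι a τ) + ψ τ • leftDeriv (E := E) f (g * trans ι a τ) (a τ))
    zero_le_one (hint (B * C)) (hint (B * K)) ?_ ?_ ?_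
  · rw [← main.2, h0, h1]; simp
  · intro x hx y hy hxy
    have hsub := uIcc_subset_uIcc_zero_one hx hy
    rw [intervalIntegral.integral_add intervalIntegrable_const
      ((ha.norm.const_mul _).mono_set hsub)]
    have e : ψ y • f (g * trans ι a y) - ψ x • f (g * trans ι a x) =
        (ψ y - ψ x) • f (g * trans ι a y) +
          ψ x • (f (g * trans ι a y) - f (g * trans ι a x)) := by
      rw [sub_smul, smul_sub]; abel
    rw [e]
    refine (norm_add_le _ _).trans (add_le_add ?_ ?_)
    · rw [norm_smul]
      have hl := (convex_Icc (0 : ℝ) 1).norm_image_sub_le_of_norm_hasDerivWithin_le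
        (f := ψ) (f' := ψ') (fun z _ => (hψ z).hasDerivWithinAt) hB' hx hy
      calc _ ≤ B' * ‖y - x‖ * Bf := by gcongr; exact hBf _ (mem_univ _)
        _ = _ := by
          rw [Real.norm_of_nonneg (sub_nonneg.2 hxy), intervalIntegral.integral_const, smul_eq_mul]
          ring
    · rw [norm_smul, intervalIntegral.integral_const_mul, mul_assoc]
      gcongr
      · exact hB x hx
      · refine (hfd _ _).trans ?_
        rw [gdist_mul_left hιc]
        exact hC a _ hS ha x hx y hy hxy
  · filter_upwards [hS.ae_hasLogDerivAt hι ha] with τ hτ hm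
    have := (hψ τ).smul (((hτ hm).const_mul g).hasDerivAt hf)
    rw [add_comm] at this
    exact this
  · refine .of_forall fun τ hτ => (norm_add_le _ _).trans ?_
    rw [norm_smul, norm_smul, mul_assoc B]
    gcongr
    · exact hB' τ hτ
    · exact hBf _ (mem_univ _)
    · exact hB τ hτ
    · exact (ContinuousLinearMap.le_opNorm _ _).trans (by gcongr; exact hK _)

/-- A measurable map that follows the transports of `A` on almost every line has, in every smooth
coordinate `f` of the group, the weak derivative prescribed by `A`. -/
lemma hasWeakPartialDeriv_of_ae_eq (hι : Manifold.IsSmoothEmbedding 𝓘(ℝ, E) 𝓘(ℝ, V) ∞ ι) {f : G → V}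
    (hf : ContMDiff 𝓘(ℝ, E) 𝓘(ℝ, V) ∞ f) (hfd : ∀ g h, ‖f g - f h‖ ≤ gdist ι g h)
    {A : (Fin m → ℝ) → E} (hA : Integrable A (cubeMeasure m)) {u : (Fin m → ℝ) → G}
    (hu : AEStronglyMeasurable u (cubeMeasure m)) {i : Fin m}
    (hP : ∀ᵐ z ∂(unitMeasure.prod (cubeMeasure m)),
        u z.2 = u (Function.update z.2 i z.1) * lineTransport ι A i z.1 z.2) :
    HasWeakPartialDeriv i (fun x => f (u x)) (fun x => leftDeriv (E := E) f (u x) (A x)) := by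
  obtain ⟨Bf, hBf⟩ := (isCompact_univ (X := G)).exists_bound_of_continuousOn
    hf.continuous.continuousOn
  have hfu : Integrable (fun x => f (u x)) (cubeMeasure m) :=
    Integrable.of_bound (hf.continuous.comp_aestronglyMeasurable hu) Bf
      (.of_forall fun x => hBf _ (mem_univ _))
  have hg : Integrable (fun x => leftDeriv (E := E) f (u x) (A x)) (cubeMeasure m) :=
    integrable_leftDeriv_apply hf ((continuous_leftDeriv hf).comp_aestronglyMeasurable hu) hA
  have hloc : ∀ h : (Fin m → ℝ) → V, Integrable h (cubeMeasure m) →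
      LocallyIntegrableOn h (interior (cube m)) := fun h hh =>
    (IntegrableOn.mono_set (hh : IntegrableOn h (cube m) volume)
      interior_subset).locallyIntegrableOn
  refine ⟨hloc _ hfu, hloc _ hg, fun φ hφ => ?_⟩
  have hd : Continuous (fderiv ℝ φ) := hφ.smooth.continuous_fderiv (by simp)
  have hdi : Continuous (fun x => partialDeriv i φ x) := hd.clm_apply continuous_const
  obtain ⟨B, hB⟩ := hφ.smooth.continuous.bounded_above_of_compact_support hφ.compact
  obtain ⟨B', hB'⟩ := hdi.bounded_above_of_compact_support ((hφ.compact.fderiv ℝ).comp_left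
    (g := fun T : (Fin m → ℝ) →L[ℝ] ℝ => T (Pi.single i 1)) rfl)
  have i1 : Integrable (fun x => partialDeriv i φ x • f (u x)) (cubeMeasure m) :=
    hfu.bdd_smul B' hdi.aestronglyMeasurable (.of_forall hB')
  have i2 : Integrable (fun x => φ x • leftDeriv (E := E) f (u x) (A x)) (cubeMeasure m) :=
    hg.bdd_smul B hφ.smooth.continuous.aestronglyMeasurable (.of_forall hB)
  rw [eq_neg_iff_add_eq_zero, ← integral_add i1 i2]
  refine (integral_update (i1.add i2) i).symm.trans ?_
  -- On almost every line, `u` is a fixed left translate of one solution.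
  obtain ⟨c, hc⟩ := (Measure.ae_ae_of_ae_prod hP).exists
  rw [← integral_zero (Fin m → ℝ) V (μ := cubeMeasure m)]
  refine integral_congr_ae ?_
  filter_upwards [ae_ae_update hc i, ae_integrable_line hA i] with x hx hxi
  rw [integrable_unitMeasure_iff] at hxi
  set a : ℝ → E := fun s => A (Function.update x i s)
  have hz : ∀ s, s ∉ Ioo (0 : ℝ) 1 → φ (Function.update x i s) = 0 := by
    intro s hs
    by_contra hne
    have := mem_interior_cube.1 (hφ.support (subset_closure hne)) i
    simp only [Function.update_self] at this
    exact hs this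
  have key := integral_by_parts_line hι hf hfd hxi
    (u (Function.update x i c) * (trans ι a c)⁻¹)
    (ψ := fun s => φ (Function.update x i s)) (ψ' := fun s => partialDeriv i φ (Function.update x i
        s))
    (fun s => ((hφ.smooth.differentiable (by simp)) _).hasFDerivAt.comp_hasDerivAt s
      (hasDerivAt_update _ i s))
    (hdi.comp (continuous_const.update i continuous_id)) (hz 0 (by simp)) (hz 1 (by simp))
  rw [integral_interval_eq] at key
  rw [← key]
  refine integral_congr_ae ?_
  filter_upwards [hx] with s hs
  rw [Function.update_idem, lineTransport, Function.update_self, par, ← mul_assoc] at hs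
  simp only [Function.update_idem] at hs
  simp only [Pi.add_apply]
  rw [hs]

/-- A measurable map that follows the transports of an `L²` form belongs to the Sobolev space in
every smooth coordinate `f`. -/
lemma memW12_of_ae_eq (hι : Manifold.IsSmoothEmbedding 𝓘(ℝ, E) 𝓘(ℝ, V) ∞ ι) {f : G → V}
    (hf : ContMDiff 𝓘(ℝ, E) 𝓘(ℝ, V) ∞ f) (hfd : ∀ g h, ‖f g - f h‖ ≤ gdist ι g h)
    {A : Fin m → (Fin m → ℝ) → E} (hA : ∀ i, MemLp (A i) 2 (cubeMeasure m)) {u : (Fin m → ℝ) → G}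
    (hu : AEStronglyMeasurable u (cubeMeasure m))
    (hP : ∀ i, ∀ᵐ z ∂(unitMeasure.prod (cubeMeasure m)),
        u z.2 = u (Function.update z.2 i z.1) * lineTransport ι (A i) i z.1 z.2) :
    MemW12 (fun x => f (u x)) := by
  obtain ⟨Bf, hBf⟩ := (isCompact_univ (X := G)).exists_bound_of_continuousOn
    hf.continuous.continuousOn
  obtain ⟨K, hK0, hK⟩ := exists_bound_leftDeriv (E := E) hf
  refine ⟨MemLp.of_bound (hf.continuous.comp_aestronglyMeasurable hu) Bf
      (.of_forall fun x => hBf _ (mem_univ _)), fun i => ⟨fun x => leftDeriv (E := E) f (u x) (A i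
          x), ?_,
    hasWeakPartialDeriv_of_ae_eq hι hf hfd ((hA i).integrable one_le_two) hu (hP i)⟩⟩
  refine MemLp.of_le_mul (c := K) (hA i) ?_ (.of_forall fun x => ?_)
  · exact (integrable_leftDeriv_apply hf ((continuous_leftDeriv hf).comp_aestronglyMeasurable hu)
      ((hA i).integrable one_le_two)).1
  · exact (ContinuousLinearMap.le_opNorm _ _).trans (by gcongr; exact hK _)

end WeakDerivative

/-! ### Maps with a weak logarithmic derivative follow the transports -/

section Converse

open scoped ENNReal

variable {m : ℕ} {E : Type*} [NormedAddCommGroup E] [NormedSpace ℝ E] [FiniteDimensional ℝ E]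
  {G : Type*} [TopologicalSpace G] [ChartedSpace E G] [Group G] [LieGroup 𝓘(ℝ, E) ∞ G]
  [CompactSpace G] {V : Type*} [NormedAddCommGroup V] [NormedSpace ℝ V] [FiniteDimensional ℝ V]
  {ι : G → V}

/-- Mollifications of two integrable functions that converge fast in `L¹`. -/
lemma exists_moll_seq_pair {f g : (Fin m → ℝ) → V} (hf : Integrable f (cubeMeasure m))
    (hg : Integrable g (cubeMeasure m)) :
    ∃ φ : ℕ → ContDiffBump (0 : Fin m → ℝ), Tendsto (fun n => (φ n).rOut) atTop (𝓝 0) ∧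
      (∑' n, ∫⁻ x, ‖moll ((φ n).normed volume) f x - f x‖ₑ ∂(cubeMeasure m) ≠ ⊤) ∧
      ∑' n, ∫⁻ x, ‖moll ((φ n).normed volume) g x - g x‖ₑ ∂(cubeMeasure m) ≠ ⊤ := by
  have h2 : ∀ n : ℕ, (0 : ℝ≥0∞) < 2⁻¹ ^ n := fun n => ENNReal.pow_pos (by simp) n
  obtain ⟨φ, hφ, hφr⟩ := exists_bump_seq (m := m) (Q := fun n φ =>
    eLpNorm (moll (φ.normed volume) f - f) 1 (cubeMeasure m) ≤ 2⁻¹ ^ n ∧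
    eLpNorm (moll (φ.normed volume) g - g) 1 (cubeMeasure m) ≤ 2⁻¹ ^ n) (fun n => by
    filter_upwards [eventually_eLpNorm_moll_sub_le le_rfl (by simp)
      (memLp_one_iff_integrable.2 hf) (h2 n), eventually_eLpNorm_moll_sub_le le_rfl (by simp)
      (memLp_one_iff_integrable.2 hg) (h2 n)] with δ a1 a2 φ hφ using ⟨a1 φ hφ, a2 φ hφ⟩)
  have hfin : ∀ a : ℕ → ℝ≥0∞, (∀ n, a n ≤ 2⁻¹ ^ n) → ∑' n, a n ≠ ⊤ := by
    intro a h
    refine ne_top_of_le_ne_top ?_ (ENNReal.tsum_le_tsum h)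
    rw [ENNReal.tsum_geometric, ENNReal.inv_ne_top]
    exact (tsub_pos_of_lt (ENNReal.inv_lt_one.2 ENNReal.one_lt_two)).ne'
  simp only [eLpNorm_one_eq_lintegral_enorm] at hφ
  exact ⟨φ, hφr, hfin _ fun n => (hφ n).1, hfin _ fun n => (hφ n).2⟩

/-- A function with an integrable weak derivative is, on almost every line, the primitive of
that derivative. -/
lemma HasWeakPartialDeriv.ae_eq_add_integral {f g : (Fin m → ℝ) → V}
    (hf : Integrable f (cubeMeasure m)) (hg : Integrable g (cubeMeasure m)) {i : Fin m}
    (h : HasWeakPartialDeriv i f g) :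
    ∀ᵐ z ∂(unitMeasure.prod (cubeMeasure m)), f z.2 = f (Function.update z.2 i z.1) +
      ∫ s in z.1..z.2 i, g (Function.update z.2 i s) := by
  have : CompleteSpace V := FiniteDimensional.complete ℝ V
  obtain ⟨φ, hφr, hφf, hφg⟩ := exists_moll_seq_pair hf hg
  set M : ℕ → (Fin m → ℝ) → V := fun n => moll ((φ n).normed volume) f with hM
  set N : ℕ → (Fin m → ℝ) → V := fun n => moll ((φ n).normed volume) g with hN
  have hMs : ∀ n, ContDiff ℝ ∞ (M n) := fun n =>
    contDiff_moll (φ n).contDiff_normed (φ n).hasCompactSupport_normed hf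
  have hNc : ∀ n, Continuous (N n) := fun n =>
    (contDiff_moll (φ n).contDiff_normed (φ n).hasCompactSupport_normed hg).continuous
  have p1 : ∀ᵐ x ∂(cubeMeasure m), Tendsto (fun n => M n x) atTop (𝓝 (f x)) := by
    filter_upwards [ae_tendsto_zero_of_tsum_lintegral
      (fun n => ((hMs n).continuous.aestronglyMeasurable.sub hf.1).enorm) hφf] with x hx
    rw [tendsto_iff_edist_tendsto_0]
    simpa [edist_eq_enorm_sub] using hx
  have p2 := ae_tendsto_lintegral_line (fun n => (hNc n).aestronglyMeasurable.sub hg.1) hφg i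
  have q1 : Measure.QuasiMeasurePreserving (fun z : ℝ × (Fin m → ℝ) => z.2)
      (unitMeasure.prod (cubeMeasure m)) (cubeMeasure m) := Measure.quasiMeasurePreserving_snd
  have q2 : Measure.QuasiMeasurePreserving (fun z : ℝ × (Fin m → ℝ) => z.1)
      (unitMeasure.prod (cubeMeasure m)) unitMeasure := Measure.quasiMeasurePreserving_fst
  filter_upwards [q1.ae p1, ae_update p1 i, q1.ae p2, q1.ae (ae_integrable_line hg i),
    q1.ae ae_mem_interior_cube, q2.ae ae_mem_Ioo]
  rintro ⟨c, x⟩ a1 a2 a3 a4 a5 hc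
  simp only at a1 a2 a3 a4 a5 hc ⊢
  rw [mem_interior_cube] at a5
  rw [integrable_unitMeasure_iff] at a4
  have hcx : uIcc c (x i) ⊆ uIcc 0 1 :=
    uIcc_subset_uIcc_zero_one ⟨hc.1.le, hc.2.le⟩ ⟨(a5 i).1.le, (a5 i).2.le⟩
  have hNi : ∀ n s t, IntervalIntegrable (fun s => N n (Function.update x i s)) volume s t :=
    fun n s t => Continuous.intervalIntegrable
      ((hNc n).comp (continuous_const.update i continuous_id)) s t
  have t1 : Tendsto (fun n => ∫ s in c..x i, N n (Function.update x i s)) atTop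
      (𝓝 (∫ s in c..x i, g (Function.update x i s))) := by
    rw [tendsto_iff_norm_sub_tendsto_zero]
    refine squeeze_zero (fun _ => norm_nonneg _) (fun n => ?_) (tendsto_intervalIntegral_norm a3)
    rw [← intervalIntegral.integral_sub (hNi n _ _) (a4.mono_set hcx)]
    refine intervalIntegral.norm_integral_le_integral_norm_uIoc.trans ?_
    rw [intervalIntegral.integral_of_le zero_le_one]
    refine setIntegral_mono_set ?_ (.of_forall fun _ => norm_nonneg _) (.of_forall ?_)
    · have := ((hNi n 0 1).sub a4).norm
      rwa [intervalIntegrable_iff_integrableOn_Ioc_of_le zero_le_one] at this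
    · intro s hs
      exact ⟨(lt_min hc.1 (a5 i).1).trans hs.1, hs.2.trans (max_le hc.2.le (a5 i).2.le)⟩
  refine tendsto_nhds_unique a1 ((a2.add t1).congr' ?_)
  obtain ⟨δ, hδ0, hδx, hδc⟩ : ∃ δ > 0, (∀ k, x k ∈ Icc δ (1 - δ)) ∧ c ∈ Icc δ (1 - δ) := by
    obtain ⟨δ, ⟨e1, e2⟩, e4⟩ := (((eventually_all.2 fun k => eventually_mem_Icc_margin (a5 k)).and
      (eventually_mem_Icc_margin hc)).and
        (eventually_mem_nhdsWithin (a := (0 : ℝ)) (s := Ioi 0))).exists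
    exact ⟨δ, e4, e1, e2⟩
  filter_upwards [hφr.eventually_lt_const hδ0] with n hn
  have hderiv : ∀ s ∈ uIcc c (x i), HasDerivAt (fun s => M n (Function.update x i s))
      (N n (Function.update x i s)) s := by
    intro s hs
    have htest : IsTestFunction (fun y => (φ n).normed volume (Function.update x i s - y)) := by
      refine isTestFunction_comp_sub (φ n).contDiff_normed (φ n).support_normed_eq.subset
        (fun k => ?_) hn
      by_cases hk : k = i
      · subst hk
        simpa using (uIcc_subset_Icc hδc (hδx k)) hs
      · simpa [hk] using hδx k
    have e := h.fderiv_moll hf (φ n).contDiff_normed (φ n).hasCompactSupport_normed htest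
    have := (((hMs n).differentiable (by simp)) (Function.update x i
        s)).hasFDerivAt.comp_hasDerivAt s
      (hasDerivAt_update x i s)
    simp only [hM, hN] at this ⊢
    rw [e] at this
    exact this
  rw [intervalIntegral.integral_eq_sub_of_hasDerivAt hderiv (hNi n _ _), Function.update_eq_self]
  abel

/-- If `A` is the logarithmic derivative of `v`, then `v` follows the transports of `A` on almost
every line. -/
lemma ae_eq_mul_par_of_hasWeakPartialDeriv (hι : Manifold.IsSmoothEmbedding 𝓘(ℝ, E) 𝓘(ℝ, V) ∞ ι)
    {A : (Fin m → ℝ) → E} (hA : Integrable A (cubeMeasure m)) {v : (Fin m → ℝ) → G}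
    (hv : AEStronglyMeasurable v (cubeMeasure m)) {i : Fin m}
    (h : HasWeakPartialDeriv i (fun x => ι (v x)) (fun x => leftDeriv (E := E) ι (v x) (A x))) :
    ∀ᵐ c ∂unitMeasure, ∀ᵐ x ∂(cubeMeasure m), ∀ᵐ s ∂unitMeasure, v (Function.update x i s) =
      v (Function.update x i c) * par ι (fun s => A (Function.update x i s)) c s := by
  have : CompleteSpace V := FiniteDimensional.complete ℝ V
  have hc := hι.contMDiff.continuous
  obtain ⟨B, hB⟩ := (isCompact_univ (X := G)).exists_bound_of_continuousOn hc.continuousOn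
  have hfv : Integrable (fun x => ι (v x)) (cubeMeasure m) :=
    Integrable.of_bound (hc.comp_aestronglyMeasurable hv) B (.of_forall fun x => hB _ (mem_univ _))
  have hg : Integrable (fun x => leftDeriv (E := E) ι (v x) (A x)) (cubeMeasure m) :=
    integrable_leftDeriv_apply hι.contMDiff ((continuous_leftDeriv
        hι.contMDiff).comp_aestronglyMeasurable hv) hA
  filter_upwards [Measure.ae_ae_of_ae_prod (h.ae_eq_add_integral hfv hg), ae_mem_Ioo] with c h1 hcm
  filter_upwards [ae_ae_update h1 i, ae_integrable_line hg i, ae_integrable_line hA i]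
    with x h2 h3 h4
  rw [integrable_unitMeasure_iff] at h3 h4
  have hcI : c ∈ Icc (0 : ℝ) 1 := ⟨hcm.1.le, hcm.2.le⟩
  have h0 : (0 : ℝ) ∈ Icc (0 : ℝ) 1 := by simp
  simp only [Function.update_idem, Function.update_self] at h2
  set a : ℝ → E := fun s => A (Function.update x i s)
  set g : ℝ → V := fun s => leftDeriv (E := E) ι (v (Function.update x i s)) (A (Function.update x
      i s))
  set Φ : ℝ → V := fun t => ι (v (Function.update x i c)) + ∫ s in c..t, g s
  have hΦc : ContinuousOn Φ (Icc 0 1) := by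
    have := intervalIntegral.continuousOn_primitive_interval' h3
      (by rwa [uIcc_of_le zero_le_one] : c ∈ uIcc (0 : ℝ) 1)
    rw [uIcc_of_le zero_le_one] at this
    exact continuousOn_const.add this
  -- The primitive takes values in the closed set `range ι`, hence comes from a path in the group.
  have hclosed : IsClosed (range ι) := (isCompact_range hc).isClosed
  have hrange : ∀ t ∈ Icc (0 : ℝ) 1, Φ t ∈ range ι := by
    have e : EqOn (fun t => Metric.infDist (Φ t) (range ι)) (fun _ => 0) (Icc 0 1) := by
      refine Measure.eqOn_Icc_of_ae_eq (μ := volume) zero_ne_one ?_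
        ((Metric.continuous_infDist_pt _).comp_continuousOn hΦc) continuousOn_const
      change _ =ᵐ[unitMeasure] _
      filter_upwards [h2] with s hs
      rw [show Φ s = ι (v (Function.update x i s)) from hs.symm]
      exact Metric.infDist_zero_of_mem (mem_range_self _)
    intro t ht
    exact (hclosed.mem_iff_infDist_zero (range_nonempty ι)).2 (e ht)
  set γ : ℝ → G := fun t => Function.invFun ι (Φ t)
  have hγ : ∀ t ∈ Icc (0 : ℝ) 1, ι (γ t) = Φ t := fun t ht => Function.invFun_eq (hrange t ht)
  have hγv : ∀ᵐ s ∂unitMeasure, s ∈ Icc (0 : ℝ) 1 ∧ γ s = v (Function.update x i s) := by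
    filter_upwards [h2, ae_mem_Ioo] with s hs hm
    have hm' : s ∈ Icc (0 : ℝ) 1 := ⟨hm.1.le, hm.2.le⟩
    exact ⟨hm', hι.isEmbedding.injective ((hγ s hm').trans hs.symm)⟩
  have hsol : IsSol ι a γ := by
    refine ⟨?_, fun t ht => ?_⟩
    · rw [hι.isEmbedding.isInducing.continuousOn_iff]
      exact hΦc.congr hγ
    · rw [hγ t ht, hγ 0 h0]
      have hsub : ∀ y ∈ Icc (0 : ℝ) 1, IntervalIntegrable g volume c y := fun y hy =>
        h3.mono_set (uIcc_subset_uIcc_zero_one hcI hy)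
      have e1 := intervalIntegral.integral_interval_sub_left (hsub t ht) (hsub 0 h0)
      have e2 : ∫ τ in (0 : ℝ)..t, leftDeriv (E := E) ι (γ τ) (a τ) = ∫ τ in (0 : ℝ)..t, g τ := by
        rw [intervalIntegral.integral_of_le ht.1, intervalIntegral.integral_of_le ht.1]
        have hle : volume.restrict (Ioc 0 t) ≤ unitMeasure := by
          have : Ioc 0 t ⊆ Icc (0 : ℝ) 1 := fun s hs => ⟨hs.1.le, hs.2.trans ht.2⟩
          exact Measure.restrict_mono this le_rfl
        refine integral_congr_ae ?_
        filter_upwards [ae_mono hle hγv] with s hs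
        rw [hs.2]
      rw [e2, ← e1]
      simp only [Φ]
      abel
  have hγc : γ c = v (Function.update x i c) :=
    hι.isEmbedding.injective ((hγ c hcI).trans (by simp [Φ]))
  filter_upwards [hγv] with s hs
  rw [← hs.2, ← hγc]
  exact hsol.eq_mul_par hι h4 hcI hs.1

/-- Measurability turns independence of a coordinate along almost every line into independence
for almost every pair of points. -/
lemma ae_update_eq_of_ae_ae [TopologicalSpace.MetrizableSpace G] {w : (Fin m → ℝ) → G}
    (hw : AEStronglyMeasurable w (cubeMeasure m)) {i : Fin m}
    (h : ∀ᵐ c ∂unitMeasure, ∀ᵐ x ∂(cubeMeasure m), ∀ᵐ s ∂unitMeasure,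
      w (Function.update x i s) = w (Function.update x i c)) :
    ∀ᵐ z ∂(unitMeasure.prod (cubeMeasure m)), w z.2 = w (Function.update z.2 i z.1) := by
  obtain ⟨w', hw', hww'⟩ := hw
  have hU := ae_update hww' i
  have q1 : Measure.QuasiMeasurePreserving (fun z : ℝ × (Fin m → ℝ) => z.2)
      (unitMeasure.prod (cubeMeasure m)) (cubeMeasure m) := Measure.quasiMeasurePreserving_snd
  suffices H : ∀ᵐ z ∂(unitMeasure.prod (cubeMeasure m)),
      z ∈ {z : ℝ × (Fin m → ℝ) | w' z.2 = w' (Function.update z.2 i z.1)} by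
    filter_upwards [H, hU, q1.ae hww'] with z h1 h2 h3
    rw [h2, h3]; exact h1
  have hS : MeasurableSet {z : ℝ × (Fin m → ℝ) | w' z.2 = w' (Function.update z.2 i z.1)} :=
    StronglyMeasurable.measurableSet_eq_fun (hw'.comp_measurable measurable_snd)
      (hw'.comp_measurable (measurePreserving_update i).measurable)
  rw [Measure.ae_prod_mem_iff_ae_ae_mem hS]
  filter_upwards [h, Measure.ae_ae_of_ae_prod hU] with c h1 h2
  have hSc : MeasurableSet {x : Fin m → ℝ | (c, x) ∈
      {z : ℝ × (Fin m → ℝ) | w' z.2 = w' (Function.update z.2 i z.1)}} := measurable_prodMk_left hS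
  have key := (lintegral_update (m := m) ((measurable_one.indicator
    hSc.compl).aemeasurable (f := indicator _ (1 : (Fin m → ℝ) → ℝ≥0∞))) i).2
  rw [lintegral_indicator_one hSc.compl] at key
  rw [ae_iff]
  refine key.symm.trans ?_
  rw [← lintegral_zero (μ := cubeMeasure m)]
  refine lintegral_congr_ae ?_
  filter_upwards [h1, h2, ae_ae_update hww' i] with x a1 a2 a3
  rw [← lintegral_zero (μ := unitMeasure)]
  refine lintegral_congr_ae ?_
  filter_upwards [a1, a3] with s b1 b2
  refine indicator_of_notMem ?_ _
  simp only [mem_compl_iff, mem_ofPred_eq, not_not, Function.update_idem]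
  rw [← a2, ← b2, b1]

end Converse

/-! ### Forms with values in the Lie algebra, and uniqueness -/

section Forms

variable {m : ℕ} {E : Type*} [NormedAddCommGroup E] [NormedSpace ℝ E] [FiniteDimensional ℝ E]
  {G : Type*} [TopologicalSpace G] [ChartedSpace E G] [Group G] [LieGroup 𝓘(ℝ, E) ∞ G]

lemma memLp_of_forall_dual {α : Type*} [MeasurableSpace α] {μ : Measure α} {p : ENNReal}
    {f : α → E} (h : ∀ l : E →L[ℝ] ℝ, MemLp (fun x => l (f x)) p μ) : MemLp f p μ := by
  have e := ContinuousLinearEquiv.ofFinrankEq (𝕜 := ℝ) (E := E)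
    (F := Fin (Module.finrank ℝ E) → ℝ) (by simp)
  have h1 : MemLp (fun x => e (f x)) p μ :=
    memLp_pi_iff.2 fun k => h ((ContinuousLinearMap.proj k).comp e.toContinuousLinearMap)
  have := e.symm.toContinuousLinearMap.comp_memLp' h1
  simpa [Function.comp_def] using this

lemma IsL2Form.memLp {A : Fin m → (Fin m → ℝ) → GroupLieAlgebra 𝓘(ℝ, E) G} (hA : IsL2Form A)
    (i : Fin m) : MemLp (ε := E) (A i) 2 (cubeMeasure m) :=
  memLp_of_forall_dual fun l => hA i l

/-- Linear functionals separate points, so flatness tested by them is flatness of the vector-valued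
integral. -/
lemma IsDistributionallyFlat.isFlat {A : Fin m → (Fin m → ℝ) → GroupLieAlgebra 𝓘(ℝ, E) G}
    (hA : IsL2Form A) (h : IsDistributionallyFlat A) :
    IsFlat (E := E) G A := by
  intro i j φ hφ
  have hL : ∀ i, MemLp (ε := E) (A i) 2 (cubeMeasure m) := hA.memLp
  have hd : Continuous (fderiv ℝ φ) := hφ.smooth.continuous_fderiv (by simp)
  have hdi : ∀ i, Continuous (fun x => partialDeriv i φ x) := fun i => hd.clm_apply continuous_const
  obtain ⟨B, hB⟩ := hφ.smooth.continuous.bounded_above_of_compact_support hφ.compact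
  have i1 : ∀ i j, Integrable (ε := E) (fun x => partialDeriv i φ x • A j x) (cubeMeasure m) := by
    intro i j
    obtain ⟨B', hB'⟩ := (hdi i).bounded_above_of_compact_support ((hφ.compact.fderiv ℝ).comp_left
      (g := fun T : (Fin m → ℝ) →L[ℝ] ℝ => T (Pi.single i 1)) rfl)
    exact ((hL j).integrable one_le_two).bdd_smul B' (hdi i).aestronglyMeasurable (.of_forall hB')
  have i2 : Integrable (fun x => φ x • br E G (A i x) (A j x)) (cubeMeasure m) :=
    (integrable_br G (hL i) (hL j)).bdd_smul B hφ.smooth.continuous.aestronglyMeasurable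
      (.of_forall hB)
  refine SeparatingDual.eq_zero_of_forall_dual_eq_zero (R := ℝ) fun l => ?_
  refine (ContinuousLinearMap.integral_comp_comm l (((i1 i j).neg.add (i1 j i)).add i2)).symm.trans
    (Eq.trans (integral_congr_ae (.of_forall fun x => ?_)) (h i j l φ hφ))
  have key : ∀ (a b c : E) (p q r : ℝ),
      l (-(p • b) + q • a + r • c) = -(p * l b) + q * l a + r * l c := fun a b c p q r => by
    simp only [map_add, map_neg, map_smul, smul_eq_mul]
  exact (key _ _ _ _ _ _).trans (congrArg
    (fun c : E => -(partialDeriv i φ x * l (A j x)) + partialDeriv j φ x * l (A i x) + φ x * l c)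
    (bracket_eq_br (A i x) (A j x)).symm)

end Forms

section Uniqueness

variable {m : ℕ} {E : Type*} [NormedAddCommGroup E] [NormedSpace ℝ E] [FiniteDimensional ℝ E]
  {G : Type*} [TopologicalSpace G] [ChartedSpace E G] [Group G] [LieGroup 𝓘(ℝ, E) ∞ G]
  [CompactSpace G] {V : Type*} [NormedAddCommGroup V] [NormedSpace ℝ V] [FiniteDimensional ℝ V]
  {ι : G → V}

/-- Two maps with the same logarithmic derivative differ by a left translation: the quotient
`u v⁻¹` is independent of every coordinate, because both maps follow the same transports. -/
lemma exists_ae_eq_mul_of_hasWeakPartialDeriv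
    (hι : Manifold.IsSmoothEmbedding 𝓘(ℝ, E) 𝓘(ℝ, V) ∞ ι)
    {A : Fin m → (Fin m → ℝ) → E} (hA : ∀ i, Integrable (A i) (cubeMeasure m))
    {u v : (Fin m → ℝ) → G} (hu : AEStronglyMeasurable (fun x => ι (u x)) (cubeMeasure m))
    (hv : AEStronglyMeasurable (fun x => ι (v x)) (cubeMeasure m))
    (hu' : ∀ i, HasWeakPartialDeriv i (fun x => ι (u x)) (fun x => leftDeriv (E := E) ι (u x) (A i
        x)))
    (hv' : ∀ i, HasWeakPartialDeriv i (fun x => ι (v x)) (fun x => leftDeriv (E := E) ι (v x) (A i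
        x))) :
    ∃ g : G, ∀ᵐ x ∂(cubeMeasure m), u x = g * v x := by
  have := topologicalGroup_of_lieGroup 𝓘(ℝ, E) ∞ (G := G)
  have := hι.isEmbedding.metrizableSpace
  have hum := hι.isEmbedding.aestronglyMeasurable_comp_iff.1 hu
  have hvm := hι.isEmbedding.aestronglyMeasurable_comp_iff.1 hv
  obtain ⟨g, hg⟩ := ae_eq_const_of_ae_update (w := fun x => u x * (v x)⁻¹) fun i =>
    ae_update_eq_of_ae_ae (hum.mul hvm.inv) (by
      filter_upwards [ae_eq_mul_par_of_hasWeakPartialDeriv hι (hA i) hum (hu' i),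
        ae_eq_mul_par_of_hasWeakPartialDeriv hι (hA i) hvm (hv' i)] with c h1 h2
      filter_upwards [h1, h2] with x h1 h2
      filter_upwards [h1, h2] with s h1 h2
      rw [Pi.mul_apply, Pi.mul_apply, Pi.inv_apply, Pi.inv_apply, h1, h2, mul_inv_rev, mul_assoc,
          mul_inv_cancel_left])
  exact ⟨g, hg.mono fun x hx => by rw [← hx, inv_mul_cancel_right]⟩

end Uniqueness

end FlatForms

theorem mainTheorem9 {E : Type*} [NormedAddCommGroup E] [NormedSpace ℝ E] [FiniteDimensional ℝ E]
    {G : Type*} [TopologicalSpace G] [ChartedSpace E G] [Group G] [LieGroup 𝓘(ℝ, E) ∞ G]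
    [CompactSpace G]
    {V : Type*} [NormedAddCommGroup V] [NormedSpace ℝ V] [FiniteDimensional ℝ V]
    (ι : G → V) (hι : Manifold.IsSmoothEmbedding 𝓘(ℝ, E) 𝓘(ℝ, V) ∞ ι)
    (m : ℕ) (A : Fin m → (Fin m → ℝ) → GroupLieAlgebra 𝓘(ℝ, E) G)
    (hA : FlatForms.IsL2Form A) (hflat : FlatForms.IsDistributionallyFlat A) :
    (∃ u : (Fin m → ℝ) → G,
      FlatForms.MemW12Embedded ι u ∧ FlatForms.MemW12Embedded ι (fun x => (u x)⁻¹) ∧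
        FlatForms.IsLogDeriv ι u A) ∧
    (∀ u v : (Fin m → ℝ) → G,
      FlatForms.MemW12Embedded ι u → FlatForms.MemW12Embedded ι (fun x => (u x)⁻¹) →
        FlatForms.IsLogDeriv ι u A →
      FlatForms.MemW12Embedded ι v → FlatForms.MemW12Embedded ι (fun x => (v x)⁻¹) →
        FlatForms.IsLogDeriv ι v A →
      ∃ g : G, ∀ᵐ x ∂(FlatForms.cubeMeasure m), u x = g * v x) := by
  have hL : ∀ i, MemLp (ε := E) (A i) 2 (FlatForms.cubeMeasure m) := hA.memLp
  have hI : ∀ i, Integrable (ε := E) (A i) (FlatForms.cubeMeasure m) := fun i =>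
    (hL i).integrable one_le_two
  have hT : ∀ (u : (Fin m → ℝ) → G) (i : Fin m),
      (fun x => FlatForms.leftTranslate ι (u x) (A i x)) =
        fun x => FlatForms.leftDeriv (E := E) ι (u x) (A i x) := fun u i =>
    funext fun x => FlatForms.leftTranslate_eq hι.contMDiff _ _
  refine ⟨?_, fun u v hu _ hud hv _ hvd => ?_⟩
  · obtain ⟨u, hum, hu⟩ := (hflat.isFlat hA).exists_gauge hι hL
    refine ⟨u, FlatForms.memW12_of_ae_eq hι hι.contMDiff
      (FlatForms.norm_sub_le_gdist' hι.contMDiff.continuous) hL hum hu,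
      FlatForms.memW12_of_ae_eq hι (f := fun g => ι g⁻¹)
        (hι.contMDiff.comp (contMDiff_inv 𝓘(ℝ, E) ∞)) (fun g h => ?_) hL hum hu, fun i => ?_⟩
    · exact (FlatForms.norm_sub_le_gdist' hι.contMDiff.continuous _ _).trans_eq
        (FlatForms.gdist_inv hι.contMDiff.continuous g h)
    · rw [hT]
      exact FlatForms.hasWeakPartialDeriv_of_ae_eq hι hι.contMDiff
        (FlatForms.norm_sub_le_gdist' hι.contMDiff.continuous) (hI i) hum (hu i)
  · exact FlatForms.exists_ae_eq_mul_of_hasWeakPartialDeriv hι hI hu.1.1 hv.1.1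
      (fun i => hT u i ▸ hud i) (fun i => hT v i ▸ hvd i)
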